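/- Let $d\ge 2$, let $\Omega\subset\mathbb{R}^d$ be a bounded domain (nonempty, open, connected) with Lipschitz boundary, let $\sigma$ be the surface measure on $\partial\Omega$, and let $b:\partial\Omega\to\mathbb{R}$ be bounded and measurable. Let $-\Delta_b$ be the self-adjoint operator in $L^2(\Omega)$ generated by the quadratic form $$\int_\Omega|\nabla v|^2\,dx+\int_{\partial\Omega}b\,|v|^2\,d\sigma,\qquad v\in H^1(\Omega),$$ where $v$ on $\partial\Omega$ is understood in the sense of traces. For $\Lambda>0$ and a real-valued $\phi\in C^1_0(\mathbb{R}^d)$ (continuously differentiable on $\mathbb{R}^d$ with compact support, not necessarily vanishing on $\partial\Omega$) let $\phi(-\Delta_b-\Lambda)\phi$ be the self-adjoint operator in $L^2(\Omega)$ generated by the quadratic form $$v\mapsto \int_\Omega|\nabla(\phi v)|^2\,dx+\int_{\partial\Omega}b\,|\phi v|^2\,d\sigma-\Lambda\int_\Omega|\phi v|^2\,dx,\qquad v\in L^2(\Omega),\ \phi v\in H^1(\Omega).$$ For such an operator $A$ let $\operatorname{Tr}A_-$ be the sum of the absolute values of its negative eigenvalues, counted with multiplicity. Let $\omega_d$ be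 the volume of the unit ball in $\mathbb{R}^d$ and $L^{(1)}_d=\frac{2}{d+2}(2\pi)^{-d}\omega_d$. Then for every $\Lambda>0$ and every real-valued $\phi\in C_0^1(\mathbb{R}^d)$ $$\operatorname{Tr}\bigl(\phi(-\Delta_b-\Lambda)\phi\bigr)_-\ \ge\ L^{(1)}_d\,\Lambda^{1+d/2}\int_\Omega|\phi|^2\,dx-\frac{\omega_d}{(2\pi)^d}\,\Lambda^{d/2}\left(\int_{\partial\Omega}b\,|\phi|^2\,d\sigma+\int_\Omega|\nabla\phi|^2\,dx\right),$$ and, in particular, $$\operatorname{Tr}(-\Delta_b-\Lambda)_-\ \ge\ L^{(1)}_d\,|\Omega|\,\Lambda^{1+d/2}-\frac{\omega_d}{(2\pi)^d}\,\Lambda^{d/2}\int_{\partial\Omega}b\,d\sigma .$$ -/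

import Mathlib

open MeasureTheory Filter Topology
open scoped ENNReal ContDiff InnerProductSpace

noncomputable section

namespace Robin

/-- `d`-dimensional Euclidean space. -/
abbrev E (d : ℕ) := EuclideanSpace ℝ (Fin d)

/-! ### Lipschitz domains and surface measure -/

/-- The boundary of `Ω` is Lipschitz: near every boundary point, after the choice of a unit
vector `n` (the "vertical" direction), `Ω` is the region strictly above the graph of a Lipschitz
function `γ` over the hyperplane orthogonal to `n`. -/
def HasLipschitzBoundary {d : ℕ} (Ω : Set (E d)) : Prop :=
  ∀ x ∈ frontier Ω, ∃ (r : ℝ) (n : E d) (K : NNReal) (γ : (ℝ ∙ n)ᗮ → ℝ),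
    0 < r ∧ ‖n‖ = 1 ∧ LipschitzWith K γ ∧
    ∀ y ∈ Metric.ball x r, y ∈ Ω ↔ γ ((ℝ ∙ n)ᗮ.orthogonalProjectionOnto y) < ⟪n, y⟫_ℝ

/-- A bounded Lipschitz domain: nonempty, open, connected, bounded, with Lipschitz boundary. -/
structure IsBoundedLipschitzDomain {d : ℕ} (Ω : Set (E d)) : Prop where
  isOpen : IsOpen Ω
  isConnected : IsConnected Ω
  isBounded : Bornology.IsBounded Ω
  lipschitz : HasLipschitzBoundary Ω

/-- The `(d-1)`-dimensional surface measure on `∂Ω` (the Hausdorff measure, normalised to agree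
with Lebesgue measure on hyperplanes). -/
def surface {d : ℕ} (Ω : Set (E d)) : Measure (E d) :=
  (Measure.euclideanHausdorffMeasure (d - 1) : Measure (E d)).restrict (frontier Ω)

/-! ### The Sobolev space `H¹(Ω)` and the boundary trace -/

/-- The classical gradient `(∂₁u, …, ∂_d u)` of a complex-valued function. -/
def cgrad {d : ℕ} (u : E d → ℂ) (x : E d) : EuclideanSpace ℂ (Fin d) :=
  WithLp.toLp 2 fun i => fderiv ℝ u x (EuclideanSpace.single i 1)

/-- `G ∈ L²(Ω; ℂ^d)` is the weak (distributional) gradient of `f` in `Ω`. -/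
def HasWeakGrad {d : ℕ} (Ω : Set (E d)) (f : E d → ℂ) (G : E d → EuclideanSpace ℂ (Fin d)) :
    Prop :=
  MemLp G 2 (volume.restrict Ω) ∧
    ∀ ψ : E d → ℝ, ContDiff ℝ ∞ ψ → HasCompactSupport ψ → tsupport ψ ⊆ Ω → ∀ i : Fin d,
      ∫ x in Ω, (fderiv ℝ ψ x (EuclideanSpace.single i 1) : ℂ) * f x =
        -∫ x in Ω, (ψ x : ℂ) * G x i

/-- `f ∈ H¹(Ω)`: both `f` and its weak gradient are square integrable over `Ω`. -/
def MemH1 {d : ℕ} (Ω : Set (E d)) (f : E d → ℂ) : Prop :=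
  MemLp f 2 (volume.restrict Ω) ∧ ∃ G, HasWeakGrad Ω f G

open Classical in
/-- The weak gradient of `f` in `Ω` (unique up to null sets; `0` if there is none). -/
def weakGrad {d : ℕ} (Ω : Set (E d)) (f : E d → ℂ) : E d → EuclideanSpace ℂ (Fin d) :=
  if h : ∃ G, HasWeakGrad Ω f G then h.choose else 0

/-- `g ∈ L²(∂Ω)` is the boundary trace of `f ∈ H¹(Ω)`: it is the limit in `L²(∂Ω)` of the
restrictions to `∂Ω` of functions in `C¹(Ω̄)` (restrictions of compactly supported `C¹` functions
on the whole space) that converge to `f` in `H¹(Ω)`. -/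
def HasTrace {d : ℕ} (Ω : Set (E d)) (f g : E d → ℂ) : Prop :=
  MemH1 Ω f ∧ MemLp g 2 (surface Ω) ∧
    ∃ u : ℕ → E d → ℂ,
      (∀ n, ContDiff ℝ 1 (u n) ∧ HasCompactSupport (u n)) ∧
      Tendsto (fun n => eLpNorm (u n - f) 2 (volume.restrict Ω)) atTop (𝓝 0) ∧
      Tendsto (fun n => eLpNorm (cgrad (u n) - weakGrad Ω f) 2 (volume.restrict Ω))
        atTop (𝓝 0) ∧
      Tendsto (fun n => eLpNorm (u n - g) 2 (surface Ω)) atTop (𝓝 0)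

open Classical in
/-- The boundary trace of `f`. On a bounded Lipschitz domain every `f ∈ H¹(Ω)` has a boundary
trace, unique up to null sets of the surface measure; the default value is `0`. -/
def trace {d : ℕ} (Ω : Set (E d)) (f : E d → ℂ) : E d → ℂ :=
  if h : ∃ g, HasTrace Ω f g then h.choose else 0

/-- The sesquilinear form (conjugate-linear in `f`) of `-Δ_b - Λ`, with form domain `H¹(Ω)`:
`∫_Ω ∇f̄·∇g dx + ∫_{∂Ω} b f̄ g dσ - Λ ∫_Ω f̄ g dx`. -/
def robinForm {d : ℕ} (Ω : Set (E d)) (b : E d → ℝ) (Λ : ℝ) (f g : E d → ℂ) : ℂ :=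
  (∫ x in Ω, ⟪weakGrad Ω f x, weakGrad Ω g x⟫_ℂ)
    + (∫ x, (b x : ℂ) * ⟪trace Ω f x, trace Ω g x⟫_ℂ ∂(surface Ω))
    - (Λ : ℂ) * ∫ x in Ω, ⟪f x, g x⟫_ℂ

/-! ### Operators generated by forms and the trace of their negative part -/

section Abstract

variable {H : Type*} [NormedAddCommGroup H] [InnerProductSpace ℂ H]

/-- The operator `A` generated by the form `a` with form domain `D`, given through its graph:
`v ∈ dom A` and `A v = f` if and only if `v ∈ D` and `a(w, v) = ⟪w, f⟫` for all `w ∈ D`. -/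
def FormOperator (D : Set H) (a : H → H → ℂ) (v f : H) : Prop :=
  v ∈ D ∧ ∀ w ∈ D, a w v = ⟪w, f⟫_ℂ

/-- The multiplicity of `μ` as an eigenvalue of the operator generated by `(D, a)`: the dimension
of the space of solutions of `A v = μ v` (`0` if `μ` is not an eigenvalue). -/
def eigMultiplicity (D : Set H) (a : H → H → ℂ) (μ : ℝ) : ℕ∞ :=
  Cardinal.toENat
    (Module.rank ℂ (Submodule.span ℂ {v : H | FormOperator D a v ((μ : ℂ) • v)}))

/-- `Tr A₋ = ∑ (μ_n)₋` for the operator `A` generated by `(D, a)`: the sum of `-μ` over all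
negative eigenvalues `μ` of `A`, counted with multiplicity (`ENNReal.ofReal (-μ)` is the negative
part `μ₋`). -/
def negTrace (D : Set H) (a : H → H → ℂ) : ℝ≥0∞ :=
  ∑' μ : ℝ, ENNReal.ofReal (-μ) * (eigMultiplicity D a μ : ℝ≥0∞)

end Abstract

/-! ### The operator `φ (-Δ_b - Λ) φ` -/

/-- The Hilbert space `L²(Ω)` of complex-valued functions. -/
abbrev L2 {d : ℕ} (Ω : Set (E d)) := Lp ℂ 2 (volume.restrict Ω)

/-- The product `φ v`. -/
def mulFun {d : ℕ} {Ω : Set (E d)} (φ : E d → ℝ) (v : L2 Ω) : E d → ℂ :=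
  fun x => (φ x : ℂ) * v x

/-- The form domain of `φ (-Δ_b - Λ) φ`: all `v ∈ L²(Ω)` with `φ v ∈ H¹(Ω)`. -/
def localizedDomain {d : ℕ} (Ω : Set (E d)) (φ : E d → ℝ) : Set (L2 Ω) :=
  {v | MemH1 Ω (mulFun φ v)}

/-- The form of `φ (-Δ_b - Λ) φ`, that is, the form of `-Δ_b - Λ` evaluated at `φ w, φ v`. -/
def localizedForm {d : ℕ} (Ω : Set (E d)) (b : E d → ℝ) (Λ : ℝ) (φ : E d → ℝ) (w v : L2 Ω) : ℂ :=
  robinForm Ω b Λ (mulFun φ w) (mulFun φ v)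

/-- `Tr (φ (-Δ_b - Λ) φ)₋`. -/
def localizedNegTrace {d : ℕ} (Ω : Set (E d)) (b : E d → ℝ) (Λ : ℝ) (φ : E d → ℝ) : ℝ≥0∞ :=
  negTrace (localizedDomain Ω φ) (localizedForm Ω b Λ φ)

/-- `Tr (-Δ_b - Λ)₋`, the operator `-Δ_b - Λ` having form domain `H¹(Ω)`. -/
def robinNegTrace {d : ℕ} (Ω : Set (E d)) (b : E d → ℝ) (Λ : ℝ) : ℝ≥0∞ :=
  negTrace {v : L2 Ω | MemH1 Ω v} (fun w v : L2 Ω => robinForm Ω b Λ w v)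

/-! ### Constants -/

/-- `ω_d`, the volume of the unit ball in `ℝ^d`. -/
def omega (d : ℕ) : ℝ := volume.real (Metric.ball (0 : E d) 1)

/-- `L_d^{(1)} = 2 / (d + 2) * (2π)^{-d} * ω_d`. -/
def L1 (d : ℕ) : ℝ := 2 / ((d : ℝ) + 2) * ((2 * Real.pi) ^ d)⁻¹ * omega d

end Robin

end

namespace Robin

/-! ### Negative eigenvalues of forms bounded below by a finite rank form -/

section NegativeSpectrum

open ComplexConjugate

variable {V H : Type*} [NormedAddCommGroup V] [NormedSpace ℂ V] [NormedAddCommGroup H]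
  [InnerProductSpace ℂ H]

/-! The bound is Berezin's argument with plane waves as test functions. Write a for the form of
φ(-Δ_b - Λ)φ and e_ξ(x) = exp(2πi⟨x, ξ⟩) on Ω. Suppose that v_i are orthonormal eigenvectors with
eigenvalues μ_i < 0 and that a(w, w) ≥ ∑ μ_i |⟨v_i, w⟩|² on the whole form domain. Since φ is real,
testing with w = e_ξ gives exactly a(e_ξ, e_ξ) = (4π²|ξ|² - Λ) A + S with A = ∫_Ω φ² and S = ∫_∂Ω b
φ² + ∫_Ω |∇φ|². Integrate over the ball |ξ| < R. By Plancherel ∫ |⟨v_i, e_ξ⟩|² dξ ≤ 1, and μ_i < 0,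
so ∑ μ_i ≤ ω_d R^d ((d/(d+2)) 4π²R² A - Λ A + S). The choice 4π²R² = Λ is the claim. This is carried
by `sum_le_of_forall_planeWave_le` and `planeWave_mem_localizedDomain`. The second bound is the case
of a cutoff equal to 1 near the closure of Ω.

The work lies in producing the v_i (`exists_localized_eigenfunctions`). Where φ vanishes the form
does not control v, so a compact resolvent is not available. Instead the negative part is shown to
have finite rank: the trace inequality absorbs the boundary term into half of the gradient, leaving
a(v, v) ≥ ½‖∇(φv)‖² - C‖φv‖², and compactness of H¹(Ω) in L²(Ω), in the form ‖f‖² ≤ ε‖∇f‖² + C ∑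
|⟨g_k, f⟩|², bounds a below by minus finitely many squared functionals of v. For such forms
`exists_negative_eigenvectors` yields a finite family exhausting the negative part.

The weak gradient and the trace are given by arbitrary choice. They are pinned down by realising
H¹(Ω) as the closure `sobolevTriple` of the triples (u, ∇u, u|∂Ω) with u of class C¹. Density of C¹
functions and the trace inequality show that every H¹ function has exactly one such triple. -/

theorem form_eq_zero_of_null {q : V →ₗ⋆[ℂ] V →ₗ[ℂ] ℂ} (hsymm : ∀ x y, conj (q x y) = q y x)
    {S : Submodule ℂ V} (hpos : ∀ x ∈ S, 0 ≤ (q x x).re) {x w : V} (hx : x ∈ S)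
    (h0 : (q x x).re = 0) (hw : w ∈ S) : q w x = 0 := by
  by_contra hz
  set z := q w x with hzdef
  have hz2 : 0 < ‖z‖ ^ 2 := by positivity
  -- Along w - s z̄ x the term quadratic in s vanishes because q(x, x) has real part 0.
  -- Nonnegativity then bounds a linear function of s for all real s, which forces z = 0.
  have key : ∀ s : ℝ, 2 * s * ‖z‖ ^ 2 ≤ (q w w).re := by
    intro s
    have h := hpos (w + (-(s : ℂ) * conj z) • x) (S.add_mem hw (S.smul_mem _ hx))
    have hxw : q x w = conj z := by rw [hzdef, hsymm]
    have hzz : z * conj z = (‖z‖ ^ 2 : ℝ) := by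
      rw [Complex.mul_conj, Complex.normSq_eq_norm_sq]
    have e : q (w + (-(s : ℂ) * conj z) • x) (w + (-(s : ℂ) * conj z) • x)
        = q w w - 2 * s * (z * conj z) + (s : ℂ) ^ 2 * (z * conj z) * q x x := by
      simp only [map_add, LinearMap.add_apply, map_smul, LinearMap.map_smulₛₗ, LinearMap.smul_apply,
        smul_eq_mul, hxw, map_mul, map_neg, Complex.conj_ofReal, Complex.conj_conj]
      rw [← hzdef]
      ring
    rw [e, hzz] at h
    have e2 : (q w w - 2 * s * ((‖z‖ ^ 2 : ℝ) : ℂ) + (s : ℂ) ^ 2 * ((‖z‖ ^ 2 : ℝ) : ℂ) * q x x).re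
        = (q w w).re - 2 * s * ‖z‖ ^ 2 + s ^ 2 * ‖z‖ ^ 2 * (q x x).re := by
      have e3 : q w w - 2 * s * ((‖z‖ ^ 2 : ℝ) : ℂ) + (s : ℂ) ^ 2 * ((‖z‖ ^ 2 : ℝ) : ℂ) * q x x
        = q w w - ((2 * s * ‖z‖ ^ 2 : ℝ) : ℂ) + ((s ^ 2 * ‖z‖ ^ 2 : ℝ) : ℂ) * q x x := by
        push_cast; ring
      rw [e3, Complex.add_re, Complex.sub_re, Complex.ofReal_re, Complex.re_ofReal_mul]
    rw [e2, h0] at h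
    linarith
  have h1 := key (((q w w).re + 1) / (2 * ‖z‖ ^ 2))
  have h2 : 2 * (((q w w).re + 1) / (2 * ‖z‖ ^ 2)) * ‖z‖ ^ 2 = (q w w).re + 1 := by
    field_simp
  linarith

/-- The parallelogram identity with the nonnegative term q(x + y, x + y) dropped. It makes
minimizing sequences Cauchy with respect to q. -/
theorem form_sub_le {q : V →ₗ⋆[ℂ] V →ₗ[ℂ] ℂ} {S : Submodule ℂ V}
    (hpos : ∀ x ∈ S, 0 ≤ (q x x).re) {x y : V} (hx : x ∈ S) (hy : y ∈ S) :
    (q (x - y) (x - y)).re ≤ 2 * (q x x).re + 2 * (q y y).re := by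
  have h := hpos (x + y) (S.add_mem hx hy)
  have e : q (x - y) (x - y) + q (x + y) (x + y) = 2 * q x x + 2 * q y y := by
    simp only [map_add, map_sub, LinearMap.add_apply, LinearMap.sub_apply]
    ring
  have e' := congrArg Complex.re e
  simp only [Complex.add_re, Complex.mul_re, Complex.re_ofNat, Complex.im_ofNat] at e'
  linarith

theorem form_re_smul (q : V →ₗ⋆[ℂ] V →ₗ[ℂ] ℂ) (r : ℝ) (x : V) :
    (q ((r : ℂ) • x) ((r : ℂ) • x)).re = r ^ 2 * (q x x).re := by
  have : q ((r : ℂ) • x) ((r : ℂ) • x) = ((r ^ 2 : ℝ) : ℂ) * q x x := by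
    simp only [map_smul, LinearMap.map_smulₛₗ, LinearMap.smul_apply, smul_eq_mul,
      Complex.conj_ofReal]
    push_cast; ring
  rw [this, Complex.re_ofReal_mul]

/-- A form that is bounded below by a finite rank form attains its negative minimum over the unit
sphere of any closed subspace. -/
theorem exists_minimizer [CompleteSpace V] (j : V →L[ℂ] H) (α : V →ₗ⋆[ℂ] V →ₗ[ℂ] ℂ)
    (hsymm : ∀ x y, conj (α x y) = α y x) (hcont : Continuous fun x => (α x x).re)
    {c M : ℝ} (hc : 0 < c) (hG : ∀ x, c * ‖x‖ ^ 2 ≤ (α x x).re + M * ‖j x‖ ^ 2)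
    {ι : Type*} [Fintype ι] (g : ι → H) (hK : ∀ x, -∑ k, ‖⟪g k, j x⟫_ℂ‖ ^ 2 ≤ (α x x).re)
    {S : Submodule ℂ V} (hS : IsClosed (S : Set V)) {y : V} (hyS : y ∈ S)
    (hy : (α y y).re < 0) :
    ∃ x ∈ S, ∃ m : ℝ, m < 0 ∧ ‖j x‖ = 1 ∧ ∀ w ∈ S, α w x = m * ⟪j w, j x⟫_ℂ := by
  have hj0 : ∀ x, j x = 0 → 0 ≤ (α x x).re := by
    intro x hx
    simpa [hx] using hK x
  have hjy : 0 < ‖j y‖ := by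
    rw [norm_pos_iff]
    intro h
    exact absurd (hj0 y h) (not_le.2 hy)
  set R : Set ℝ := {r | ∃ x ∈ S, ‖j x‖ = 1 ∧ (α x x).re = r} with hR
  have hnormalize : ∀ x ∈ S, j x ≠ 0 → ‖j x‖⁻¹ ^ 2 * (α x x).re ∈ R := by
    intro x hx hjx
    refine ⟨((‖j x‖⁻¹ : ℝ) : ℂ) • x, S.smul_mem _ hx, ?_, form_re_smul α _ x⟩
    rw [map_smul, norm_smul, Complex.norm_real, norm_inv, norm_norm,
      inv_mul_cancel₀ (norm_ne_zero_iff.2 hjx)]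
  have hbdd : BddBelow R := by
    refine ⟨-∑ k, ‖g k‖ ^ 2, ?_⟩
    rintro r ⟨x, -, hx1, rfl⟩
    refine le_trans (neg_le_neg (Finset.sum_le_sum fun k _ => ?_)) (hK x)
    have := norm_inner_le_norm (𝕜 := ℂ) (g k) (j x)
    rw [hx1, mul_one] at this
    gcongr
  have hyR := hnormalize y hyS (norm_pos_iff.1 hjy)
  have hne : R.Nonempty := ⟨_, hyR⟩
  set m := sInf R with hm
  have hm0 : m < 0 := by
    refine lt_of_le_of_lt (csInf_le hbdd hyR) ?_
    exact mul_neg_of_pos_of_neg (by positivity) hy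
  -- Subtracting the infimum m of the Rayleigh quotient makes the form nonnegative on S. A minimizer
  -- is then a null vector of q.
  let q : V →ₗ⋆[ℂ] V →ₗ[ℂ] ℂ := LinearMap.mk₂'ₛₗ (starRingEnd ℂ) (RingHom.id ℂ)
    (fun x y => α x y - m * ⟪j x, j y⟫_ℂ)
    (by intro a b e; simp; ring)
    (by intro a b e; simp; ring)
    (by intro a b e; simp; ring)
    (by intro a b e; simp; ring)
  have hq : ∀ x y, q x y = α x y - m * ⟪j x, j y⟫_ℂ := fun x y => rfl
  have hqre : ∀ x, (q x x).re = (α x x).re - m * ‖j x‖ ^ 2 := by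
    intro x
    rw [hq, inner_self_eq_norm_sq_to_K, Complex.sub_re]
    congr 1
    rw [Complex.re_ofReal_mul]
    congr 1
    norm_cast
  have hqs : ∀ x y, conj (q x y) = q y x := by
    intro x y
    rw [hq, hq, map_sub, hsymm, map_mul, inner_conj_symm, Complex.conj_ofReal]
  have hqpos : ∀ x ∈ S, 0 ≤ (q x x).re := by
    intro x hx
    rw [hqre]
    by_cases hjx : j x = 0
    · simpa [hjx] using hj0 x hjx
    · have h := csInf_le hbdd (hnormalize x hx hjx)
      have hp : 0 < ‖j x‖ ^ 2 := by positivity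
      rw [← hm, inv_pow, inv_mul_eq_div, le_div_iff₀ hp] at h
      linarith
  obtain ⟨u, -, hut, huR⟩ := exists_seq_tendsto_sInf hne hbdd
  choose x hxS hx1 hxu using huR
  have hqx : Tendsto (fun n => (q (x n) (x n)).re) atTop (𝓝 0) := by
    have : (fun n => (q (x n) (x n)).re) = fun n => u n - m := by
      funext n
      rw [hqre, hx1, hxu]; ring
    rw [this, ← sub_self m]
    exact hut.sub_const m
  -- Only finitely many functionals occur in the lower bound, so Bolzano–Weierstrass in a
  -- finite-dimensional space suffices to extract a subsequence.
  obtain ⟨l, -, φ, hφ, hl⟩ := tendsto_subseq_of_bounded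
    (s := Metric.closedBall (0 : ι → ℂ) (∑ k, ‖g k‖)) Metric.isBounded_closedBall
    (x := fun n k => ⟪g k, j (x n)⟫_ℂ) (by
      intro n
      rw [mem_closedBall_zero_iff, pi_norm_le_iff_of_nonneg (by positivity)]
      intro k
      have := norm_inner_le_norm (𝕜 := ℂ) (g k) (j (x n))
      rw [hx1, mul_one] at this
      exact this.trans (Finset.single_le_sum (f := fun k => ‖g k‖) (fun _ _ => norm_nonneg _)
        (Finset.mem_univ k)))
  have hcauchy : CauchySeq (x ∘ φ) := by
    rw [cauchySeq_iff_tendsto_dist_atTop_0]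
    set F : ℕ × ℕ → ℝ := fun p => 2 * (q (x (φ p.1)) (x (φ p.1))).re
      + 2 * (q (x (φ p.2)) (x (φ p.2))).re with hF
    set G : ℕ × ℕ → ℝ := fun p => ∑ k, ‖⟪g k, j (x (φ p.1))⟫_ℂ - ⟪g k, j (x (φ p.2))⟫_ℂ‖ ^ 2
      with hGdef
    have h1 : Tendsto (fun p : ℕ × ℕ => p.1) atTop atTop := by
      rw [← prod_atTop_atTop_eq]; exact tendsto_fst
    have h2 : Tendsto (fun p : ℕ × ℕ => p.2) atTop atTop := by
      rw [← prod_atTop_atTop_eq]; exact tendsto_snd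
    have hF0 : Tendsto F atTop (𝓝 0) := by
      have a := ((hqx.comp hφ.tendsto_atTop).comp h1).const_mul 2
      have b := ((hqx.comp hφ.tendsto_atTop).comp h2).const_mul 2
      simpa using a.add b
    have hG0 : Tendsto G atTop (𝓝 0) := by
      have : Tendsto G atTop (𝓝 (∑ k, ‖l k - l k‖ ^ 2)) := by
        refine tendsto_finsetSum _ fun k _ => ?_
        have a := ((tendsto_pi_nhds.1 hl k).comp h1)
        have b := ((tendsto_pi_nhds.1 hl k).comp h2)
        exact ((a.sub b).norm).pow 2
      simpa using this
    -- For a difference d, the lower bound reads -G ≤ α(d, d) = q(d, d) + m‖j d‖² in real parts. As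
    -- m < 0, this controls ‖j d‖² by (F + G)/(-m), and coercivity then controls ‖d‖².
    have hbound : ∀ p : ℕ × ℕ, dist ((x ∘ φ) p.1) ((x ∘ φ) p.2) ^ 2
        ≤ c⁻¹ * (F p + |M| * ((F p + G p) / (-m))) := by
      intro p
      set d := x (φ p.1) - x (φ p.2) with hd
      have a1 := form_sub_le hqpos (hxS (φ p.1)) (hxS (φ p.2))
      rw [← hd] at a1
      have a2 := hK d
      have a3 := hG d
      have a4 := hqre d
      have a5 : ∑ k, ‖⟪g k, j d⟫_ℂ‖ ^ 2 = G p := by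
        simp only [hGdef, hd, map_sub, inner_sub_right]
      rw [a5] at a2
      have a6 : ‖j d‖ ^ 2 ≤ (F p + G p) / (-m) := by
        rw [le_div_iff₀ (by linarith)]
        simp only [hF]
        linarith
      have a7 : (M + m) * ‖j d‖ ^ 2 ≤ |M| * ((F p + G p) / (-m)) := by
        refine le_trans ?_ (mul_le_mul_of_nonneg_left a6 (abs_nonneg M))
        gcongr
        linarith [le_abs_self M]
      rw [dist_eq_norm, inv_mul_eq_div, le_div_iff₀ hc]
      have a8 : (x ∘ φ) p.1 - (x ∘ φ) p.2 = d := rfl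
      rw [a8]
      have : (q d d).re ≤ F p := a1
      linarith
    have hlim : Tendsto (fun p => c⁻¹ * (F p + |M| * ((F p + G p) / (-m)))) atTop (𝓝 0) := by
      have := (hF0.add (((hF0.add hG0).div_const (-m)).const_mul |M|)).const_mul c⁻¹
      simpa using this
    have hsq := squeeze_zero (fun p => sq_nonneg _) hbound hlim
    have := hsq.sqrt
    simpa [Real.sqrt_sq dist_nonneg] using this
  obtain ⟨z, hz⟩ := cauchySeq_tendsto_of_complete hcauchy
  have hzS : z ∈ S := hS.mem_of_tendsto hz (Eventually.of_forall fun n => hxS _)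
  have hz1 : ‖j z‖ = 1 := by
    have : Tendsto (fun n => ‖j ((x ∘ φ) n)‖) atTop (𝓝 ‖j z‖) :=
      (((j.continuous.norm).tendsto z).comp hz)
    refine tendsto_nhds_unique this ?_
    simp [hx1]
  have hqz : (q z z).re = 0 := by
    have hqc : Continuous fun x => (q x x).re := by
      simp only [hqre]
      exact hcont.sub ((j.continuous.norm.pow 2).const_mul m)
    exact tendsto_nhds_unique ((hqc.tendsto z).comp hz) (hqx.comp hφ.tendsto_atTop)
  -- The limit is null for q, hence lies in the radical of q on S. That is the eigenvalue equation
  -- against every w in S.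
  refine ⟨z, hzS, m, hm0, hz1, fun w hw => ?_⟩
  have := form_eq_zero_of_null hqs hqpos hzS hqz hw
  rw [hq] at this
  linear_combination this

/-- The form is negative definite on the span of the x i, while it is nonnegative at any vector
whose image is orthogonal to all g k. Hence the g k separate points of the span, and its dimension
is at most their number. -/
theorem card_negative_eigenvectors_le (j : V →L[ℂ] H) (α : V →ₗ⋆[ℂ] V →ₗ[ℂ] ℂ)
    {ι : Type*} [Fintype ι] (g : ι → H) (hK : ∀ x, -∑ k, ‖⟪g k, j x⟫_ℂ‖ ^ 2 ≤ (α x x).re)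
    {n : ℕ} {x : Fin n → V} {μ : Fin n → ℝ} (hx : Orthonormal ℂ fun i => j (x i))
    (hμ : ∀ i, μ i < 0) (he : ∀ i w, α w (x i) = μ i * ⟪j w, j (x i)⟫_ℂ) :
    n ≤ Fintype.card ι := by
  let L : (Fin n → ℂ) →ₗ[ℂ] (ι → ℂ) := LinearMap.pi fun k =>
    ((innerSL ℂ (g k)).toLinearMap.comp j.toLinearMap).comp (Fintype.linearCombination ℂ x)
  have hL : ∀ c k, L c k = ⟪g k, j (∑ i, c i • x i)⟫_ℂ := fun c k => rfl
  have hinj : Function.Injective L := by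
    rw [← LinearMap.ker_eq_bot, LinearMap.ker_eq_bot']
    intro c hc
    set y := ∑ i, c i • x i with hy
    have h1 : 0 ≤ (α y y).re := by
      have := hK y
      have h0 : ∀ k, ⟪g k, j y⟫_ℂ = 0 := fun k => by rw [← hL, hc]; rfl
      simpa [h0] using this
    have h2 : α y y = ∑ i, ((μ i * ‖c i‖ ^ 2 : ℝ) : ℂ) := by
      conv_lhs => enter [2]; rw [hy]
      rw [map_sum]
      refine Finset.sum_congr rfl fun i _ => ?_
      have hjy : j y = ∑ i, c i • j (x i) := by simp [hy]
      rw [map_smul, smul_eq_mul, he, hjy, hx.inner_left_fintype]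
      have := Complex.mul_conj (c i)
      rw [Complex.normSq_eq_norm_sq] at this
      push_cast at this ⊢
      linear_combination (μ i : ℂ) * this
    have h3 : ∀ i ∈ Finset.univ, μ i * ‖c i‖ ^ 2 ≤ 0 := fun i _ =>
      mul_nonpos_of_nonpos_of_nonneg (hμ i).le (sq_nonneg _)
    rw [h2, ← Complex.ofReal_sum, Complex.ofReal_re] at h1
    have h4 := (Finset.sum_eq_zero_iff_of_nonpos h3).1 (le_antisymm (Finset.sum_nonpos h3) h1)
    funext i
    have h5 := h4 i (Finset.mem_univ i)
    simpa [(hμ i).ne] using h5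
  have := LinearMap.finrank_le_finrank_of_injective hinj
  simpa using this

/-- A form that is bounded below by a finite rank form has a finite orthonormal family of
eigenvectors with negative eigenvalues that exhausts its negative part. -/
theorem exists_negative_eigenvectors [CompleteSpace V] (j : V →L[ℂ] H) (α : V →ₗ⋆[ℂ] V →ₗ[ℂ] ℂ)
    (hsymm : ∀ x y, conj (α x y) = α y x) (hcont : Continuous fun x => (α x x).re)
    {c M : ℝ} (hc : 0 < c) (hG : ∀ x, c * ‖x‖ ^ 2 ≤ (α x x).re + M * ‖j x‖ ^ 2)
    {ι : Type*} [Fintype ι] (g : ι → H) (hK : ∀ x, -∑ k, ‖⟪g k, j x⟫_ℂ‖ ^ 2 ≤ (α x x).re) :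
    ∃ (n : ℕ) (x : Fin n → V) (μ : Fin n → ℝ), Orthonormal ℂ (fun i => j (x i)) ∧
      (∀ i, μ i < 0) ∧ (∀ i w, α w (x i) = μ i * ⟪j w, j (x i)⟫_ℂ) ∧
      ∀ w, ∑ i, μ i * ‖⟪j (x i), j w⟫_ℂ‖ ^ 2 ≤ (α w w).re := by
  classical
  let P : ℕ → Prop := fun n => ∃ (x : Fin n → V) (μ : Fin n → ℝ),
    Orthonormal ℂ (fun i => j (x i)) ∧ (∀ i, μ i < 0) ∧
      ∀ i w, α w (x i) = μ i * ⟪j w, j (x i)⟫_ℂ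
  have hP0 : P 0 := by
    refine ⟨Fin.elim0, Fin.elim0, ⟨fun i => i.elim0, fun i => i.elim0⟩, fun i => i.elim0,
      fun i => i.elim0⟩
  have hPle : ∀ n, P n → n ≤ Fintype.card ι := by
    rintro n ⟨x, μ, hx, hμ, he⟩
    exact card_negative_eigenvectors_le j α g hK hx hμ he
  -- A family of maximal size exists since sizes are bounded. Were the form negative somewhere on
  -- its orthogonal complement S, a minimizer there would enlarge it.
  set n := Nat.findGreatest P (Fintype.card ι) with hn
  have hPn : P n := Nat.findGreatest_spec (Nat.zero_le _) hP0
  have hPn1 : ¬ P (n + 1) := fun h =>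
    absurd (Nat.le_findGreatest (hPle _ h) h) (by omega)
  obtain ⟨x, μ, hx, hμ, he⟩ := hPn
  refine ⟨n, x, μ, hx, hμ, he, fun w => ?_⟩
  let S : Submodule ℂ V := ⨅ i, ((innerSL ℂ (j (x i))).comp j).ker
  have hSmem : ∀ v, v ∈ S ↔ ∀ i, ⟪j (x i), j v⟫_ℂ = 0 := fun v => by
    simp [S, Submodule.mem_iInf]
  have hSclosed : IsClosed (S : Set V) := by
    simp only [S, Submodule.coe_iInf]
    exact isClosed_iInter fun i => ContinuousLinearMap.isClosed_ker _
  have hSpos : ∀ y ∈ S, 0 ≤ (α y y).re := by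
    intro y hyS
    by_contra! hy
    obtain ⟨z, hzS, m, hm, hz1, hzw⟩ := exists_minimizer j α hsymm hcont hc hG g hK hSclosed hyS hy
    rw [hSmem] at hzS
    refine hPn1 ⟨Fin.cons z x, Fin.cons m μ, ?_, ?_, ?_⟩
    · constructor
      · intro i
        refine Fin.cases ?_ (fun i => ?_) i
        · simpa using hz1
        · simpa using hx.1 i
      · intro i k
        refine Fin.cases ?_ (fun i => ?_) i <;> refine Fin.cases ?_ (fun k => ?_) k
        · simp
        · intro _
          simp only [Fin.cons_zero, Fin.cons_succ]
          rw [← inner_conj_symm, hzS, map_zero]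
        · intro _
          simpa using hzS i
        · intro hik
          simpa using hx.2 (fun h => hik (congrArg Fin.succ h))
    · intro i
      refine Fin.cases ?_ (fun i => ?_) i
      · simpa using hm
      · simpa using hμ i
    · intro i v
      refine Fin.cases ?_ (fun i => ?_) i
      · simp only [Fin.cons_zero]
        -- The minimizer satisfies the eigenvalue equation only against S. Removing the components
        -- along the x i brings v into S, and both sides of the equation vanish at the x i.
        set v' := v - ∑ i, ⟪j (x i), j v⟫_ℂ • x i with hv'
        have hv'S : v' ∈ S := by
          rw [hSmem]
          intro i
          rw [hv', map_sub, map_sum, inner_sub_right]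
          simp only [map_smul]
          rw [hx.inner_right_fintype, sub_self]
        have hxz : ∀ i, α (x i) z = 0 := by
          intro i
          rw [← hsymm, he, ← inner_conj_symm, hzS]
          simp
        have hv : v = v' + ∑ i, ⟪j (x i), j v⟫_ℂ • x i := by rw [hv']; abel
        have e1 : α v z = α v' z := by
          rw [hv]
          simp [hxz]
        have e2 : ⟪j v, j z⟫_ℂ = ⟪j v', j z⟫_ℂ := by
          conv_lhs => rw [hv]
          simp [hzS]
        rw [e1, e2, hzw v' hv'S]
      · simpa using he i v
  -- In the splitting of w into w' ∈ S and its components along the x i, the cross terms of α vanish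
  -- and the w' part is nonnegative.
  set w' := w - ∑ i, ⟪j (x i), j w⟫_ℂ • x i with hw'
  have hw'S : w' ∈ S := by
    rw [hSmem]
    intro i
    rw [hw', map_sub, map_sum, inner_sub_right]
    simp only [map_smul]
    rw [hx.inner_right_fintype, sub_self]
  have hw'pos := hSpos w' hw'S
  rw [hSmem] at hw'S
  have hxw : ∀ i, α (x i) w' = 0 := by
    intro i
    rw [← hsymm, he, ← inner_conj_symm, hw'S]
    simp
  have e1 : ∀ i, ⟪j w, j (x i)⟫_ℂ = conj ⟪j (x i), j w⟫_ℂ := fun i => by rw [inner_conj_symm]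
  have hw : w = w' + ∑ i, ⟪j (x i), j w⟫_ℂ • x i := by rw [hw']; abel
  have e2 : α w w = α w' w' + ∑ i, ((μ i * ‖⟪j (x i), j w⟫_ℂ‖ ^ 2 : ℝ) : ℂ) := by
    have e3 : α w w' = α w' w' := by
      conv_lhs => enter [1]; rw [hw]
      simp [hxw]
    conv_lhs => enter [2]; rw [hw]
    rw [map_add, e3, map_sum]
    congr 1
    refine Finset.sum_congr rfl fun i _ => ?_
    rw [map_smul, smul_eq_mul, he, e1]
    have := Complex.mul_conj ⟪j (x i), j w⟫_ℂ
    rw [Complex.normSq_eq_norm_sq] at this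
    push_cast at this ⊢
    linear_combination (μ i : ℂ) * this
  rw [e2, ← Complex.ofReal_sum, Complex.add_re, Complex.ofReal_re]
  linarith

/-- Grouping the indices by the value of μ, orthonormal eigenvectors with a common value are
linearly independent in that eigenspace, so their number is at most its multiplicity. For a lower
bound on the trace it is not necessary to know that all negative eigenvalues were found. -/
theorem sum_ofReal_neg_le_negTrace (D : Set H) (a : H → H → ℂ) {n : ℕ} {v : Fin n → H}
    {μ : Fin n → ℝ} (hv : Orthonormal ℂ v)
    (he : ∀ i, FormOperator D a (v i) ((μ i : ℂ) • v i)) :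
    ∑ i, ENNReal.ofReal (-μ i) ≤ negTrace D a := by
  classical
  have hcard : ∀ r : ℝ, ((Finset.univ.filter fun i => μ i = r).card : ℕ∞)
      ≤ eigMultiplicity D a r := by
    intro r
    set s := Finset.univ.filter fun i => μ i = r with hs
    let w : s → Submodule.span ℂ {v : H | FormOperator D a v ((r : ℂ) • v)} := fun i =>
      ⟨v i, Submodule.subset_span (by
        have h := (Finset.mem_filter.1 i.2).2
        have := he i
        rw [h] at this
        exact this)⟩
    have hw : LinearIndependent ℂ w := by
      refine LinearIndependent.of_comp (Submodule.subtype _) ?_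
      exact hv.linearIndependent.comp (fun i : s => (i : Fin n)) Subtype.val_injective
    have := hw.cardinal_lift_le_rank
    rw [Cardinal.mk_coe_finset, Cardinal.lift_natCast, Cardinal.nat_le_lift_iff] at this
    have h2 := Cardinal.toENat.monotone' this
    simpa [eigMultiplicity] using h2
  calc ∑ i, ENNReal.ofReal (-μ i)
      = ∑ r ∈ Finset.univ.image μ,
          ENNReal.ofReal (-r) * ((Finset.univ.filter fun i => μ i = r).card : ℝ≥0∞) := by
        rw [← Finset.sum_fiberwise_of_maps_to (s := Finset.univ) (t := Finset.univ.image μ)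
          (g := μ) (fun i hi => Finset.mem_image_of_mem μ hi)]
        refine Finset.sum_congr rfl fun r _ => ?_
        rw [Finset.sum_congr rfl (g := fun _ => ENNReal.ofReal (-r)) (fun i hi => by
          rw [(Finset.mem_filter.1 hi).2]), Finset.sum_const, nsmul_eq_mul, mul_comm]
    _ ≤ ∑ r ∈ Finset.univ.image μ,
          ENNReal.ofReal (-r) * (eigMultiplicity D a r : ℝ≥0∞) := by
        refine Finset.sum_le_sum fun r _ => ?_
        gcongr
        have := hcard r
        exact_mod_cast (ENat.toENNReal_le.2 this)
    _ ≤ negTrace D a := ENNReal.sum_le_tsum _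

end NegativeSpectrum

/-! ### Plane waves and Plancherel's identity -/

section Fourier

open FourierTransform SchwartzMap

theorem norm_sq_eq_integral {α F : Type*} [MeasurableSpace α] {μ : Measure α}
    [NormedAddCommGroup F] [InnerProductSpace ℂ F] (g : Lp F 2 μ) :
    ‖g‖ ^ 2 = ∫ x, ‖g x‖ ^ 2 ∂μ := by
  have h : ⟪g, g⟫_ℂ = ∫ x, ⟪g x, g x⟫_ℂ ∂μ := L2.inner_def g g
  simp only [inner_self_eq_norm_sq_to_K] at h
  have h2 : ((‖g‖ ^ 2 : ℝ) : ℂ) = ((∫ x, ‖g x‖ ^ 2 ∂μ : ℝ) : ℂ) := by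
    refine Eq.trans (by push_cast; rfl) (h.trans (Eq.trans ?_ integral_ofReal))
    push_cast
    rfl
  exact_mod_cast h2

variable {W : Type*} [NormedAddCommGroup W] [InnerProductSpace ℝ W] [FiniteDimensional ℝ W]
  [MeasurableSpace W] [BorelSpace W]

/-- On L¹ ∩ L² the abstract L² Fourier transform agrees with the Fourier integral: against a smooth
compactly supported g, both pair to the integral of 𝓕 g times f, the first as a tempered
distribution and the second by Fubini. -/
theorem fourier_toLp_ae_eq {f : W → ℂ} (hf : MemLp f 2) (hfi : Integrable f) :
    (𝓕 (hf.toLp f) : Lp ℂ 2 (volume : Measure W)) =ᵐ[volume] 𝓕 f := by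
  have hcont : Continuous (𝓕 f) := VectorFourier.fourierIntegral_continuous
    Real.continuous_fourierChar (L := innerₗ W) (by exact continuous_inner) hfi
  refine ae_eq_of_integral_contDiff_smul_eq
    ((Lp.memLp _).locallyIntegrable (by norm_num)) hcont.locallyIntegrable fun g hg hgc => ?_
  have hg₁ : HasCompactSupport (Complex.ofRealCLM ∘ g) := hgc.comp_left rfl
  have hg₂ : ContDiff ℝ ∞ (Complex.ofRealCLM ∘ g) := by fun_prop
  set G : 𝓢(W, ℂ) := hg₁.toSchwartzMap hg₂ with hG
  have hGx : ∀ x, G x = (g x : ℂ) := fun x => rfl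
  have h1 : ∫ x, G x • (𝓕 (hf.toLp f) : Lp ℂ 2 (volume : Measure W)) x
      = ∫ x, (𝓕 G) x • (hf.toLp f) x := by
    rw [← Lp.toTemperedDistribution_apply, ← Lp.toTemperedDistribution_apply,
      ← Lp.fourier_toTemperedDistribution_eq]
    rfl
  have h2 : ∫ x, (𝓕 G) x • f x = ∫ x, G x • 𝓕 f x := by
    have := VectorFourier.integral_fourierIntegral_smul_eq_flip (μ := volume) (ν := volume)
      (L := innerₗ W) Real.continuous_fourierChar (by exact continuous_inner) G.integrable hfi
    rw [flip_innerₗ] at this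
    exact this
  have h3 : ∫ x, (𝓕 G) x • (hf.toLp f) x = ∫ x, (𝓕 G) x • f x := by
    refine integral_congr_ae ?_
    filter_upwards [hf.coeFn_toLp] with x hx
    rw [hx]
  have h4 := h1.trans (h3.trans h2)
  simpa only [hGx, Complex.real_smul, smul_eq_mul] using h4

theorem integrable_norm_sq_fourier {f : W → ℂ} (hf : MemLp f 2) (hfi : Integrable f) :
    Integrable fun ξ => ‖𝓕 f ξ‖ ^ 2 := by
  have h := fourier_toLp_ae_eq hf hfi
  have := (memLp_two_iff_integrable_sq_norm ((Lp.memLp _).1)).1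
    (Lp.memLp (𝓕 (hf.toLp f) : Lp ℂ 2 (volume : Measure W)))
  refine this.congr ?_
  filter_upwards [h] with x hx
  rw [hx]

theorem integral_norm_sq_fourier {f : W → ℂ} (hf : MemLp f 2) (hfi : Integrable f) :
    ∫ ξ, ‖𝓕 f ξ‖ ^ 2 = ∫ x, ‖f x‖ ^ 2 := by
  have h := fourier_toLp_ae_eq hf hfi
  have h1 : ∫ ξ, ‖𝓕 f ξ‖ ^ 2
      = ∫ ξ, ‖(𝓕 (hf.toLp f) : Lp ℂ 2 (volume : Measure W)) ξ‖ ^ 2 := by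
    refine integral_congr_ae ?_
    filter_upwards [h] with x hx
    rw [hx]
  rw [h1, ← norm_sq_eq_integral, Lp.norm_fourier_eq, norm_sq_eq_integral]
  refine integral_congr_ae ?_
  filter_upwards [hf.coeFn_toLp] with x hx
  rw [hx]

end Fourier

/-! ### Plane waves in L²(Ω) and moments of balls. -/

section PlaneWave

open FourierTransform

variable {d : ℕ}

/-- The plane wave `x ↦ exp (2πi ⟨x, ξ⟩)`. -/
noncomputable def planeWave (ξ x : E d) : ℂ :=
  Complex.exp (2 * Real.pi * ⟪x, ξ⟫_ℝ * Complex.I)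

theorem norm_planeWave (ξ x : E d) : ‖planeWave ξ x‖ = 1 := by
  rw [planeWave]
  have := Complex.norm_exp_ofReal_mul_I (2 * Real.pi * ⟪x, ξ⟫_ℝ)
  push_cast at this
  exact this

theorem contDiff_planeWave (ξ : E d) : ContDiff ℝ ∞ (planeWave ξ) := by
  unfold planeWave
  have : ContDiff ℝ ∞ fun x : E d => (⟪x, ξ⟫_ℝ : ℂ) :=
    Complex.ofRealCLM.contDiff.comp (contDiff_id.inner ℝ contDiff_const)
  exact Complex.contDiff_exp.comp ((contDiff_const.mul this).mul contDiff_const)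

theorem memLp_planeWave {Ω : Set (E d)} (hΩ : volume Ω ≠ ⊤) (ξ : E d) :
    MemLp (planeWave ξ) 2 (volume.restrict Ω) := by
  have : IsFiniteMeasure (volume.restrict Ω) := ⟨by simpa using hΩ.lt_top⟩
  refine MemLp.of_bound (contDiff_planeWave ξ).continuous.aestronglyMeasurable 1 ?_
  exact Eventually.of_forall fun x => (norm_planeWave ξ x).le

/-- The inner product is conjugate-linear in its first slot, so it is the complex conjugate of the
Fourier transform of v extended by zero. -/
theorem norm_inner_planeWave {Ω : Set (E d)} (hΩ : volume Ω ≠ ⊤) (hΩm : MeasurableSet Ω)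
    (v : L2 Ω) (ξ : E d) :
    ‖⟪v, (memLp_planeWave hΩ ξ).toLp⟫_ℂ‖ = ‖𝓕 (Ω.indicator v) ξ‖ := by
  have h1 : ⟪v, (memLp_planeWave hΩ ξ).toLp⟫_ℂ
      = ∫ x in Ω, planeWave ξ x * (starRingEnd ℂ) (v x) := by
    rw [L2.inner_def]
    refine integral_congr_ae ?_
    filter_upwards [(memLp_planeWave hΩ ξ).coeFn_toLp] with x hx
    rw [hx]
    simp
  have h2 : 𝓕 (Ω.indicator v) ξ
      = (starRingEnd ℂ) (∫ x in Ω, planeWave ξ x * (starRingEnd ℂ) (v x)) := by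
    rw [← integral_conj, Real.fourier_eq', ← integral_indicator hΩm]
    refine integral_congr_ae (Eventually.of_forall fun x => ?_)
    by_cases hx : x ∈ Ω
    · simp only [Set.indicator_of_mem hx, smul_eq_mul, map_mul, Complex.conj_conj]
      congr 1
      rw [planeWave, ← Complex.exp_conj]
      congr 1
      simp only [map_mul, Complex.conj_ofReal, Complex.conj_I, map_ofNat]
      push_cast
      ring
    · simp [Set.indicator_of_notMem hx]
  rw [h1, h2, RCLike.norm_conj]

theorem integrable_norm_sq_inner_planeWave {Ω : Set (E d)} (hΩ : volume Ω ≠ ⊤)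
    (hΩm : MeasurableSet Ω) (v : L2 Ω) :
    Integrable fun ξ => ‖⟪v, (memLp_planeWave hΩ ξ).toLp⟫_ℂ‖ ^ 2 := by
  have : IsFiniteMeasure (volume.restrict Ω) := ⟨by simpa using hΩ.lt_top⟩
  have hv : MemLp (Ω.indicator v) 2 volume := (memLp_indicator_iff_restrict hΩm).2 (Lp.memLp v)
  have hvi : Integrable (Ω.indicator v) volume :=
    (integrable_indicator_iff hΩm).2 ((Lp.memLp v).integrable (by norm_num))
  simp only [norm_inner_planeWave hΩ hΩm]
  exact integrable_norm_sq_fourier hv hvi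

/-- Plancherel gives equality when s is the whole space. The 2π in the exponent of the plane wave
removes any constant. -/
theorem integral_norm_sq_inner_planeWave_le {Ω : Set (E d)} (hΩ : volume Ω ≠ ⊤)
    (hΩm : MeasurableSet Ω) (v : L2 Ω) (s : Set (E d)) :
    ∫ ξ in s, ‖⟪v, (memLp_planeWave hΩ ξ).toLp⟫_ℂ‖ ^ 2 ≤ ‖v‖ ^ 2 := by
  have : IsFiniteMeasure (volume.restrict Ω) := ⟨by simpa using hΩ.lt_top⟩
  have hv : MemLp (Ω.indicator v) 2 volume := (memLp_indicator_iff_restrict hΩm).2 (Lp.memLp v)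
  have hvi : Integrable (Ω.indicator v) volume :=
    (integrable_indicator_iff hΩm).2 ((Lp.memLp v).integrable (by norm_num))
  refine (setIntegral_le_integral (integrable_norm_sq_inner_planeWave hΩ hΩm v)
    (Eventually.of_forall fun ξ => by positivity)).trans ?_
  simp only [norm_inner_planeWave hΩ hΩm]
  rw [integral_norm_sq_fourier hv hvi, norm_sq_eq_integral, ← integral_indicator hΩm]
  refine (integral_congr_ae (Eventually.of_forall fun x => ?_)).le
  by_cases hx : x ∈ Ω
  · simp [hx]
  · simp [hx]

theorem volume_real_ball {R : ℝ} (hR : 0 < R) :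
    volume.real (Metric.ball (0 : E d) R) = R ^ d * omega d := by
  rw [Measure.real, Measure.addHaar_ball_of_pos _ _ hR, ENNReal.toReal_mul,
    ENNReal.toReal_ofReal (by positivity), finrank_euclideanSpace_fin]
  rfl

theorem integral_norm_sq_ball (hd : d ≠ 0) {R : ℝ} (hR : 0 < R) :
    ∫ ξ in Metric.ball (0 : E d) R, ‖ξ‖ ^ 2 = d / (d + 2) * omega d * R ^ (d + 2) := by
  have : Nonempty (Fin d) := ⟨⟨0, Nat.pos_of_ne_zero hd⟩⟩
  rw [← integral_indicator measurableSet_ball]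
  have h1 : (Metric.ball (0 : E d) R).indicator (fun ξ => ‖ξ‖ ^ 2)
      = fun ξ => (Set.Iio R).indicator (fun r => r ^ 2) ‖ξ‖ := by
    funext ξ
    by_cases h : ‖ξ‖ < R
    · rw [Set.indicator_of_mem (by simpa using h), Set.indicator_of_mem (by simpa using h)]
    · rw [Set.indicator_of_notMem (by simpa using h), Set.indicator_of_notMem (by simpa using h)]
  rw [h1, integral_fun_norm_addHaar]
  have h2 : ∫ y in Set.Ioi (0 : ℝ), y ^ (Module.finrank ℝ (E d) - 1) •
      (Set.Iio R).indicator (fun r => r ^ 2) y = R ^ (d + 2) / (d + 2) := by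
    rw [finrank_euclideanSpace_fin]
    -- The natural subtraction d - 1 is harmless since d ≠ 0: the polar weight times r² is r^(d+1).
    have h3 : (fun y : ℝ => y ^ (d - 1) • (Set.Iio R).indicator (fun r => r ^ 2) y)
        = (Set.Iio R).indicator fun y => y ^ (d + 1) := by
      funext y
      by_cases hy : y < R
      · have : d + 1 = d - 1 + 2 := by omega
        simp only [Set.indicator_of_mem (Set.mem_Iio.2 hy), smul_eq_mul]
        rw [← pow_add, this]
      · simp [hy]
    rw [h3, setIntegral_indicator measurableSet_Iio, Set.Ioi_inter_Iio,
      ← integral_Ioc_eq_integral_Ioo, ← intervalIntegral.integral_of_le hR.le, integral_pow]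
    push_cast
    simp
    ring
  rw [h2, finrank_euclideanSpace_fin]
  simp only [nsmul_eq_mul, smul_eq_mul, omega]
  ring

end PlaneWave

/-! ### Increments of `C¹` functions along segments -/

section Increments

theorem sq_lintegral_le {α : Type*} [MeasurableSpace α] {μ : Measure α} {w : α → ℝ≥0∞}
    (hw : AEMeasurable w μ) : (∫⁻ x, w x ∂μ) ^ 2 ≤ μ Set.univ * ∫⁻ x, w x ^ 2 ∂μ := by
  have h := ENNReal.lintegral_mul_le_Lp_mul_Lq μ Real.HolderConjugate.two_two
    (f := fun _ => 1) (g := w) aemeasurable_const hw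
  simp only [Pi.mul_apply, one_mul, lintegral_const, ENNReal.rpow_two, one_pow] at h
  calc (∫⁻ x, w x ∂μ) ^ 2
      ≤ ((μ Set.univ) ^ (1 / 2 : ℝ) * (∫⁻ x, w x ^ 2 ∂μ) ^ (1 / 2 : ℝ)) ^ 2 := by gcongr
    _ = μ Set.univ * ∫⁻ x, w x ^ 2 ∂μ := by
        rw [mul_pow, ← ENNReal.rpow_natCast, ← ENNReal.rpow_natCast, ← ENNReal.rpow_mul,
          ← ENNReal.rpow_mul]
        norm_num

/-- Cauchy–Schwarz for the measure with density ρ. -/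
theorem sq_lintegral_mul_le {α : Type*} [MeasurableSpace α] {μ : Measure α} {ρ w : α → ℝ≥0∞}
    (hρ : Measurable ρ) (hw : Measurable w) :
    (∫⁻ x, ρ x * w x ∂μ) ^ 2 ≤ (∫⁻ x, ρ x ∂μ) * ∫⁻ x, ρ x * w x ^ 2 ∂μ := by
  have h := sq_lintegral_le (μ := μ.withDensity ρ) hw.aemeasurable
  rwa [lintegral_withDensity_eq_lintegral_mul _ hρ hw,
    lintegral_withDensity_eq_lintegral_mul _ hρ (hw.pow_const 2), withDensity_apply _ .univ,
    Measure.restrict_univ] at h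

theorem enorm_add_sq_le {F : Type*} [SeminormedAddCommGroup F] (a b : F) :
    ‖a + b‖ₑ ^ 2 ≤ 2 * ‖a‖ₑ ^ 2 + 2 * ‖b‖ₑ ^ 2 := by
  have h : ‖a + b‖ ^ 2 ≤ 2 * ‖a‖ ^ 2 + 2 * ‖b‖ ^ 2 := by
    have := norm_add_le a b
    nlinarith [norm_nonneg (a + b), sq_nonneg (‖a‖ - ‖b‖)]
  have h2 := ENNReal.ofReal_le_ofReal h
  rw [ENNReal.ofReal_add (by positivity) (by positivity), ENNReal.ofReal_mul (by norm_num),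
    ENNReal.ofReal_mul (by norm_num), ENNReal.ofReal_pow (norm_nonneg _),
    ENNReal.ofReal_pow (norm_nonneg _), ENNReal.ofReal_pow (norm_nonneg _)] at h2
  simpa only [ofReal_norm, ENNReal.ofReal_ofNat] using h2

theorem enorm_sq_le_two_mul_add {F : Type*} [SeminormedAddCommGroup F] (a b : F) :
    ‖a‖ₑ ^ 2 ≤ 2 * ‖b - a‖ₑ ^ 2 + 2 * ‖b‖ₑ ^ 2 := by
  have := enorm_add_sq_le (a - b) b
  rwa [sub_add_cancel, ← enorm_neg (a - b), neg_sub] at this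

variable {W : Type*} [NormedAddCommGroup W] [NormedSpace ℝ W]

/-- The fundamental theorem of calculus along the segment, followed by Cauchy–Schwarz on (0, t]. -/
theorem enorm_sub_sq_le_lintegral_fderiv {u : W → ℂ} (hu : ContDiff ℝ 1 u) (y n : W) {t : ℝ}
    (ht : 0 ≤ t) :
    ‖u (y + t • n) - u y‖ₑ ^ 2
      ≤ ENNReal.ofReal t * (‖n‖ₑ ^ 2 * ∫⁻ s in Set.Ioc 0 t, ‖fderiv ℝ u (y + s • n)‖ₑ ^ 2) := by
  have hd : ∀ s : ℝ, HasDerivAt (fun s => u (y + s • n)) (fderiv ℝ u (y + s • n) n) s := by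
    intro s
    have h1 : HasDerivAt (fun s : ℝ => y + s • n) n s := by
      simpa using ((hasDerivAt_id s).smul_const n).const_add y
    exact ((hu.differentiable one_ne_zero).differentiableAt.hasFDerivAt).comp_hasDerivAt s h1
  have hc : Continuous fun s : ℝ => fderiv ℝ u (y + s • n) :=
    (hu.continuous_fderiv one_ne_zero).comp (by fun_prop)
  have hc2 : Continuous fun s : ℝ => fderiv ℝ u (y + s • n) n := hc.clm_apply continuous_const
  have h1 : u (y + t • n) - u y = ∫ s in Set.Ioc 0 t, fderiv ℝ u (y + s • n) n := by
    rw [← intervalIntegral.integral_of_le ht,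
      intervalIntegral.integral_eq_sub_of_hasDerivAt (fun s _ => hd s)
        (hc2.intervalIntegrable _ _)]
    simp
  calc ‖u (y + t • n) - u y‖ₑ ^ 2
      ≤ (∫⁻ s in Set.Ioc 0 t, ‖fderiv ℝ u (y + s • n) n‖ₑ) ^ 2 := by
        rw [h1]
        gcongr
        exact enorm_integral_le_lintegral_enorm _
    _ ≤ ENNReal.ofReal t * ∫⁻ s in Set.Ioc 0 t, ‖fderiv ℝ u (y + s • n) n‖ₑ ^ 2 := by
        refine (sq_lintegral_le hc2.enorm.measurable.aemeasurable).trans (le_of_eq ?_)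
        simp
    _ ≤ ENNReal.ofReal t * (‖n‖ₑ ^ 2 * ∫⁻ s in Set.Ioc 0 t, ‖fderiv ℝ u (y + s • n)‖ₑ ^ 2) := by
        gcongr
        rw [← lintegral_const_mul _ (hc.enorm.measurable.pow_const 2)]
        refine lintegral_mono fun s => ?_
        rw [← mul_pow, mul_comm]
        gcongr
        exact ContinuousLinearMap.le_opENorm _ _

variable [FiniteDimensional ℝ W] [MeasurableSpace W] [BorelSpace W] (μ : Measure W)
  [μ.IsAddHaarMeasure]

/-- After Tonelli, each slice in s is an integral over A shifted by s z, which is contained in Ω.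
Translation invariance then makes the bound independent of s. -/
theorem lintegral_enorm_translate_sub_sq_le {u : W → ℂ} (hu : ContDiff ℝ 1 u) {A Ω : Set W}
    (hA : MeasurableSet A) (hΩ : MeasurableSet Ω) (z : W)
    (h : ∀ y ∈ A, ∀ s ∈ Set.Ioc (0 : ℝ) 1, y + s • z ∈ Ω) :
    ∫⁻ y in A, ‖u (y + z) - u y‖ₑ ^ 2 ∂μ ≤ ‖z‖ₑ ^ 2 * ∫⁻ y in Ω, ‖fderiv ℝ u y‖ₑ ^ 2 ∂μ := by
  have hc : Continuous (fderiv ℝ u) := hu.continuous_fderiv one_ne_zero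
  calc ∫⁻ y in A, ‖u (y + z) - u y‖ₑ ^ 2 ∂μ
      ≤ ∫⁻ y in A, ‖z‖ₑ ^ 2 * (∫⁻ s in Set.Ioc (0 : ℝ) 1, ‖fderiv ℝ u (y + s • z)‖ₑ ^ 2) ∂μ := by
        refine lintegral_mono fun y => ?_
        simpa using enorm_sub_sq_le_lintegral_fderiv hu y z zero_le_one
    _ = ‖z‖ₑ ^ 2 * ∫⁻ y in A, (∫⁻ s in Set.Ioc (0 : ℝ) 1, ‖fderiv ℝ u (y + s • z)‖ₑ ^ 2) ∂μ := by
        refine lintegral_const_mul' _ _ (by simp)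
    _ = ‖z‖ₑ ^ 2 * ∫⁻ s in Set.Ioc (0 : ℝ) 1, (∫⁻ y in A, ‖fderiv ℝ u (y + s • z)‖ₑ ^ 2 ∂μ) := by
        rw [lintegral_lintegral_swap]
        refine Measurable.aemeasurable ?_
        refine ((hc.comp ?_).enorm.measurable).pow_const 2
        fun_prop
    _ ≤ ‖z‖ₑ ^ 2 * ∫⁻ s in Set.Ioc (0 : ℝ) 1, (∫⁻ y in Ω, ‖fderiv ℝ u y‖ₑ ^ 2 ∂μ) := by
        refine mul_le_mul_right ?_ _
        refine setLIntegral_mono' measurableSet_Ioc fun s hs => ?_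
        rw [← lintegral_indicator hA, ← lintegral_indicator hΩ,
          
          ← lintegral_add_right_eq_self (Ω.indicator fun y => ‖fderiv ℝ u y‖ₑ ^ 2) (s • z)]
        refine lintegral_mono fun y => ?_
        by_cases hy : y ∈ A
        · rw [Set.indicator_of_mem hy, Set.indicator_of_mem (h y hy s hs)]
        · rw [Set.indicator_of_notMem hy]
          exact zero_le
    _ = _ := by simp

end Increments

/-! ### Local geometry of Lipschitz domains -/

section Geometry

variable {d : ℕ} {Ω : Set (E d)}

theorem orthogonalProjectionOnto_add_smul_self (n y : E d) (t : ℝ) :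
    (ℝ ∙ n)ᗮ.orthogonalProjectionOnto (y + t • n) = (ℝ ∙ n)ᗮ.orthogonalProjectionOnto y := by
  have h : n ∈ (ℝ ∙ n)ᗮᗮ :=
    Submodule.le_orthogonal_orthogonal _ (Submodule.mem_span_singleton_self n)
  have h2 := Submodule.orthogonalProjectionOnto_apply_of_mem_orthogonal h
  rw [map_add, map_smul, h2, smul_zero, add_zero]

/-- Near every point of the closure of a Lipschitz domain there is a direction into the domain. -/
theorem exists_inward_direction (hΩ : IsBoundedLipschitzDomain Ω) {x : E d} (hx : x ∈ closure Ω) :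
    ∃ r > 0, ∃ n : E d, ‖n‖ ≤ 1 ∧ ∃ t₀ > (0 : ℝ), ∀ t > (0 : ℝ), t ≤ t₀ → ∃ δ > 0,
      ∀ y ∈ Ω ∩ Metric.ball x r, Metric.ball (y + t • n) δ ⊆ Ω := by
  by_cases hxΩ : x ∈ Ω
  · obtain ⟨r, hr, hrΩ⟩ := Metric.isOpen_iff.1 hΩ.isOpen x hxΩ
    -- At an interior point the zero vector serves as direction, which is why only ‖n‖ ≤ 1 is asked.
    refine ⟨r / 2, by positivity, 0, by simp, 1, one_pos, fun t _ _ => ⟨r / 2, by positivity, ?_⟩⟩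
    rintro y ⟨-, hy⟩
    rw [smul_zero, add_zero]
    refine (Metric.ball_subset_ball' ?_).trans hrΩ
    rw [Metric.mem_ball] at hy
    linarith
  · have hxf : x ∈ frontier Ω := by
      rw [hΩ.isOpen.frontier_eq]
      exact ⟨hx, hxΩ⟩
    obtain ⟨r, n, K, γ, hr, hn, hγ, hgraph⟩ := hΩ.lipschitz x hxf
    refine ⟨r / 2, by positivity, n, hn.le, r / 4, by positivity, fun t ht htr => ?_⟩
    -- Moving by less than t/(K+1) changes the height and the value of γ by less than t in total,
    -- which is the height gained by the shift. The bound r/4 keeps the point in the chart.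
    refine ⟨min (r / 4) (t / (K + 1)), by positivity, ?_⟩
    rintro y ⟨hyΩ, hyx⟩ w hw
    rw [Metric.mem_ball, dist_eq_norm] at hyx hw
    have hw1 : ‖w - (y + t • n)‖ < r / 4 := hw.trans_le (min_le_left _ _)
    have hw2 : ‖w - (y + t • n)‖ * (K + 1) < t := by
      have := hw.trans_le (min_le_right _ _)
      rwa [lt_div_iff₀ (by positivity)] at this
    have htn : ‖t • n‖ = t := by rw [norm_smul, hn, mul_one, Real.norm_of_nonneg ht.le]
    have hyball : y ∈ Metric.ball x r := by
      rw [Metric.mem_ball, dist_eq_norm]; linarith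
    have hwball : w ∈ Metric.ball x r := by
      rw [Metric.mem_ball, dist_eq_norm]
      have e : w - x = (w - (y + t • n)) + t • n + (y - x) := by abel
      rw [e]
      have := norm_add₃_le (a := w - (y + t • n)) (b := t • n) (c := y - x)
      linarith
    rw [hgraph w hwball]
    have hy := (hgraph y hyball).1 hyΩ
    have h1 : γ ((ℝ ∙ n)ᗮ.orthogonalProjectionOnto w)
        - γ ((ℝ ∙ n)ᗮ.orthogonalProjectionOnto y) ≤ K * ‖w - (y + t • n)‖ := by
      rw [← orthogonalProjectionOnto_add_smul_self n y t]
      have a1 := hγ.dist_le_mul ((ℝ ∙ n)ᗮ.orthogonalProjectionOnto w)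
        ((ℝ ∙ n)ᗮ.orthogonalProjectionOnto (y + t • n))
      rw [Real.dist_eq, dist_eq_norm, ← map_sub] at a1
      have a2 := (ℝ ∙ n)ᗮ.norm_orthogonalProjectionOnto_apply_le (w - (y + t • n))
      have a3 := le_abs_self (γ ((ℝ ∙ n)ᗮ.orthogonalProjectionOnto w)
        - γ ((ℝ ∙ n)ᗮ.orthogonalProjectionOnto (y + t • n)))
      have a4 : (K : ℝ) * ‖(ℝ ∙ n)ᗮ.orthogonalProjectionOnto (w - (y + t • n))‖
        ≤ K * ‖w - (y + t • n)‖ := by gcongr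
      linarith
    have h2 : ⟪n, w⟫_ℝ = ⟪n, w - (y + t • n)⟫_ℝ + ⟪n, y⟫_ℝ + t := by
      rw [inner_sub_right, inner_add_right, inner_smul_right, real_inner_self_eq_norm_sq, hn]
      ring
    have h3 := neg_le_of_abs_le (abs_real_inner_le_norm n (w - (y + t • n)))
    rw [hn, one_mul] at h3
    linarith

end Geometry

/-! ### The trace inequality -/

section Trace

variable {d : ℕ} {Ω : Set (E d)}

theorem finrank_orthogonal_span_singleton (hd : d ≠ 0) {n : E d} (hn : n ≠ 0) :
    Module.finrank ℝ (ℝ ∙ n)ᗮ = d - 1 := by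
  have : Fact (Module.finrank ℝ (E d) = (d - 1) + 1) := ⟨by
    rw [finrank_euclideanSpace_fin]; omega⟩
  exact Submodule.finrank_orthogonal_span_singleton hn

/-- The linear coordinates `(z, t) ↦ z + t n` adapted to a unit vector `n`. -/
noncomputable def orthogonalCoordinates {n : E d} (hn : ‖n‖ = 1) :
    ((ℝ ∙ n)ᗮ × ℝ) ≃L[ℝ] E d :=
  LinearEquiv.toContinuousLinearEquiv
    { toFun := fun p => (p.1 : E d) + p.2 • n
      map_add' := by
        intro p q
        simp only [Prod.fst_add, Prod.snd_add, Submodule.coe_add, add_smul]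
        abel
      map_smul' := by
        intro c p
        simp [smul_smul]
      invFun := fun y => ((ℝ ∙ n)ᗮ.orthogonalProjectionOnto y, ⟪n, y⟫_ℝ)
      left_inv := by
        rintro ⟨z, t⟩
        have hz : ⟪n, (z : E d)⟫_ℝ = 0 :=
          Submodule.mem_orthogonal_singleton_iff_inner_right.1 z.2
        refine Prod.ext ?_ ?_
        · simp only
          rw [orthogonalProjectionOnto_add_smul_self]
          simp
        · simp only
          rw [inner_add_right, inner_smul_right, hz, real_inner_self_eq_norm_sq, hn]
          simp
      right_inv := by
        intro y
        simp only
        have h := Submodule.starProjection_add_starProjection_orthogonal (K := ℝ ∙ n) y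
        rw [Submodule.starProjection_unit_singleton ℝ hn, add_comm] at h
        exact h }

/-- The coordinates form a linear isomorphism, so the image of the product measure is a Haar measure
and hence a finite multiple of Lebesgue measure. Its value is irrelevant below. -/
theorem lintegral_orthogonalCoordinates_le {n : E d} (hn : ‖n‖ = 1) :
    ∃ C : ℝ≥0∞, C ≠ ⊤ ∧ ∀ h : E d → ℝ≥0∞, Measurable h →
      ∫⁻ z : (ℝ ∙ n)ᗮ, ∫⁻ t : ℝ, h ((z : E d) + t • n) ≤ C * ∫⁻ y, h y := by
  set Φ := orthogonalCoordinates hn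
  have hhaar : (Measure.map Φ (volume.prod volume)).IsAddHaarMeasure :=
    Φ.isAddHaarMeasure_map _
  refine ⟨Measure.addHaarScalarFactor (Measure.map Φ (volume.prod volume)) volume,
    ENNReal.coe_ne_top, fun h hh => ?_⟩
  have e : ∫⁻ z : (ℝ ∙ n)ᗮ, ∫⁻ t : ℝ, h ((z : E d) + t • n)
      = ∫⁻ y, h y ∂(Measure.map Φ (volume.prod volume)) := by
    rw [lintegral_map hh Φ.continuous.measurable,
      lintegral_prod (fun p => h (Φ p)) (hh.comp Φ.continuous.measurable).aemeasurable]
    rfl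
  rw [e]
  conv_lhs => rw [Measure.isAddLeftInvariant_eq_smul (Measure.map Φ (volume.prod volume)) volume]
  rw [lintegral_smul_measure]
  rfl

/-- The graph map `z ↦ z + γ(z) n` over the hyperplane orthogonal to `n`. -/
def graphMap {n : E d} (γ : (ℝ ∙ n)ᗮ → ℝ) (z : (ℝ ∙ n)ᗮ) : E d := (z : E d) + γ z • n

theorem lipschitzWith_graphMap {n : E d} {K : NNReal} {γ : (ℝ ∙ n)ᗮ → ℝ}
    (hγ : LipschitzWith K γ) : LipschitzWith (1 + K * ‖n‖₊) (graphMap γ) := by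
  refine LipschitzWith.add (LipschitzWith.subtype_val _) ?_
  refine LipschitzWith.of_dist_le_mul fun a b => ?_
  rw [dist_eq_norm, ← sub_smul, norm_smul, ← dist_eq_norm]
  have := hγ.dist_le_mul a b
  push_cast
  calc dist (γ a) (γ b) * ‖n‖ ≤ (K * dist a b) * ‖n‖ := by gcongr
    _ = K * ‖n‖ * dist a b := by ring

/-- An L-Lipschitz map enlarges (d-1)-dimensional Hausdorff measure by at most L^(d-1), and on the
hyperplane the normalised Hausdorff measure is Lebesgue measure. -/
theorem euclideanHausdorffMeasure_image_graphMap_le (hd : d ≠ 0) {n : E d} (hn : ‖n‖ = 1)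
    {K : NNReal} {γ : (ℝ ∙ n)ᗮ → ℝ} (hγ : LipschitzWith K γ) :
    ∃ C : ℝ≥0∞, C ≠ ⊤ ∧ ∀ A : Set (ℝ ∙ n)ᗮ,
      (Measure.euclideanHausdorffMeasure (d - 1) : Measure (E d)) (graphMap γ '' A)
        ≤ C * volume A := by
  have hrank := finrank_orthogonal_span_singleton hd (n := n) (by
    rintro rfl
    simp at hn)
  refine ⟨((1 + K * ‖n‖₊ : NNReal) : ℝ≥0∞) ^ ((d - 1 : ℕ) : ℝ),
    ENNReal.rpow_ne_top_of_nonneg (by positivity) ENNReal.coe_ne_top, fun A => ?_⟩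
  have h1 := (lipschitzWith_graphMap hγ).hausdorffMeasure_image_le
    (d := ((d - 1 : ℕ) : ℝ)) (by positivity) A
  rw [← InnerProductSpace.euclideanHausdorffMeasure_eq_volume, hrank,
    Measure.euclideanHausdorffMeasure_def, Measure.euclideanHausdorffMeasure_def,
    Measure.smul_apply, Measure.smul_apply, ENNReal.smul_def, ENNReal.smul_def, smul_eq_mul,
    smul_eq_mul, mul_left_comm]
  gcongr

/-- Near a boundary point the surface measure is controlled by Lebesgue measure on a hyperplane,
and the boundary flows into the domain. -/
theorem exists_boundary_chart (hd : d ≠ 0) (hΩ : IsBoundedLipschitzDomain Ω) {x : E d}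
    (hx : x ∈ frontier Ω) :
    ∃ r > (0 : ℝ), surface Ω (Metric.ball x r) ≠ ⊤ ∧ ∃ n : E d, ‖n‖ = 1 ∧ ∃ t₀ > (0 : ℝ), ∃ C : ℝ≥0∞, C ≠ ⊤ ∧
      ∀ t > (0 : ℝ), t ≤ t₀ → ∀ h : E d → ℝ≥0∞, Measurable h →
        ∫⁻ y in Metric.ball x r, (∫⁻ s in Set.Ioc 0 t, h (y + s • n)) ∂(surface Ω)
          ≤ C * ∫⁻ y in Ω, h y := by
  obtain ⟨r, n, K, γ, hr, hn, hγ, hgraph⟩ := hΩ.lipschitz x hx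
  have hγc := hγ.continuous
  have hPc : Continuous fun y : E d => (ℝ ∙ n)ᗮ.orthogonalProjectionOnto y :=
    (ℝ ∙ n)ᗮ.orthogonalProjectionOnto.continuous
  -- Boundary points in the chart lie on the graph: one inequality by passing to the closure of Ω,
  -- the other because the open set Ω misses its frontier.
  have hfront : ∀ y ∈ frontier Ω ∩ Metric.ball x r,
      γ ((ℝ ∙ n)ᗮ.orthogonalProjectionOnto y) = ⟪n, y⟫_ℝ := by
    rintro y ⟨hyf, hyb⟩
    rw [hΩ.isOpen.frontier_eq] at hyf
    refine le_antisymm ?_ (not_lt.1 fun h => hyf.2 ((hgraph y hyb).2 h))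
    have hmem : y ∈ closure (Ω ∩ Metric.ball x r) := by
      have := Metric.isOpen_ball.inter_closure (s := Metric.ball x r) (t := Ω) ⟨hyb, hyf.1⟩
      rwa [Set.inter_comm] at this
    have hcl : IsClosed {y : E d | γ ((ℝ ∙ n)ᗮ.orthogonalProjectionOnto y) ≤ ⟪n, y⟫_ℝ} :=
      isClosed_le (hγc.comp hPc) (by fun_prop)
    refine closure_minimal ?_ hcl hmem
    rintro w ⟨hw1, hw2⟩
    exact ((hgraph w hw2).1 hw1).le
  set S := frontier Ω ∩ Metric.ball x (r / 2) with hS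
  have hSm : MeasurableSet S := isClosed_frontier.measurableSet.inter measurableSet_ball
  have hSr : S ⊆ frontier Ω ∩ Metric.ball x r :=
    Set.inter_subset_inter_right _ (Metric.ball_subset_ball (by linarith))
  have hSgraph : ∀ y ∈ S, graphMap γ ((ℝ ∙ n)ᗮ.orthogonalProjectionOnto y) = y := by
    intro y hy
    rw [graphMap, hfront y (hSr hy)]
    exact (orthogonalCoordinates hn).apply_symm_apply y
  obtain ⟨C₁, hC₁, hC₁'⟩ := euclideanHausdorffMeasure_image_graphMap_le hd hn hγ
  obtain ⟨C₂, hC₂, hC₂'⟩ := lintegral_orthogonalCoordinates_le hn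
  have hΓm : Measurable (graphMap γ) := (lipschitzWith_graphMap hγ).continuous.measurable
  have hsurf : (surface Ω).restrict (Metric.ball x (r / 2))
      = (Measure.euclideanHausdorffMeasure (d - 1) : Measure (E d)).restrict S := by
    rw [surface, Measure.restrict_restrict measurableSet_ball, Set.inter_comm]
  have hle : (Measure.euclideanHausdorffMeasure (d - 1) : Measure (E d)).restrict S
      ≤ C₁ • Measure.map (graphMap γ) (volume.restrict (graphMap γ ⁻¹' S)) := by
    refine Measure.le_iff.2 fun A hA => ?_
    rw [Measure.restrict_apply hA, Measure.smul_apply, smul_eq_mul, Measure.map_apply hΓm hA,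
      Measure.restrict_apply (hΓm hA)]
    refine (measure_mono ?_).trans (hC₁' _)
    rintro y ⟨hyA, hyS⟩
    refine ⟨(ℝ ∙ n)ᗮ.orthogonalProjectionOnto y, ⟨?_, ?_⟩, hSgraph y hyS⟩ <;>
      rw [Set.mem_preimage, hSgraph y hyS] <;> assumption
  refine ⟨r / 2, by positivity, ?_, n, hn, r / 4, by positivity, C₁ * C₂,
    ENNReal.mul_ne_top hC₁ hC₂, fun t ht htr h hh => ?_⟩
  · rw [← Measure.restrict_apply_univ, hsurf]
    refine ne_top_of_le_ne_top ?_ (hle _)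
    rw [Measure.smul_apply, smul_eq_mul, Measure.map_apply hΓm .univ]
    refine ENNReal.mul_ne_top hC₁ ?_
    rw [Set.preimage_univ, Measure.restrict_apply_univ]
    refine (Bornology.IsBounded.measure_lt_top ?_).ne
    refine (Metric.isBounded_ball (x := (ℝ ∙ n)ᗮ.orthogonalProjectionOnto x)
      (r := r / 2)).subset ?_
    intro z hz
    have h1 : (ℝ ∙ n)ᗮ.orthogonalProjectionOnto (graphMap γ z) = z := by
      rw [graphMap, orthogonalProjectionOnto_add_smul_self]
      simp
    have h2 := hz.2
    rw [Metric.mem_ball, dist_eq_norm] at h2 ⊢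
    rw [← h1, ← map_sub]
    exact ((ℝ ∙ n)ᗮ.norm_orthogonalProjectionOnto_apply_le _).trans_lt h2
  · rw [hsurf]
    set k : E d → ℝ≥0∞ := Ω.indicator h with hk
    have hkm : Measurable k := hh.indicator hΩ.isOpen.measurableSet
    have hflow : ∀ y ∈ S, ∀ s ∈ Set.Ioc 0 t, y + s • n ∈ Ω := by
      intro y hy s hs
      have hb : y + s • n ∈ Metric.ball x r := by
        have h1 := hy.2
        rw [Metric.mem_ball, dist_eq_norm] at h1 ⊢
        have h2 : ‖s • n‖ = s := by rw [norm_smul, hn, mul_one, Real.norm_of_nonneg hs.1.le]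
        have h3 : y + s • n - x = (y - x) + s • n := by abel
        rw [h3]
        have := norm_add_le (y - x) (s • n)
        have := hs.2
        linarith
      rw [hgraph _ hb, orthogonalProjectionOnto_add_smul_self, hfront y (hSr hy), inner_add_right,
        inner_smul_right, real_inner_self_eq_norm_sq, hn]
      linarith [hs.1]
    have hmeas : Measurable fun p : E d × ℝ => k (p.1 + p.2 • n) := hkm.comp (by fun_prop)
    have hmeas1 : Measurable fun y : E d => ∫⁻ s : ℝ, k (y + s • n) := hmeas.lintegral_prod_right'
    calc ∫⁻ y in S, (∫⁻ s in Set.Ioc 0 t, h (y + s • n)) ∂(Measure.euclideanHausdorffMeasure (d - 1))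
        ≤ ∫⁻ y in S, (∫⁻ s : ℝ, k (y + s • n)) ∂(Measure.euclideanHausdorffMeasure (d - 1)) := by
          refine setLIntegral_mono' hSm fun y hy => ?_
          refine le_trans ?_ (setLIntegral_le_lintegral (Set.Ioc 0 t) _)
          refine setLIntegral_mono' measurableSet_Ioc fun s hs => ?_
          rw [hk, Set.indicator_of_mem (hflow y hy s hs)]
      _ ≤ ∫⁻ y, (∫⁻ s : ℝ, k (y + s • n))
            ∂(C₁ • Measure.map (graphMap γ) (volume.restrict (graphMap γ ⁻¹' S))) :=
          lintegral_mono' hle le_rfl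
      _ = C₁ * ∫⁻ z in graphMap γ ⁻¹' S, ∫⁻ s : ℝ, k (graphMap γ z + s • n) := by
          rw [lintegral_smul_measure, lintegral_map hmeas1 hΓm, smul_eq_mul]
      _ ≤ C₁ * ∫⁻ z : (ℝ ∙ n)ᗮ, ∫⁻ s : ℝ, k (graphMap γ z + s • n) := by
          gcongr
          exact Measure.restrict_le_self
      _ = C₁ * ∫⁻ z : (ℝ ∙ n)ᗮ, ∫⁻ s : ℝ, k ((z : E d) + s • n) := by
          congr 1
          refine lintegral_congr fun z => ?_
          -- Extending the vertical integral to the whole line allows the shift by γ(z), which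
          -- flattens the graph to the hyperplane.
          rw [← lintegral_add_left_eq_self (fun s : ℝ => k ((z : E d) + s • n)) (γ z)]
          refine lintegral_congr fun s => ?_
          rw [graphMap, add_smul, add_assoc]
      _ ≤ C₁ * (C₂ * ∫⁻ y, k y) := by
          gcongr
          exact hC₂' k hkm
      _ = C₁ * C₂ * ∫⁻ y in Ω, h y := by
          rw [hk, lintegral_indicator hΩ.isOpen.measurableSet, mul_assoc]

theorem isFiniteMeasure_surface (hd : d ≠ 0) (hΩ : IsBoundedLipschitzDomain Ω) :
    IsFiniteMeasure (surface Ω) := by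
  have hcomp : IsCompact (frontier Ω) :=
    Metric.isCompact_of_isClosed_isBounded isClosed_frontier
      (hΩ.isBounded.closure.subset frontier_subset_closure)
  have h : surface Ω (frontier Ω) < ⊤ := by
    refine hcomp.measure_lt_top_of_nhdsWithin fun x hx => ?_
    obtain ⟨r, hr, hfin, -⟩ := exists_boundary_chart hd hΩ hx
    exact ⟨Metric.ball x r, mem_nhdsWithin_of_mem_nhds (Metric.ball_mem_nhds x hr),
      hfin.lt_top⟩
  refine ⟨?_⟩
  rw [surface, Measure.restrict_apply_univ]
  rwa [surface, Measure.restrict_apply_self] at h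

/-- Comparing u(y) with u(y + s n) and averaging over 0 < s ≤ t, then integrating over the boundary
chart, bounds the boundary integral by 2Ct ∫|∇u|² + (2C/t) ∫|u|². A short flow time t makes the
gradient coefficient small. -/
theorem exists_ball_lintegral_surface_le (hd : d ≠ 0) (hΩ : IsBoundedLipschitzDomain Ω) {x : E d}
    (hx : x ∈ frontier Ω) : ∃ r > (0 : ℝ), ∀ ε : ℝ≥0∞, ε ≠ 0 → ∃ C : ℝ≥0∞, C ≠ ⊤ ∧
      ∀ u : E d → ℂ, ContDiff ℝ 1 u → ∫⁻ y in Metric.ball x r, ‖u y‖ₑ ^ 2 ∂(surface Ω)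
        ≤ ε * (∫⁻ y in Ω, ‖fderiv ℝ u y‖ₑ ^ 2) + C * ∫⁻ y in Ω, ‖u y‖ₑ ^ 2 := by
  obtain ⟨r, hr, -, n, hn, t₀, ht₀, C, hC, hflow⟩ := exists_boundary_chart hd hΩ hx
  refine ⟨r, hr, fun ε hε => ?_⟩
  obtain ⟨t, ht, htt₀, htε⟩ : ∃ t > (0 : ℝ), t ≤ t₀ ∧ ENNReal.ofReal t * (2 * C) ≤ ε := by
    rcases eq_or_ne ε ⊤ with rfl | hεt
    · exact ⟨t₀, ht₀, le_rfl, le_top⟩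
    have h2C : 2 * C ≠ ⊤ := ENNReal.mul_ne_top (by simp) hC
    have hpos : 0 < ε.toReal := ENNReal.toReal_pos hε hεt
    refine ⟨min t₀ (ε.toReal / ((2 * C).toReal + 1)), by positivity, min_le_left _ _, ?_⟩
    conv_lhs => enter [2]; rw [← ENNReal.ofReal_toReal h2C]
    rw [← ENNReal.ofReal_mul (by positivity), ENNReal.ofReal_le_iff_le_toReal hεt]
    calc min t₀ (ε.toReal / ((2 * C).toReal + 1)) * (2 * C).toReal
        ≤ (ε.toReal / ((2 * C).toReal + 1)) * ((2 * C).toReal + 1) := by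
          gcongr
          · exact min_le_right _ _
          · linarith
      _ = ε.toReal := by field_simp
  have ht0 : ENNReal.ofReal t ≠ 0 := by simpa using ht
  refine ⟨(ENNReal.ofReal t)⁻¹ * (2 * C),
    ENNReal.mul_ne_top (by simpa using ht) (ENNReal.mul_ne_top (by simp) hC), fun u hu => ?_⟩
  have hDc : Continuous (fderiv ℝ u) := hu.continuous_fderiv one_ne_zero
  have hum : Measurable fun y => ‖u y‖ₑ ^ 2 := hu.continuous.enorm.measurable.pow_const 2
  have hDm : Measurable fun y => ‖fderiv ℝ u y‖ₑ ^ 2 := hDc.enorm.measurable.pow_const 2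
  have hpt : ∀ y, ENNReal.ofReal t * ‖u y‖ₑ ^ 2
      ≤ 2 * (∫⁻ s in Set.Ioc 0 t, ‖u (y + s • n)‖ₑ ^ 2)
        + 2 * ENNReal.ofReal t ^ 2 * ∫⁻ s in Set.Ioc 0 t, ‖fderiv ℝ u (y + s • n)‖ₑ ^ 2 := by
    intro y
    have h1 : ∀ s ∈ Set.Ioc 0 t, ‖u y‖ₑ ^ 2 ≤ 2 * ‖u (y + s • n)‖ₑ ^ 2
        + 2 * (ENNReal.ofReal t * ∫⁻ s in Set.Ioc 0 t, ‖fderiv ℝ u (y + s • n)‖ₑ ^ 2) := by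
      intro s hs
      refine (enorm_sq_le_two_mul_add (u y) (u (y + s • n))).trans ?_
      rw [add_comm]
      gcongr
      refine (enorm_sub_sq_le_lintegral_fderiv hu y n hs.1.le).trans ?_
      have : ‖n‖ₑ = 1 := by rw [← ofReal_norm, hn, ENNReal.ofReal_one]
      rw [this, one_pow, one_mul]
      gcongr
      · exact hs.2
      · exact hs.2
    calc ENNReal.ofReal t * ‖u y‖ₑ ^ 2 = ∫⁻ s in Set.Ioc 0 t, ‖u y‖ₑ ^ 2 := by
          simp [mul_comm]
      _ ≤ ∫⁻ s in Set.Ioc 0 t, (2 * ‖u (y + s • n)‖ₑ ^ 2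
        + 2 * (ENNReal.ofReal t * ∫⁻ s in Set.Ioc 0 t, ‖fderiv ℝ u (y + s • n)‖ₑ ^ 2)) :=
          setLIntegral_mono' measurableSet_Ioc h1
      _ = _ := by
          rw [lintegral_add_right _ measurable_const, lintegral_const_mul' _ _ (by simp)]
          simp only [lintegral_const, Measure.restrict_apply_univ, Real.volume_Ioc, sub_zero]
          ring
  have hmain : ENNReal.ofReal t * ∫⁻ y in Metric.ball x r, ‖u y‖ₑ ^ 2 ∂(surface Ω)
      ≤ 2 * (C * ∫⁻ y in Ω, ‖u y‖ₑ ^ 2)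
        + 2 * ENNReal.ofReal t ^ 2 * (C * ∫⁻ y in Ω, ‖fderiv ℝ u y‖ₑ ^ 2) := by
    rw [← lintegral_const_mul _ hum]
    refine (lintegral_mono hpt).trans ?_
    have hm1 : Measurable fun y => 2 * ∫⁻ s in Set.Ioc 0 t, ‖u (y + s • n)‖ₑ ^ 2 := by
      refine Measurable.const_mul (Measurable.lintegral_prod_right' (f := fun p : E d × ℝ =>
        ‖u (p.1 + p.2 • n)‖ₑ ^ 2) (hum.comp (by fun_prop))) _
    rw [lintegral_add_left hm1, lintegral_const_mul' _ _ (by simp),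
      lintegral_const_mul' _ _ (ENNReal.mul_ne_top (by simp) (by simp))]
    gcongr
    · exact hflow t ht htt₀ _ hum
    · exact hflow t ht htt₀ _ hDm
  have hfin := mul_le_mul_right hmain (ENNReal.ofReal t)⁻¹
  rw [← mul_assoc, ENNReal.inv_mul_cancel ht0 ENNReal.ofReal_ne_top, one_mul] at hfin
  refine hfin.trans ?_
  rw [mul_add, add_comm]
  gcongr ?_ + ?_
  · have : (ENNReal.ofReal t)⁻¹ * (2 * ENNReal.ofReal t ^ 2
        * (C * ∫⁻ y in Ω, ‖fderiv ℝ u y‖ₑ ^ 2))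
        = ((ENNReal.ofReal t)⁻¹ * ENNReal.ofReal t) * (ENNReal.ofReal t * (2 * C))
          * ∫⁻ y in Ω, ‖fderiv ℝ u y‖ₑ ^ 2 := by ring
    rw [this, ENNReal.inv_mul_cancel ht0 ENNReal.ofReal_ne_top, one_mul]
    gcongr
  · rw [← mul_assoc 2 C, ← mul_assoc]

/-- The trace inequality with a small constant in front of the gradient. -/
theorem lintegral_surface_le (hd : d ≠ 0) (hΩ : IsBoundedLipschitzDomain Ω) {ε : ℝ≥0∞}
    (hε : ε ≠ 0) : ∃ C : ℝ≥0∞, C ≠ ⊤ ∧ ∀ u : E d → ℂ, ContDiff ℝ 1 u →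
      ∫⁻ y, ‖u y‖ₑ ^ 2 ∂(surface Ω)
        ≤ ε * (∫⁻ y in Ω, ‖fderiv ℝ u y‖ₑ ^ 2) + C * ∫⁻ y in Ω, ‖u y‖ₑ ^ 2 := by
  have hcomp : IsCompact (frontier Ω) :=
    Metric.isCompact_of_isClosed_isBounded isClosed_frontier
      (hΩ.isBounded.closure.subset frontier_subset_closure)
  have hsurf : ∀ u : E d → ℂ, ∫⁻ y, ‖u y‖ₑ ^ 2 ∂(surface Ω)
      = ∫⁻ y in frontier Ω, ‖u y‖ₑ ^ 2 ∂(surface Ω) := by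
    intro u
    rw [surface, Measure.restrict_restrict_of_subset subset_rfl]
  simp only [hsurf]
  -- The statement for all ε at once is what passes to unions of patches, where each half is applied
  -- with ε/2.
  suffices H : ∀ ε : ℝ≥0∞, ε ≠ 0 → ∃ C : ℝ≥0∞, C ≠ ⊤ ∧ ∀ u : E d → ℂ, ContDiff ℝ 1 u →
      ∫⁻ y in frontier Ω, ‖u y‖ₑ ^ 2 ∂(surface Ω)
        ≤ ε * (∫⁻ y in Ω, ‖fderiv ℝ u y‖ₑ ^ 2) + C * ∫⁻ y in Ω, ‖u y‖ₑ ^ 2 from H ε hε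
  refine hcomp.induction_on (p := fun T => ∀ ε : ℝ≥0∞, ε ≠ 0 → ∃ C : ℝ≥0∞, C ≠ ⊤ ∧
    ∀ u : E d → ℂ, ContDiff ℝ 1 u → ∫⁻ y in T, ‖u y‖ₑ ^ 2 ∂(surface Ω)
        ≤ ε * (∫⁻ y in Ω, ‖fderiv ℝ u y‖ₑ ^ 2) + C * ∫⁻ y in Ω, ‖u y‖ₑ ^ 2) ?_ ?_ ?_ ?_
  · intro ε _
    exact ⟨0, by simp, fun u _ => by simp⟩
  · intro T T' hT h ε hε
    obtain ⟨C, hC, hu⟩ := h ε hε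
    exact ⟨C, hC, fun u hu1 => (lintegral_mono_set hT).trans (hu u hu1)⟩
  · intro T T' h h' ε hε
    obtain ⟨C, hC, hu⟩ := h (ε / 2) (by simpa using hε)
    obtain ⟨C', hC', hu'⟩ := h' (ε / 2) (by simpa using hε)
    refine ⟨C + C', ENNReal.add_ne_top.2 ⟨hC, hC'⟩, fun u hu1 => ?_⟩
    refine (lintegral_union_le _ T T').trans ((add_le_add (hu u hu1) (hu' u hu1)).trans ?_)
    rw [add_add_add_comm, ← add_mul, ← add_mul, ENNReal.add_halves]
  · intro x hx
    obtain ⟨r, hr, h⟩ := exists_ball_lintegral_surface_le hd hΩ hx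
    exact ⟨Metric.ball x r, mem_nhdsWithin_of_mem_nhds (Metric.ball_mem_nhds x hr), h⟩

end Trace

/-! ### The compactness inequality -/

section Compactness

variable {d : ℕ} {Ω : Set (E d)}

/-- The points of `Ω` whose distance to the complement is at least `δ`. -/
def innerRegion (Ω : Set (E d)) (δ : ℝ) : Set (E d) := {x | Metric.ball x δ ⊆ Ω}

theorem isClosed_innerRegion (Ω : Set (E d)) (δ : ℝ) : IsClosed (innerRegion Ω δ) := by
  have : innerRegion Ω δ = (Metric.thickening δ Ωᶜ)ᶜ := by
    ext x
    rw [innerRegion, Set.mem_ofPred_eq, Set.mem_compl_iff, Metric.mem_thickening_iff]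
    push Not
    refine ⟨fun h z hz => ?_, fun h z hz => ?_⟩
    · by_contra! hlt
      rw [dist_comm] at hlt
      exact hz (h hlt)
    · by_contra hz'
      have := h z hz'
      rw [Metric.mem_ball, dist_comm] at hz
      linarith
  rw [this]
  exact Metric.isOpen_thickening.isClosed_compl

theorem innerRegion_anti (Ω : Set (E d)) {δ δ' : ℝ} (h : δ ≤ δ') :
    innerRegion Ω δ' ⊆ innerRegion Ω δ := fun _ hx => (Metric.ball_subset_ball h).trans hx

theorem innerRegion_subset {δ : ℝ} (hδ : 0 < δ) : innerRegion Ω δ ⊆ Ω := fun _ hx =>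
  hx (Metric.mem_ball_self hδ)

theorem ENNReal_exists_pos_two_mul_sq_le {ε : ℝ≥0∞} (hε : ε ≠ 0) {t₀ : ℝ} (ht₀ : 0 < t₀)
    {C : ℝ≥0∞} (hC : C ≠ ⊤) : ∃ t > (0 : ℝ), t ≤ t₀ ∧ C * ENNReal.ofReal t ^ 2 ≤ ε := by
  have h : Tendsto (fun t : ℝ => C * ENNReal.ofReal t ^ 2) (𝓝[>] 0) (𝓝 0) := by
    have h1 : Tendsto (fun t : ℝ => ENNReal.ofReal t ^ 2) (𝓝[>] 0) (𝓝 0) := by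
      have h2 : Tendsto (fun t : ℝ => ENNReal.ofReal t ^ 2) (𝓝 0) (𝓝 (ENNReal.ofReal 0 ^ 2)) :=
        ((ENNReal.continuous_pow 2).comp ENNReal.continuous_ofReal).tendsto 0
      simp only [ENNReal.ofReal_zero, ne_eq, OfNat.ofNat_ne_zero, not_false_eq_true,
        zero_pow] at h2
      exact h2.mono_left nhdsWithin_le_nhds
    have := ENNReal.Tendsto.const_mul h1 (Or.inr hC)
    simpa using this
  have h1 := h.eventually (gt_mem_nhds (pos_iff_ne_zero.2 hε))
  have h2 : ∀ᶠ t : ℝ in 𝓝[>] 0, t ∈ Set.Ioc 0 t₀ := Ioc_mem_nhdsGT ht₀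
  obtain ⟨t, ht1, ht2⟩ := (h1.and h2).exists
  exact ⟨t, ht2.1, ht2.2, ht1.le⟩

/-- Push inward by t n: the shifted point lies in the inner region, and the increment of u costs t²
∫|∇u|² by the translation estimate. -/
theorem exists_ball_lintegral_le_innerRegion (hΩ : IsBoundedLipschitzDomain Ω) {x : E d}
    (hx : x ∈ closure Ω) : ∃ r > (0 : ℝ), ∀ ε : ℝ≥0∞, ε ≠ 0 → ∃ δ > (0 : ℝ),
      ∀ u : E d → ℂ, ContDiff ℝ 1 u → ∫⁻ y in Ω ∩ Metric.ball x r, ‖u y‖ₑ ^ 2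
        ≤ ε * (∫⁻ y in Ω, ‖fderiv ℝ u y‖ₑ ^ 2) + 2 * ∫⁻ y in innerRegion Ω δ, ‖u y‖ₑ ^ 2 := by
  obtain ⟨r, hr, n, hn, t₀, ht₀, hin⟩ := exists_inward_direction hΩ hx
  refine ⟨r, hr, fun ε hε => ?_⟩
  obtain ⟨t, ht, htt₀, htε⟩ := ENNReal_exists_pos_two_mul_sq_le hε ht₀ (C := 2) (by simp)
  obtain ⟨δ, hδ, hδΩ⟩ := hin t ht htt₀
  refine ⟨δ, hδ, fun u hu => ?_⟩
  have hΩm := hΩ.isOpen.measurableSet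
  have hAm : MeasurableSet (Ω ∩ Metric.ball x r) := hΩm.inter measurableSet_ball
  -- The points between y and y + t n also lie in Ω, by the inward property for the shorter time s
  -- t.
  have h1 := lintegral_enorm_translate_sub_sq_le volume hu hAm hΩm (t • n) (by
    intro y hy s hs
    obtain ⟨δ', hδ', h'⟩ := hin (s * t) (mul_pos hs.1 ht)
      (le_trans (mul_le_of_le_one_left ht.le hs.2) htt₀)
    rw [smul_smul]
    exact h' y hy (Metric.mem_ball_self hδ'))
  have h2 : ∫⁻ y in Ω ∩ Metric.ball x r, ‖u (y + t • n)‖ₑ ^ 2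
      ≤ ∫⁻ y in innerRegion Ω δ, ‖u y‖ₑ ^ 2 := by
    have hKm := (isClosed_innerRegion Ω δ).measurableSet
    rw [← lintegral_indicator hAm, ← lintegral_indicator hKm,
      ← lintegral_add_right_eq_self ((innerRegion Ω δ).indicator fun y => ‖u y‖ₑ ^ 2) (t • n)]
    refine lintegral_mono fun y => ?_
    by_cases hy : y ∈ Ω ∩ Metric.ball x r
    · have hy' : y + t • n ∈ innerRegion Ω δ := hδΩ y hy
      rw [Set.indicator_of_mem hy, Set.indicator_of_mem hy']
    · rw [Set.indicator_of_notMem hy]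
      exact zero_le
  have hm : Measurable fun y => 2 * ‖u (y + t • n) - u y‖ₑ ^ 2 := by
    have : Continuous fun y => u (y + t • n) - u y :=
      (hu.continuous.comp (by fun_prop)).sub hu.continuous
    exact (this.enorm.measurable.pow_const 2).const_mul 2
  calc ∫⁻ y in Ω ∩ Metric.ball x r, ‖u y‖ₑ ^ 2
      ≤ ∫⁻ y in Ω ∩ Metric.ball x r,
          (2 * ‖u (y + t • n) - u y‖ₑ ^ 2 + 2 * ‖u (y + t • n)‖ₑ ^ 2) :=
        lintegral_mono fun y => enorm_sq_le_two_mul_add _ _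
    _ = 2 * (∫⁻ y in Ω ∩ Metric.ball x r, ‖u (y + t • n) - u y‖ₑ ^ 2)
          + 2 * ∫⁻ y in Ω ∩ Metric.ball x r, ‖u (y + t • n)‖ₑ ^ 2 := by
        rw [lintegral_add_left hm, lintegral_const_mul' _ _ (by simp),
          lintegral_const_mul' _ _ (by simp)]
    _ ≤ 2 * (‖t • n‖ₑ ^ 2 * ∫⁻ y in Ω, ‖fderiv ℝ u y‖ₑ ^ 2)
          + 2 * ∫⁻ y in innerRegion Ω δ, ‖u y‖ₑ ^ 2 := by gcongr
    _ ≤ _ := by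
        rw [← mul_assoc]
        gcongr
        refine le_trans ?_ htε
        gcongr
        rw [← ofReal_norm, norm_smul, Real.norm_of_nonneg ht.le]
        exact ENNReal.ofReal_le_ofReal (mul_le_of_le_one_right ht.le hn)

theorem lintegral_le_innerRegion (hΩ : IsBoundedLipschitzDomain Ω) {ε : ℝ≥0∞} (hε : ε ≠ 0) :
    ∃ δ > (0 : ℝ), ∃ C : ℝ≥0∞, C ≠ ⊤ ∧ ∀ u : E d → ℂ, ContDiff ℝ 1 u → ∫⁻ y in Ω, ‖u y‖ₑ ^ 2
        ≤ ε * (∫⁻ y in Ω, ‖fderiv ℝ u y‖ₑ ^ 2) + C * ∫⁻ y in innerRegion Ω δ, ‖u y‖ₑ ^ 2 := by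
  have hcomp : IsCompact (closure Ω) :=
    Metric.isCompact_of_isClosed_isBounded isClosed_closure hΩ.isBounded.closure
  suffices H : ∀ ε : ℝ≥0∞, ε ≠ 0 → ∃ δ > (0 : ℝ), ∃ C : ℝ≥0∞, C ≠ ⊤ ∧
      ∀ u : E d → ℂ, ContDiff ℝ 1 u → ∫⁻ y in Ω ∩ closure Ω, ‖u y‖ₑ ^ 2
        ≤ ε * (∫⁻ y in Ω, ‖fderiv ℝ u y‖ₑ ^ 2)
          + C * ∫⁻ y in innerRegion Ω δ, ‖u y‖ₑ ^ 2 by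
    rw [Set.inter_eq_left.2 subset_closure] at H
    exact H ε hε
  refine hcomp.induction_on (p := fun T => ∀ ε : ℝ≥0∞, ε ≠ 0 → ∃ δ > (0 : ℝ), ∃ C : ℝ≥0∞, C ≠ ⊤ ∧
      ∀ u : E d → ℂ, ContDiff ℝ 1 u → ∫⁻ y in Ω ∩ T, ‖u y‖ₑ ^ 2
        ≤ ε * (∫⁻ y in Ω, ‖fderiv ℝ u y‖ₑ ^ 2)
          + C * ∫⁻ y in innerRegion Ω δ, ‖u y‖ₑ ^ 2) ?_ ?_ ?_ ?_
  · intro ε _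
    exact ⟨1, one_pos, 0, by simp, fun u _ => by simp⟩
  · intro T T' hT h ε hε
    obtain ⟨δ, hδ, C, hC, hu⟩ := h ε hε
    exact ⟨δ, hδ, C, hC, fun u hu1 =>
      (lintegral_mono_set (Set.inter_subset_inter_right _ hT)).trans (hu u hu1)⟩
  · intro T T' h h' ε hε
    obtain ⟨δ, hδ, C, hC, hu⟩ := h (ε / 2) (by simpa using hε)
    obtain ⟨δ', hδ', C', hC', hu'⟩ := h' (ε / 2) (by simpa using hε)
    refine ⟨min δ δ', lt_min hδ hδ', C + C', ENNReal.add_ne_top.2 ⟨hC, hC'⟩, fun u hu1 => ?_⟩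
    rw [Set.inter_union_distrib_left]
    refine (lintegral_union_le _ _ _).trans ((add_le_add (hu u hu1) (hu' u hu1)).trans ?_)
    rw [add_add_add_comm, ← add_mul, ENNReal.add_halves, add_mul]
    gcongr
    · exact innerRegion_anti Ω (min_le_left _ _)
    · exact innerRegion_anti Ω (min_le_right _ _)
  · intro x hx
    obtain ⟨r, hr, h⟩ := exists_ball_lintegral_le_innerRegion hΩ hx
    refine ⟨Metric.ball x r, mem_nhdsWithin_of_mem_nhds (Metric.ball_mem_nhds x hr), ?_⟩
    intro ε hε
    obtain ⟨δ, hδ, hu⟩ := h ε hε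
    exact ⟨δ, hδ, 2, by simp, hu⟩

/-- Jensen's inequality for the probability density ρ, from the weighted Cauchy–Schwarz inequality.
-/
theorem enorm_integral_smul_sq_le {α F : Type*} [MeasurableSpace α] {μ : Measure α}
    [NormedAddCommGroup F] [NormedSpace ℝ F] {ρ : α → ℝ} (hρm : Measurable ρ)
    (hρ0 : ∀ z, 0 ≤ ρ z) (hρ : ∫⁻ z, ENNReal.ofReal (ρ z) ∂μ = 1) {w : α → F}
    (hw : Measurable fun z => ‖w z‖ₑ) :
    ‖∫ z, ρ z • w z ∂μ‖ₑ ^ 2 ≤ ∫⁻ z, ENNReal.ofReal (ρ z) * ‖w z‖ₑ ^ 2 ∂μ := by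
  calc ‖∫ z, ρ z • w z ∂μ‖ₑ ^ 2 ≤ (∫⁻ z, ENNReal.ofReal (ρ z) * ‖w z‖ₑ ∂μ) ^ 2 := by
        gcongr
        refine (enorm_integral_le_lintegral_enorm _).trans (le_of_eq ?_)
        refine lintegral_congr fun z => ?_
        rw [enorm_smul, Real.enorm_eq_ofReal (hρ0 z)]
    _ ≤ (∫⁻ z, ENNReal.ofReal (ρ z) ∂μ) * ∫⁻ z, ENNReal.ofReal (ρ z) * ‖w z‖ₑ ^ 2 ∂μ :=
        sq_lintegral_mul_le hρm.ennreal_ofReal hw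
    _ = _ := by rw [hρ, one_mul]

theorem lintegral_ofReal_normed {c : E d} (f : ContDiffBump c) :
    ∫⁻ z, ENNReal.ofReal (f.normed volume z) = 1 := by
  rw [← ofReal_integral_eq_lintegral_ofReal f.integrable_normed
    (Eventually.of_forall f.nonneg_normed), f.integral_normed, ENNReal.ofReal_one]

theorem Continuous.integrableOn_of_isBounded {F : Type*} [NormedAddCommGroup F]
    (hΩ : Bornology.IsBounded Ω) {f : E d → F} (hf : Continuous f) : IntegrableOn f Ω :=
  (hf.continuousOn.integrableOn_compact
    (Metric.isCompact_of_isClosed_isBounded isClosed_closure hΩ.closure)).mono_set subset_closure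

/-- The mollification `x ↦ ∫ ρ(z) u(x + z) dz` is close to `u` at distance from the boundary. -/
theorem lintegral_mollify_sub_sq_le {Ω : Set (E d)} (hΩm : MeasurableSet Ω) {δ : ℝ}
    (f : ContDiffBump (0 : E d)) (hf : f.rOut ≤ δ) {u : E d → ℂ} (hu : ContDiff ℝ 1 u) :
    ∫⁻ x in innerRegion Ω δ, ‖(∫ z, f.normed volume z • u (x + z)) - u x‖ₑ ^ 2
      ≤ ENNReal.ofReal f.rOut ^ 2 * ∫⁻ y in Ω, ‖fderiv ℝ u y‖ₑ ^ 2 := by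
  set ρ : E d → ℝ := f.normed volume with hρdef
  have hρc : Continuous ρ := f.continuous_normed
  have hρ0 : ∀ z, 0 ≤ ρ z := f.nonneg_normed
  have hρ1 : ∫⁻ z, ENNReal.ofReal (ρ z) = 1 := lintegral_ofReal_normed f
  have hρi : ∫ z, ρ z = 1 := f.integral_normed
  have hρs : Function.support ρ = Metric.ball 0 f.rOut := f.support_normed_eq
  set h := f.rOut with hh
  set K := innerRegion Ω δ with hK
  have hKm : MeasurableSet K := (isClosed_innerRegion Ω δ).measurableSet
  set D := ∫⁻ y in Ω, ‖fderiv ℝ u y‖ₑ ^ 2 with hD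
  set m : E d → ℂ := fun x => ∫ z, ρ z • u (x + z) with hm
  have hint : ∀ x, Integrable fun z => ρ z • u (x + z) := fun x =>
    (hρc.smul (hu.continuous.comp (by fun_prop))).integrable_of_hasCompactSupport
      f.hasCompactSupport_normed.smul_right
  have hum : Measurable fun p : E d × E d => ‖u (p.1 + p.2) - u p.1‖ₑ ^ 2 := by
    have : Continuous fun p : E d × E d => u (p.1 + p.2) - u p.1 :=
      (hu.continuous.comp (by fun_prop)).sub (hu.continuous.comp (by fun_prop))
    exact this.enorm.measurable.pow_const 2
  calc ∫⁻ x in K, ‖m x - u x‖ₑ ^ 2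
      ≤ ∫⁻ x in K, ∫⁻ z, ENNReal.ofReal (ρ z) * ‖u (x + z) - u x‖ₑ ^ 2 := by
        refine lintegral_mono fun x => ?_
        have e1 : m x - u x = ∫ z, ρ z • (u (x + z) - u x) := by
          simp only [smul_sub]
          rw [integral_sub (hint x) (f.integrable_normed.smul_const _), integral_smul_const, hρi,
            one_smul]
        simp only
        rw [e1]
        refine enorm_integral_smul_sq_le hρc.measurable hρ0 hρ1 ?_
        exact ((hu.continuous.comp (by fun_prop)).sub continuous_const).enorm.measurable
    _ = ∫⁻ z, ∫⁻ x in K, ENNReal.ofReal (ρ z) * ‖u (x + z) - u x‖ₑ ^ 2 := by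
        rw [lintegral_lintegral_swap]
        exact ((hρc.measurable.ennreal_ofReal.comp measurable_snd).mul hum).aemeasurable
    _ ≤ ∫⁻ z, ENNReal.ofReal (ρ z) * (ENNReal.ofReal h ^ 2 * D) := by
        refine lintegral_mono fun z => ?_
        simp only
        rw [lintegral_const_mul' _ _ ENNReal.ofReal_ne_top]
        by_cases hz : z ∈ Metric.ball (0 : E d) h
        · gcongr
          rw [mem_ball_zero_iff] at hz
          refine (lintegral_enorm_translate_sub_sq_le volume hu hKm hΩm z ?_).trans ?_
          · intro y hy s hs
            refine hy ?_
            rw [Metric.mem_ball, dist_eq_norm, add_sub_cancel_left, norm_smul,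
              Real.norm_of_nonneg hs.1.le]
            exact (mul_le_of_le_one_left (norm_nonneg _) hs.2).trans_lt (hz.trans_le hf)
          · gcongr
            rw [← ofReal_norm]
            exact ENNReal.ofReal_le_ofReal hz.le
        · have : ρ z = 0 := by
            rw [← hρs] at hz
            simpa using hz
          simp [this]
    _ = ENNReal.ofReal h ^ 2 * D := by
        rw [lintegral_mul_const _ hρc.measurable.ennreal_ofReal, hρ1, one_mul]

/-- Finitely many averages control the mollification of a function. -/
theorem enorm_mollify_sq_le (hΩ : IsBoundedLipschitzDomain Ω) {δ : ℝ}
    (f : ContDiffBump (0 : E d)) (hf : f.rOut ≤ δ) {κ η : ℝ}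
    (hκρ : ∀ ⦃a b : E d⦄, dist a b < κ → dist (f.normed volume a) (f.normed volume b) < η)
    {u : E d → ℂ} (hu : ContDiff ℝ 1 u) {x p : E d} (hx : x ∈ innerRegion Ω δ)
    (hp : x ∈ Metric.ball p κ) :
    ‖∫ z, f.normed volume z • u (x + z)‖ₑ ^ 2
      ≤ 2 * ‖∫ y in Ω, f.normed volume (y - p) • u y‖ₑ ^ 2
        + 2 * (volume Ω * (ENNReal.ofReal η ^ 2 * ∫⁻ y in Ω, ‖u y‖ₑ ^ 2)) := by
  set ρ : E d → ℝ := f.normed volume with hρdef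
  have hρc : Continuous ρ := f.continuous_normed
  have hρs : Function.support ρ = Metric.ball 0 f.rOut := f.support_normed_eq
  set U := ∫⁻ y in Ω, ‖u y‖ₑ ^ 2 with hU
  set m : E d → ℂ := fun x => ∫ z, ρ z • u (x + z) with hm
  -- For x in the inner region the kernel centred at x is supported in Ω, so nothing outside Ω
  -- enters the average.
  have e1 : m x = ∫ y in Ω, ρ (y - x) • u y := by
    rw [hm, setIntegral_eq_integral_of_forall_compl_eq_zero,
      ← integral_add_left_eq_self (fun y => ρ (y - x) • u y) x]
    · simp
    · intro y hy
      have : y - x ∉ Function.support ρ := by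
        rw [hρs, mem_ball_zero_iff, ← dist_eq_norm]
        intro hlt
        exact hy (hx (Metric.mem_ball.2 (hlt.trans_le hf)))
      rw [Function.notMem_support.1 this, zero_smul]
  have hi : ∀ p : E d, IntegrableOn (fun y => ρ (y - p) • u y) Ω := fun p =>
    Continuous.integrableOn_of_isBounded hΩ.isBounded
      ((hρc.comp (by fun_prop)).smul hu.continuous)
  have e2 : m x = (∫ y in Ω, ρ (y - p) • u y) + ∫ y in Ω, (ρ (y - x) - ρ (y - p)) • u y := by
    simp only [sub_smul]
    rw [e1, integral_sub (hi x) (hi p)]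
    abel
  change ‖m x‖ₑ ^ 2 ≤ _
  rw [e2]
  refine (enorm_add_sq_le _ _).trans ?_
  gcongr
  calc ‖∫ y in Ω, (ρ (y - x) - ρ (y - p)) • u y‖ₑ ^ 2
      ≤ (∫⁻ y in Ω, ENNReal.ofReal η * ‖u y‖ₑ) ^ 2 := by
        gcongr
        refine (enorm_integral_le_lintegral_enorm _).trans (lintegral_mono fun y => ?_)
        simp only
        rw [enorm_smul]
        gcongr
        rw [← ofReal_norm, ← dist_eq_norm]
        refine ENNReal.ofReal_le_ofReal (hκρ ?_).le
        rw [dist_sub_left, dist_comm, dist_comm] at *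
        exact Metric.mem_ball.1 hp
    _ ≤ volume Ω * ∫⁻ y in Ω, (ENNReal.ofReal η * ‖u y‖ₑ) ^ 2 := by
        refine (sq_lintegral_le
          (hu.continuous.enorm.measurable.const_mul _).aemeasurable).trans (le_of_eq ?_)
        rw [Measure.restrict_apply_univ]
    _ = volume Ω * (ENNReal.ofReal η ^ 2 * U) := by
        simp only [mul_pow]
        rw [lintegral_const_mul' _ _ (by simp)]

/-- The Fréchet–Kolmogorov argument. At scale h the mollification differs from u by O(h‖∇u‖), and
uniform continuity of the kernel compares its value at x with the average at the nearest point of a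
finite κ-net. The g k are the kernels centred at the net points. -/
theorem lintegral_innerRegion_le (hΩ : IsBoundedLipschitzDomain Ω) {δ : ℝ} (hδ : 0 < δ)
    {ε : ℝ≥0∞} (hε : ε ≠ 0) : ∃ (N : ℕ) (g : Fin N → E d → ℝ) (C : ℝ≥0∞), C ≠ ⊤ ∧
      (∀ k, Continuous (g k)) ∧ ∀ u : E d → ℂ, ContDiff ℝ 1 u →
      ∫⁻ y in innerRegion Ω δ, ‖u y‖ₑ ^ 2 ≤ ε * (∫⁻ y in Ω, ‖fderiv ℝ u y‖ₑ ^ 2)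
        + ε * (∫⁻ y in Ω, ‖u y‖ₑ ^ 2) + C * ∑ k, ‖∫ y in Ω, g k y • u y‖ₑ ^ 2 := by
  obtain ⟨h, hh, hhδ, hhε⟩ := ENNReal_exists_pos_two_mul_sq_le hε hδ (C := 2) (by simp)
  have hΩm := hΩ.isOpen.measurableSet
  have hΩfin : volume Ω ≠ ⊤ := hΩ.isBounded.measure_lt_top.ne
  let f : ContDiffBump (0 : E d) := ⟨h / 2, h, by positivity, by linarith⟩
  set ρ : E d → ℝ := f.normed volume with hρdef
  have hρc : Continuous ρ := f.continuous_normed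
  have hρu : UniformContinuous ρ := 
    f.hasCompactSupport_normed.uniformContinuous_of_continuous hρc
  -- The constant is the factor that multiplies η² ∫|u|² in the final estimate.
  obtain ⟨η, hη, -, hηε⟩ := ENNReal_exists_pos_two_mul_sq_le hε one_pos
    (C := 2 * (volume Ω * (2 * volume Ω))) (by finiteness)
  obtain ⟨κ, hκ, hκρ⟩ := Metric.uniformContinuous_iff.1 hρu η hη
  have hKb : Bornology.IsBounded (innerRegion Ω δ) :=
    hΩ.isBounded.subset (innerRegion_subset hδ)
  obtain ⟨F, hF, hFK⟩ := Metric.totallyBounded_iff.1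
    ((Metric.isCompact_of_isClosed_isBounded isClosed_closure hKb.closure).totallyBounded.subset
      subset_closure) κ hκ
  have : Fintype F := hF.fintype
  let e := Fintype.equivFin F
  refine ⟨Fintype.card F, fun k y => ρ (y - (e.symm k : E d)), 2 * (volume Ω * 2), by finiteness,
    fun k => hρc.comp (by fun_prop), fun u hu => ?_⟩
  have hsum : ∑ k, ‖∫ y in Ω, ρ (y - (e.symm k : E d)) • u y‖ₑ ^ 2
      = ∑ p : F, ‖∫ y in Ω, ρ (y - (p : E d)) • u y‖ₑ ^ 2 :=
    Equiv.sum_comp e.symm fun p : F => ‖∫ y in Ω, ρ (y - (p : E d)) • u y‖ₑ ^ 2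
  rw [hsum]
  have hQle : ∀ p : F, ‖∫ y in Ω, ρ (y - (p : E d)) • u y‖ₑ ^ 2
      ≤ ∑ p : F, ‖∫ y in Ω, ρ (y - (p : E d)) • u y‖ₑ ^ 2 := fun p =>
    Finset.single_le_sum_of_canonicallyOrdered
      (f := fun p : F => ‖∫ y in Ω, ρ (y - (p : E d)) • u y‖ₑ ^ 2) (Finset.mem_univ p)
  set Q := ∑ p : F, ‖∫ y in Ω, ρ (y - (p : E d)) • u y‖ₑ ^ 2 with hQ
  set K := innerRegion Ω δ with hK
  have hKm : MeasurableSet K := (isClosed_innerRegion Ω δ).measurableSet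
  set D := ∫⁻ y in Ω, ‖fderiv ℝ u y‖ₑ ^ 2 with hD
  set U := ∫⁻ y in Ω, ‖u y‖ₑ ^ 2 with hU
  set m : E d → ℂ := fun x => ∫ z, ρ z • u (x + z) with hm
  have hdiff : ∫⁻ x in K, ‖m x - u x‖ₑ ^ 2 ≤ ENNReal.ofReal h ^ 2 * D :=
    lintegral_mollify_sub_sq_le hΩm f hhδ hu
  have hmK : ∀ x ∈ K, ‖m x‖ₑ ^ 2 ≤ 2 * Q + 2 * (volume Ω * (ENNReal.ofReal η ^ 2 * U)) := by
    intro x hx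
    obtain ⟨p, hpF, hp⟩ := Set.mem_iUnion₂.1 (hFK hx)
    refine (enorm_mollify_sq_le hΩ f hhδ hκρ hu hx hp).trans ?_
    gcongr
    exact hQle ⟨p, hpF⟩
  have hmeas : Measurable fun x => 2 * ‖m x - u x‖ₑ ^ 2 := by
    have hmm : StronglyMeasurable m := by
      have : StronglyMeasurable fun p : E d × E d => ρ p.2 • u (p.1 + p.2) :=
        ((hρc.comp continuous_snd).smul
          (hu.continuous.comp (by fun_prop))).stronglyMeasurable
      exact this.integral_prod_right
    exact ((hmm.measurable.sub hu.continuous.measurable).enorm.pow_const 2).const_mul 2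
  calc ∫⁻ x in K, ‖u x‖ₑ ^ 2
      ≤ ∫⁻ x in K, (2 * ‖m x - u x‖ₑ ^ 2 + 2 * ‖m x‖ₑ ^ 2) :=
        lintegral_mono fun x => enorm_sq_le_two_mul_add _ _
    _ = 2 * (∫⁻ x in K, ‖m x - u x‖ₑ ^ 2) + 2 * ∫⁻ x in K, ‖m x‖ₑ ^ 2 := by
        rw [lintegral_add_left hmeas, lintegral_const_mul' _ _ (by simp),
          lintegral_const_mul' _ _ (by simp)]
    _ ≤ 2 * (ENNReal.ofReal h ^ 2 * D)
        + 2 * (volume Ω * (2 * Q + 2 * (volume Ω * (ENNReal.ofReal η ^ 2 * U)))) := by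
        gcongr
        refine (setLIntegral_mono' hKm hmK).trans ?_
        rw [setLIntegral_const, mul_comm]
        gcongr
        exact innerRegion_subset hδ
    _ = 2 * ENNReal.ofReal h ^ 2 * D + 2 * (volume Ω * (2 * volume Ω)) * ENNReal.ofReal η ^ 2 * U
        + 2 * (volume Ω * 2) * Q := by ring
    _ ≤ ε * D + ε * U + 2 * (volume Ω * 2) * Q := by gcongr

/-- A quantitative form of the compactness of the embedding `H¹(Ω) ⊆ L²(Ω)`. -/
theorem lintegral_le_finite_rank (hΩ : IsBoundedLipschitzDomain Ω) {ε : ℝ≥0∞} (hε : ε ≠ 0) :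
    ∃ (N : ℕ) (g : Fin N → E d → ℝ) (C : ℝ≥0∞), C ≠ ⊤ ∧
      (∀ k, Continuous (g k)) ∧ ∀ u : E d → ℂ, ContDiff ℝ 1 u →
      ∫⁻ y in Ω, ‖u y‖ₑ ^ 2 ≤ ε * (∫⁻ y in Ω, ‖fderiv ℝ u y‖ₑ ^ 2)
        + C * ∑ k, ‖∫ y in Ω, g k y • u y‖ₑ ^ 2 := by
  obtain ⟨δ, hδ, C₁, hC₁, h1⟩ := lintegral_le_innerRegion hΩ (ε := ε / 2 / 2) (by simpa using hε)
  -- The bound C₁ε' ≤ 1/2 lets the L² term on the right be absorbed on the left; the other bound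
  -- keeps the gradient coefficient below ε/2 before doubling.
  obtain ⟨ε', hε', hε1, hε2⟩ : ∃ ε' : ℝ≥0∞, ε' ≠ 0 ∧ C₁ * ε' ≤ ε / 2 / 2 ∧ C₁ * ε' ≤ 1 / 2 := by
    refine ⟨min (ε / 2 / 2) (1 / 2) / (C₁ + 1), ?_, ?_⟩
    · refine ENNReal.div_ne_zero.2 ⟨?_, by finiteness⟩
      simp [hε]
    · rw [← le_min_iff]
      calc C₁ * (min (ε / 2 / 2) (1 / 2) / (C₁ + 1))
          ≤ (C₁ + 1) * (min (ε / 2 / 2) (1 / 2) / (C₁ + 1)) := by gcongr; exact le_self_add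
        _ = min (ε / 2 / 2) (1 / 2) := ENNReal.mul_div_cancel (by simp) (by finiteness)
  obtain ⟨N, g, C₂, hC₂, hg, h2⟩ := lintegral_innerRegion_le hΩ hδ hε'
  refine ⟨N, g, 2 * (C₁ * C₂), by finiteness, hg, fun u hu => ?_⟩
  set D := ∫⁻ y in Ω, ‖fderiv ℝ u y‖ₑ ^ 2 with hD
  set U := ∫⁻ y in Ω, ‖u y‖ₑ ^ 2 with hU
  set S := ∑ k, ‖∫ y in Ω, g k y • u y‖ₑ ^ 2 with hS
  -- Absorption cancels U/2 in [0, ∞], which requires U to be finite.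
  have hUfin : U ≠ ⊤ := by
    have hi := Continuous.integrableOn_of_isBounded hΩ.isBounded
      (f := fun y => ‖u y‖ ^ 2) (hu.continuous.norm.pow 2)
    have := hi.2.ne
    simpa [enorm_pow] using this
  have h3 : U ≤ (ε / 2 * D + C₁ * C₂ * S) + U / 2 := by
    calc U ≤ ε / 2 / 2 * D + C₁ * (ε' * D + ε' * U + C₂ * S) := (h1 u hu).trans (by
          gcongr
          exact h2 u hu)
      _ = ε / 2 / 2 * D + (C₁ * ε') * D + C₁ * C₂ * S + (C₁ * ε') * U := by ring
      _ ≤ ε / 2 / 2 * D + ε / 2 / 2 * D + C₁ * C₂ * S + 1 / 2 * U := by gcongr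
      _ = (ε / 2 * D + C₁ * C₂ * S) + U / 2 := by
          rw [← add_mul, ENNReal.add_halves, one_div, ENNReal.div_eq_inv_mul (a := U)]
  have h4 : U / 2 ≤ ε / 2 * D + C₁ * C₂ * S := by
    rw [← ENNReal.add_le_add_iff_right (a := U / 2) (by finiteness), ENNReal.add_halves]
    exact h3
  calc U = U / 2 + U / 2 := (ENNReal.add_halves U).symm
    _ ≤ (ε / 2 * D + C₁ * C₂ * S) + (ε / 2 * D + C₁ * C₂ * S) := add_le_add h4 h4
    _ = (ε / 2 + ε / 2) * D + 2 * (C₁ * C₂) * S := by ring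
    _ = _ := by rw [ENNReal.add_halves]

end Compactness

/-! ### Density of `C¹` functions in `H¹` -/

section Density

open ContinuousLinearMap
open scoped Convolution

variable {d : ℕ} {Ω : Set (E d)}

theorem eLpNorm_two_sq {α F : Type*} [MeasurableSpace α] {μ : Measure α} [NormedAddCommGroup F]
    (f : α → F) : eLpNorm f 2 μ ^ 2 = ∫⁻ x, ‖f x‖ₑ ^ 2 ∂μ := by
  have := eLpNorm_nnreal_pow_eq_lintegral (μ := μ) (f := f) (p := 2) (by norm_num)
  simpa using this

theorem eLpNorm_two_le {α F : Type*} [MeasurableSpace α] {μ : Measure α} [NormedAddCommGroup F]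
    {f : α → F} {ε : ℝ≥0∞} (h : ∫⁻ x, ‖f x‖ₑ ^ 2 ∂μ ≤ ε ^ 2) : eLpNorm f 2 μ ≤ ε := by
  rw [← eLpNorm_two_sq] at h
  by_contra! hlt
  exact absurd h (not_le.2 (ENNReal.pow_lt_pow_left two_ne_zero hlt))

theorem exists_translate_close {V : Type*} [NormedAddCommGroup V] {F : E d → V}
    (hF : MemLp F 2 volume) {ε : ℝ≥0∞} (hε : ε ≠ 0) :
    ∃ κ > (0 : ℝ), ∀ z, ‖z‖ < κ → eLpNorm (fun x => F (x - z) - F x) 2 volume ≤ ε := by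
  have : Fact ((2 : ℝ≥0∞) ≠ ⊤) := ⟨by simp⟩
  have hcont : Continuous fun z : E d => DomAddAct.mk (-z) +ᵥ hF.toLp F := by
    have h1 : Continuous fun z : E d => DomAddAct.mk (-z) :=
      DomAddAct.continuous_mk.comp continuous_neg
    exact h1.vadd continuous_const
  have h0 : Tendsto (fun z : E d => edist (DomAddAct.mk (-z) +ᵥ hF.toLp F) (hF.toLp F))
      (𝓝 0) (𝓝 0) := by
    have := (hcont.edist continuous_const).tendsto (f := fun z : E d =>
      edist (DomAddAct.mk (-z) +ᵥ hF.toLp F) (hF.toLp F)) 0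
    have e : DomAddAct.mk (-(0 : E d)) +ᵥ hF.toLp F = hF.toLp F := by
      rw [DomAddAct.mk_vadd_toLp]
      congr 1
      funext x
      simp
    rw [e, edist_self] at this
    exact this
  have h1 := h0.eventually (gt_mem_nhds (pos_iff_ne_zero.2 hε))
  obtain ⟨κ, hκ, h2⟩ := Metric.eventually_nhds_iff.1 h1
  refine ⟨κ, hκ, fun z hz => ?_⟩
  have h3 := h2 (y := z) (by simpa using hz)
  rw [DomAddAct.mk_vadd_toLp, Lp.edist_toLp_toLp] at h3
  refine le_trans (le_of_eq (congrArg (fun g => eLpNorm g 2 volume) ?_)) h3.le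
  funext x
  simp [sub_eq_add_neg, add_comm]

/-- By Jensen the error is an average of translation errors over the support of the kernel. The
kernel need not be centred at 0, since later it also carries the inward shift. -/
theorem exists_mollify_close {V : Type*} [NormedAddCommGroup V] [NormedSpace ℝ V] [CompleteSpace V]
    {F : E d → V} (hF : MemLp F 2 volume) {ε : ℝ≥0∞} (hε : ε ≠ 0) :
    ∃ κ > (0 : ℝ), ∀ (c : E d) (f : ContDiffBump c), ‖c‖ + f.rOut ≤ κ →
      eLpNorm (fun x => (f.normed volume ⋆[lsmul ℝ ℝ, volume] F) x - F x) 2 volume ≤ ε := by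
  -- A strongly measurable representative is needed for Tonelli. Convolution does not see the change
  -- on a null set.
  suffices H : ∀ F : E d → V, MemLp F 2 volume → StronglyMeasurable F →
      ∃ κ > (0 : ℝ), ∀ (c : E d) (f : ContDiffBump c), ‖c‖ + f.rOut ≤ κ →
      eLpNorm (fun x => (f.normed volume ⋆[lsmul ℝ ℝ, volume] F) x - F x) 2 volume ≤ ε by
    obtain ⟨κ, hκ, h⟩ := H (hF.1.mk F) (hF.ae_eq hF.1.ae_eq_mk) hF.1.stronglyMeasurable_mk
    refine ⟨κ, hκ, fun c f hf => ?_⟩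
    refine le_trans (le_of_eq (eLpNorm_congr_ae ?_)) (h c f hf)
    filter_upwards [hF.1.ae_eq_mk] with x hx
    refine congrArg₂ (· - ·) ?_ hx
    rw [convolution_def, convolution_def]
    refine integral_congr_ae ?_
    have := (quasiMeasurePreserving_sub_left volume x).ae_eq_comp hF.1.ae_eq_mk
    filter_upwards [this] with z hz
    simp only [Function.comp_apply] at hz
    rw [hz]
  clear hF F
  intro F hF hFm
  obtain ⟨κ, hκ, h⟩ := exists_translate_close hF hε
  refine ⟨κ, hκ, fun c f hf => eLpNorm_two_le ?_⟩
  set ρ : E d → ℝ := f.normed volume with hρdef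
  have hρc : Continuous ρ := f.continuous_normed
  have hρs : Function.support ρ = Metric.ball c f.rOut := f.support_normed_eq
  have hex := f.hasCompactSupport_normed (μ := volume).convolutionExists_left (lsmul ℝ ℝ) hρc
    (hF.locallyIntegrable (by norm_num))
  have hm2 : Measurable fun p : E d × E d => ‖F (p.1 - p.2) - F p.1‖ₑ ^ 2 := by
    have h1 : StronglyMeasurable fun p : E d × E d => F (p.1 - p.2) - F p.1 :=
      (hFm.comp_measurable (by fun_prop)).sub (hFm.comp_measurable measurable_fst)
    exact h1.enorm.pow_const 2
  calc ∫⁻ x, ‖(ρ ⋆[lsmul ℝ ℝ, volume] F) x - F x‖ₑ ^ 2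
      ≤ ∫⁻ x, ∫⁻ z, ENNReal.ofReal (ρ z) * ‖F (x - z) - F x‖ₑ ^ 2 := by
        refine lintegral_mono fun x => ?_
        have e1 : (ρ ⋆[lsmul ℝ ℝ, volume] F) x - F x = ∫ z, ρ z • (F (x - z) - F x) := by
          have hx : Integrable fun z => ρ z • F (x - z) := hex x
          have hx' : Integrable fun z => ρ z • F x := f.integrable_normed.smul_const _
          simp only [smul_sub]
          rw [integral_sub hx hx', integral_smul_const, hρdef, f.integral_normed, one_smul]
          rfl
        simp only
        rw [e1]
        refine enorm_integral_smul_sq_le hρc.measurable f.nonneg_normed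
          (lintegral_ofReal_normed f) ?_
        exact ((hFm.comp_measurable (by fun_prop)).sub stronglyMeasurable_const).enorm
    _ = ∫⁻ z, ∫⁻ x, ENNReal.ofReal (ρ z) * ‖F (x - z) - F x‖ₑ ^ 2 := by
        rw [lintegral_lintegral_swap]
        exact ((hρc.measurable.ennreal_ofReal.comp measurable_snd).mul hm2).aemeasurable
    _ ≤ ∫⁻ z, ENNReal.ofReal (ρ z) * ε ^ 2 := by
        refine lintegral_mono fun z => ?_
        simp only
        rw [lintegral_const_mul' _ _ ENNReal.ofReal_ne_top]
        by_cases hz : z ∈ Metric.ball c f.rOut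
        · gcongr
          rw [← eLpNorm_two_sq]
          gcongr
          refine h z ?_
          rw [Metric.mem_ball, dist_eq_norm] at hz
          have := norm_add_le (z - c) c
          rw [sub_add_cancel] at this
          linarith
        · have : ρ z = 0 := by
            rw [← hρs] at hz
            simpa using hz
          simp [this]
    _ = ε ^ 2 := by
        rw [lintegral_mul_const _ hρc.measurable.ennreal_ofReal, lintegral_ofReal_normed f, one_mul]

/-- The gradient `φ ∇f + f ∇φ` of the product `φ f`. -/
noncomputable def productGrad (φ : E d → ℝ) (f : E d → ℂ) (G : E d → EuclideanSpace ℂ (Fin d))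
    (x : E d) : EuclideanSpace ℂ (Fin d) :=
  WithLp.toLp 2 fun i =>
    (φ x : ℂ) * G x i + (fderiv ℝ φ x (EuclideanSpace.single i 1) : ℂ) * f x

theorem memLp_ofReal_mul {φ : E d → ℝ} (hφ : Continuous φ) (hφc : HasCompactSupport φ)
    {μ : Measure (E d)} {f : E d → ℂ} (hf : MemLp f 2 μ) :
    MemLp (fun x => (φ x : ℂ) * f x) 2 μ := by
  obtain ⟨C, hC⟩ := hφc.exists_bound_of_continuous hφ
  refine MemLp.of_le_mul (g := f) (c := C) hf ?_ (Eventually.of_forall fun x => ?_)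
  · exact (Complex.continuous_ofReal.comp hφ).aestronglyMeasurable.mul hf.1
  · rw [norm_mul, Complex.norm_real]
    exact mul_le_mul_of_nonneg_right (hC x) (norm_nonneg _)

theorem memLp_euclidean {α : Type*} [MeasurableSpace α] {μ : Measure α}
    {H : α → EuclideanSpace ℂ (Fin d)} (h : ∀ i, MemLp (fun x => H x i) 2 μ) : MemLp H 2 μ := by
  have e : H = fun x => ∑ i, H x i • (EuclideanSpace.single i (1 : ℂ)) := by
    funext x
    ext k
    simp [Finset.sum_apply, Pi.single_apply]
  rw [e]
  refine memLp_finsetSum _ fun i _ => ?_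
  exact MemLp.of_le_mul (g := fun x => H x i) (c := 1) (h i)
    ((h i).1.smul_const _) (Eventually.of_forall fun x => by
      simp [norm_smul])

theorem memLp_apply {α : Type*} [MeasurableSpace α] {μ : Measure α}
    {H : α → EuclideanSpace ℂ (Fin d)} (h : MemLp H 2 μ) (i : Fin d) :
    MemLp (fun x => H x i) 2 μ :=
  (EuclideanSpace.proj (𝕜 := ℂ) i).comp_memLp' h

theorem memLp_productGrad {φ : E d → ℝ} (hφ : ContDiff ℝ 1 φ) (hφc : HasCompactSupport φ)
    {μ : Measure (E d)} {f : E d → ℂ} (hf : MemLp f 2 μ) {G : E d → EuclideanSpace ℂ (Fin d)}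
    (hG : MemLp G 2 μ) : MemLp (productGrad φ f G) 2 μ := by
  refine memLp_euclidean fun i => ?_
  refine (memLp_ofReal_mul hφ.continuous hφc (memLp_apply hG i)).add (memLp_ofReal_mul
    (φ := fun x => fderiv ℝ φ x (EuclideanSpace.single i 1)) ?_ ?_ hf)
  · exact (hφ.continuous_fderiv one_ne_zero).clm_apply continuous_const
  · exact hφc.fderiv_apply ℝ _

theorem fderiv_convolution_apply {ρ : E d → ℝ} (hρ : ContDiff ℝ 1 ρ) (hρc : HasCompactSupport ρ)
    {F : E d → ℂ} (hF : LocallyIntegrable F volume) (x v : E d) :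
    fderiv ℝ (ρ ⋆[lsmul ℝ ℝ, volume] F) x v = ∫ y, fderiv ℝ ρ (x - y) v • F y := by
  have h := (hρc.hasFDerivAt_convolution_left (lsmul ℝ ℝ) hρ hF x).fderiv
  have hex : ConvolutionExistsAt (fderiv ℝ ρ) F x ((lsmul ℝ ℝ).precompL (E d)) volume :=
    (hρc.fderiv ℝ).convolutionExists_left _ (hρ.continuous_fderiv one_ne_zero) hF x
  rw [h, convolution_def, ContinuousLinearMap.integral_apply hex,
    ← integral_sub_left_eq_self (fun y => fderiv ℝ ρ (x - y) v • F y) volume x]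
  refine integral_congr_ae (Eventually.of_forall fun t => ?_)
  simp [precompL_apply]

/-- The derivative first falls on the kernel. Condition hx makes y ↦ ρ(x - y) φ(y) a test function
supported in Ω, so the definition of the weak gradient moves the derivative onto φ f. Thus extension
by zero creates no boundary term at such x. -/
theorem cgrad_convolution_eq (hΩm : MeasurableSet Ω) (hΩ : volume Ω ≠ ⊤) {ρ φ : E d → ℝ}
    (hρ : ContDiff ℝ ∞ ρ) (hρc : HasCompactSupport ρ) (hφ : ContDiff ℝ ∞ φ)
    (hφc : HasCompactSupport φ) {f : E d → ℂ} {G : E d → EuclideanSpace ℂ (Fin d)}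
    (hf : MemLp f 2 (volume.restrict Ω)) (hG : HasWeakGrad Ω f G) {x : E d}
    (hx : ∀ y ∈ tsupport φ, x - y ∈ tsupport ρ → y ∈ Ω) :
    cgrad (ρ ⋆[lsmul ℝ ℝ, volume] Ω.indicator fun y => (φ y : ℂ) * f y) x
      = (ρ ⋆[lsmul ℝ ℝ, volume] Ω.indicator (productGrad φ f G)) x := by
  have : IsFiniteMeasure (volume.restrict Ω) := ⟨by simpa using hΩ.lt_top⟩
  have hφ1 : ContDiff ℝ 1 φ := hφ.of_le (by exact_mod_cast le_top)
  have hρ1 : ContDiff ℝ 1 ρ := hρ.of_le (by exact_mod_cast le_top)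
  have hF2 : MemLp (Ω.indicator fun y => (φ y : ℂ) * f y) 2 volume :=
    (memLp_indicator_iff_restrict hΩm).2 (memLp_ofReal_mul hφ.continuous hφc hf)
  have hH2 : MemLp (Ω.indicator (productGrad φ f G)) 2 volume :=
    (memLp_indicator_iff_restrict hΩm).2 (memLp_productGrad hφ1 hφc hf hG.1)
  have hH := hH2.locallyIntegrable (by norm_num)
  have hex := hρc.convolutionExists_left (lsmul ℝ ℝ) hρ.continuous hH x
  have hbdd : ∀ {g : E d → ℝ} {h : E d → ℂ}, Continuous g → HasCompactSupport g →
      MemLp h 2 (volume.restrict Ω) → IntegrableOn (fun y => (g y : ℂ) * h y) Ω :=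
    fun hg hgc hh => (memLp_ofReal_mul hg hgc hh).integrable (by norm_num)
  have hsub : ∀ {g : E d → ℝ}, HasCompactSupport g → HasCompactSupport fun y => g (x - y) :=
    fun hg => hg.comp_homeomorph (Homeomorph.subLeft x)
  ext i
  set e : E d := EuclideanSpace.single i 1 with he
  have hDρ : Continuous fun y => fderiv ℝ ρ y e :=
    (hρ1.continuous_fderiv one_ne_zero).clm_apply continuous_const
  have hDφ : Continuous fun y => fderiv ℝ φ y e :=
    (hφ1.continuous_fderiv one_ne_zero).clm_apply continuous_const
  have lhs : cgrad (ρ ⋆[lsmul ℝ ℝ, volume] Ω.indicator fun y => (φ y : ℂ) * f y) x i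
      = ∫ y in Ω, ((fderiv ℝ ρ (x - y) e * φ y : ℝ) : ℂ) * f y := by
    change fderiv ℝ _ x e = _
    rw [fderiv_convolution_apply hρ1 hρc (hF2.locallyIntegrable (by norm_num)),
      ← integral_indicator hΩm]
    refine integral_congr_ae (Eventually.of_forall fun y => ?_)
    by_cases hy : y ∈ Ω
    · simp [hy]
      ring
    · simp [hy]
  have rhs : (ρ ⋆[lsmul ℝ ℝ, volume] Ω.indicator (productGrad φ f G)) x i
      = ∫ y in Ω, (((ρ (x - y) * φ y : ℝ) : ℂ) * G y i
        + ((ρ (x - y) * fderiv ℝ φ y e : ℝ) : ℂ) * f y) := by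
    have h1 := (EuclideanSpace.proj (𝕜 := ℂ) i).integral_comp_comm hex
    rw [convolution_def]
    refine h1.symm.trans ?_
    rw [← integral_indicator hΩm, ← integral_sub_left_eq_self (fun y => Ω.indicator _ y) volume x]
    refine integral_congr_ae (Eventually.of_forall fun z => ?_)
    by_cases hy : x - z ∈ Ω
    · simp [hy, productGrad]
      ring
    · simp [hy]
  have hψd : ∀ y, HasFDerivAt (fun y => ρ (x - y) * φ y)
      (ρ (x - y) • fderiv ℝ φ y + φ y • (-fderiv ℝ ρ (x - y))) y := by
    intro y
    have h1 : HasFDerivAt (fun y => ρ (x - y)) (-fderiv ℝ ρ (x - y)) y := by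
      have h2 := ((hρ1.differentiable one_ne_zero) (x - y)).hasFDerivAt.comp y
        ((hasFDerivAt_id y).const_sub x)
      have h3 : fderiv ℝ ρ (x - y) ∘L (-ContinuousLinearMap.id ℝ (E d)) = -fderiv ℝ ρ (x - y) := by
        ext
        simp
      rw [h3] at h2
      exact h2
    exact h1.mul ((hφ1.differentiable one_ne_zero) y).hasFDerivAt
  have hψ := hG.2 (fun y => ρ (x - y) * φ y)
    ((hρ.comp (contDiff_const.sub contDiff_id)).mul hφ) hφc.mul_left (by
      intro y hy
      have hy1 : y ∈ tsupport φ := tsupport_mul_subset_right hy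
      have hy2 : y ∈ tsupport fun y => ρ (x - y) := tsupport_mul_subset_left hy
      refine hx y hy1 ?_
      have : tsupport (fun y => ρ (x - y)) ⊆ (fun y => x - y) ⁻¹' tsupport ρ := by
        refine closure_minimal (fun w hw => subset_tsupport _ hw)
          ((isClosed_tsupport ρ).preimage (by fun_prop))
      exact this hy2) i
  rw [lhs, rhs]
  have hi1 : IntegrableOn (fun y => ((fderiv ℝ ρ (x - y) e * φ y : ℝ) : ℂ) * f y) Ω :=
    hbdd ((hDρ.comp (by fun_prop)).mul hφ.continuous) hφc.mul_left hf
  have hi2 : IntegrableOn (fun y => ((ρ (x - y) * fderiv ℝ φ y e : ℝ) : ℂ) * f y) Ω :=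
    hbdd ((hρ.continuous.comp (by fun_prop)).mul hDφ) (hsub hρc).mul_right hf
  have hi3 : IntegrableOn (fun y => ((ρ (x - y) * φ y : ℝ) : ℂ) * G y i) Ω :=
    hbdd ((hρ.continuous.comp (by fun_prop)).mul hφ.continuous) hφc.mul_left (memLp_apply hG.1 i)
  have hsplit : ∫ y in Ω, (fderiv ℝ (fun y => ρ (x - y) * φ y) y e : ℂ) * f y
      = (∫ y in Ω, ((ρ (x - y) * fderiv ℝ φ y e : ℝ) : ℂ) * f y)
        - ∫ y in Ω, ((fderiv ℝ ρ (x - y) e * φ y : ℝ) : ℂ) * f y := by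
    rw [← integral_sub hi2 hi1]
    refine integral_congr_ae (Eventually.of_forall fun y => ?_)
    simp only
    rw [(hψd y).fderiv]
    simp only [add_apply, smul_apply, neg_apply, smul_eq_mul]
    push_cast
    ring
  rw [hsplit] at hψ
  rw [integral_add hi3 hi2]
  linear_combination -hψ

/-- A kernel centred at -t n samples φ f near x + t n. For x in Ω within the chart these points stay
inside Ω, so mollification commutes with the gradient on all of Ω, up to the boundary. -/
theorem exists_approx_of_tsupport_subset_ball (hΩ : IsBoundedLipschitzDomain Ω) {f : E d → ℂ}
    {G : E d → EuclideanSpace ℂ (Fin d)} (hf : MemLp f 2 (volume.restrict Ω))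
    (hG : HasWeakGrad Ω f G) {x₀ : E d} {r : ℝ} (hr : 0 < r) {n : E d} (hn : ‖n‖ ≤ 1) {t₀ : ℝ}
    (ht₀ : 0 < t₀) (hin : ∀ t > (0 : ℝ), t ≤ t₀ → ∃ δ > 0, ∀ y ∈ Ω ∩ Metric.ball x₀ r,
      Metric.ball (y + t • n) δ ⊆ Ω) {φ : E d → ℝ} (hφ : ContDiff ℝ ∞ φ)
    (hφs : tsupport φ ⊆ Metric.ball x₀ (r / 2)) {ε : ℝ≥0∞} (hε : ε ≠ 0) :
    ∃ u : E d → ℂ, ContDiff ℝ 1 u ∧ HasCompactSupport u ∧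
      eLpNorm (fun x => u x - φ x * f x) 2 (volume.restrict Ω) ≤ ε ∧
      eLpNorm (fun x => cgrad u x - productGrad φ f G x) 2 (volume.restrict Ω) ≤ ε := by
  have hΩm := hΩ.isOpen.measurableSet
  have hΩfin : volume Ω ≠ ⊤ := hΩ.isBounded.measure_lt_top.ne
  have hφc : HasCompactSupport φ := HasCompactSupport.of_support_subset_isCompact
    (isCompact_closedBall x₀ (r / 2))
    ((subset_tsupport φ).trans (hφs.trans Metric.ball_subset_closedBall))
  have hφ1 : ContDiff ℝ 1 φ := hφ.of_le (by exact_mod_cast le_top)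
  have hF2 : MemLp (Ω.indicator fun y => (φ y : ℂ) * f y) 2 volume :=
    (memLp_indicator_iff_restrict hΩm).2 (memLp_ofReal_mul hφ.continuous hφc hf)
  have hH2 : MemLp (Ω.indicator (productGrad φ f G)) 2 volume :=
    (memLp_indicator_iff_restrict hΩm).2 (memLp_productGrad hφ1 hφc hf hG.1)
  obtain ⟨κ₁, hκ₁, h1⟩ := exists_mollify_close hF2 hε
  obtain ⟨κ₂, hκ₂, h2⟩ := exists_mollify_close hH2 hε
  -- The bound r/4 keeps x in the ball of radius r when the sampled point is within r/2 of x₀. Shift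
  -- plus kernel radius is at most 2t, below both mollification thresholds.
  set t := min t₀ (min (r / 4) (min (κ₁ / 2) (κ₂ / 2))) with ht
  have htpos : 0 < t := by positivity
  have ht1 : t ≤ t₀ := min_le_left _ _
  have ht2 : t ≤ r / 4 := (min_le_right _ _).trans (min_le_left _ _)
  have ht3 : t ≤ κ₁ / 2 := (min_le_right _ _).trans ((min_le_right _ _).trans (min_le_left _ _))
  have ht4 : t ≤ κ₂ / 2 := (min_le_right _ _).trans ((min_le_right _ _).trans (min_le_right _ _))
  obtain ⟨δ, hδ, hδΩ⟩ := hin t htpos ht1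
  set s := min (δ / 2) t with hs
  have hspos : 0 < s := by positivity
  let b : ContDiffBump (-(t • n)) := ⟨s / 2, s, by positivity, by linarith⟩
  have hnt : ‖t • n‖ ≤ t := by
    rw [norm_smul, Real.norm_of_nonneg htpos.le]
    exact mul_le_of_le_one_right htpos.le hn
  have hst : s ≤ t := min_le_right _ _
  have hsδ : s < δ := (min_le_left _ _).trans_lt (by linarith)
  have hb : ‖-(t • n)‖ + b.rOut ≤ 2 * t := by
    rw [norm_neg]
    change ‖t • n‖ + s ≤ 2 * t
    linarith
  set ρ : E d → ℝ := b.normed volume with hρ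
  have hρc : HasCompactSupport ρ := b.hasCompactSupport_normed
  have hρd : ContDiff ℝ ∞ ρ := b.contDiff_normed
  have hρs : tsupport ρ = Metric.closedBall (-(t • n)) s := b.tsupport_normed_eq
  set F : E d → ℂ := Ω.indicator fun y => (φ y : ℂ) * f y with hF
  have hFc : HasCompactSupport F := by
    refine HasCompactSupport.of_support_subset_isCompact hφc.isCompact ?_
    intro y hy
    refine subset_tsupport φ ?_
    rw [Function.mem_support] at hy ⊢
    contrapose! hy
    by_cases hyΩ : y ∈ Ω <;> simp [hF, hyΩ, hy]
  refine ⟨ρ ⋆[lsmul ℝ ℝ, volume] F, ?_, ?_, ?_, ?_⟩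
  · exact_mod_cast hρc.contDiff_convolution_left (n := 1) (lsmul ℝ ℝ)
      (by exact_mod_cast hρd.of_le (by exact_mod_cast le_top))
      (hF2.locallyIntegrable (by norm_num))
  · exact hρc.convolution (lsmul ℝ ℝ) hFc
  · refine le_trans ?_ (h1 _ b (by linarith))
    refine le_trans (le_of_eq (eLpNorm_congr_ae ?_)) (eLpNorm_mono_measure _ Measure.restrict_le_self)
    filter_upwards [ae_restrict_mem hΩm] with x hx
    rw [hF, Set.indicator_of_mem hx]
  · refine le_trans ?_ (h2 _ b (by linarith))
    refine le_trans (le_of_eq (eLpNorm_congr_ae ?_)) (eLpNorm_mono_measure _ Measure.restrict_le_self)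
    filter_upwards [ae_restrict_mem hΩm] with x hx
    rw [hF, cgrad_convolution_eq hΩm hΩfin hρd hρc hφ hφc hf hG, Set.indicator_of_mem hx]
    intro y hy hxy
    rw [hρs, Metric.mem_closedBall, dist_eq_norm, sub_neg_eq_add] at hxy
    have hyb := hφs hy
    rw [Metric.mem_ball, dist_eq_norm] at hyb
    have hxb : x ∈ Metric.ball x₀ r := by
      rw [Metric.mem_ball, dist_eq_norm]
      have e : x - x₀ = (x - y + t • n) + -(t • n) + (y - x₀) := by abel
      rw [e]
      have := norm_add₃_le (a := x - y + t • n) (b := -(t • n)) (c := y - x₀)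
      rw [norm_neg] at this
      linarith
    refine hδΩ x ⟨hx, hxb⟩ ?_
    rw [Metric.mem_ball, dist_eq_norm, ← norm_neg]
    have e : -(y - (x + t • n)) = x - y + t • n := by abel
    rw [e]
    exact hxy.trans_lt hsδ

open scoped Manifold

/-- A finite smooth partition of unity near `closure Ω` that is subordinate to balls in which `Ω`
can be pushed into itself along a fixed direction. -/
theorem exists_partition (hΩ : IsBoundedLipschitzDomain Ω) :
    ∃ (m : ℕ) (x : Fin m → E d) (r : Fin m → ℝ) (n : Fin m → E d) (t₀ : Fin m → ℝ)
      (φ : Fin m → E d → ℝ),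
      (∀ i, 0 < r i ∧ ‖n i‖ ≤ 1 ∧ 0 < t₀ i ∧ ContDiff ℝ ∞ (φ i) ∧
        tsupport (φ i) ⊆ Metric.ball (x i) (r i / 2) ∧
        ∀ t > (0 : ℝ), t ≤ t₀ i → ∃ δ > 0, ∀ y ∈ Ω ∩ Metric.ball (x i) (r i),
          Metric.ball (y + t • n i) δ ⊆ Ω) ∧
      ∀ y ∈ closure Ω, ∑ i, φ i y = 1 := by
  have hc : IsCompact (closure Ω) := hΩ.isBounded.isCompact_closure
  choose r hr n hn t₀ ht₀ hin using fun x : closure Ω => exists_inward_direction hΩ x.2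
  obtain ⟨s, hs⟩ := hc.elim_finite_subcover (fun x : closure Ω => Metric.ball (x : E d) (r x / 2))
    (fun x => Metric.isOpen_ball) (fun y hy => Set.mem_iUnion.2
      ⟨⟨y, hy⟩, Metric.mem_ball_self (by have := hr ⟨y, hy⟩; positivity)⟩)
  let e := s.equivFin.symm
  obtain ⟨p, hp⟩ := SmoothPartitionOfUnity.exists_isSubordinate 𝓘(ℝ, E d)
    (isClosed_closure (s := Ω))
    (fun i : Fin s.card => Metric.ball ((e i : closure Ω) : E d) (r (e i) / 2))
    (fun i => Metric.isOpen_ball) (by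
      intro y hy
      have := hs hy
      simp only [Set.mem_iUnion] at this ⊢
      obtain ⟨i, hi, hy⟩ := this
      exact ⟨s.equivFin ⟨i, hi⟩, by simpa [e] using hy⟩)
  refine ⟨s.card, fun i => (e i : closure Ω), fun i => r (e i), fun i => n (e i),
    fun i => t₀ (e i), fun i => p i, fun i => ⟨hr _, hn _, ht₀ _, ?_, hp i, hin _⟩, fun y hy => ?_⟩
  · exact (p i).contMDiff.contDiff
  · have := p.sum_eq_one hy
    rwa [finsum_eq_sum_of_fintype] at this

theorem cgrad_sum {ι : Type*} (s : Finset ι) {u : ι → E d → ℂ} (hu : ∀ i, ContDiff ℝ 1 (u i))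
    (x : E d) : cgrad (fun y => ∑ i ∈ s, u i y) x = ∑ i ∈ s, cgrad (u i) x := by
  ext k
  simp only [cgrad, WithLp.ofLp_sum, Finset.sum_apply]
  rw [fderiv_fun_sum fun i _ => (hu i).differentiable one_ne_zero x]
  simp

theorem continuous_cgrad {u : E d → ℂ} (hu : ContDiff ℝ 1 u) : Continuous (cgrad u) := by
  refine (PiLp.continuous_toLp 2 _).comp (continuous_pi fun i => ?_)
  exact (hu.continuous_fderiv one_ne_zero).clm_apply continuous_const

/-- The localized approximations are summed over the partition of unity. Because ∑ ∇φ_i = 0 in Ω,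
the gradients of the pieces φ_i f add up to G. -/
theorem exists_contDiff_approx (hΩ : IsBoundedLipschitzDomain Ω) {f : E d → ℂ}
    {G : E d → EuclideanSpace ℂ (Fin d)} (hf : MemLp f 2 (volume.restrict Ω))
    (hG : HasWeakGrad Ω f G) {ε : ℝ≥0∞} (hε : ε ≠ 0) :
    ∃ u : E d → ℂ, ContDiff ℝ 1 u ∧ HasCompactSupport u ∧
      eLpNorm (fun x => u x - f x) 2 (volume.restrict Ω) ≤ ε ∧
      eLpNorm (fun x => cgrad u x - G x) 2 (volume.restrict Ω) ≤ ε := by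
  obtain ⟨m, x, r, n, t₀, φ, h, hsum⟩ := exists_partition hΩ
  have hε' : ε / (m + 1) ≠ 0 :=
    (ENNReal.div_pos hε (by finiteness)).ne'
  choose u hu huc h1 h2 using fun i => exists_approx_of_tsupport_subset_ball hΩ hf hG (h i).1
    (h i).2.1 (h i).2.2.1 (h i).2.2.2.2.2 (h i).2.2.2.1 (h i).2.2.2.2.1 hε'
  have hφ1 : ∀ i, ContDiff ℝ 1 (φ i) := fun i => (h i).2.2.2.1.of_le (by exact_mod_cast le_top)
  have hφc : ∀ i, HasCompactSupport (φ i) := fun i =>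
    HasCompactSupport.of_support_subset_isCompact (isCompact_closedBall (x i) (r i / 2))
    ((subset_tsupport _).trans ((h i).2.2.2.2.1.trans Metric.ball_subset_closedBall))
  have hm : (∑ _i : Fin m, ε / ((m : ℝ≥0∞) + 1)) ≤ ε := by
    rw [Finset.sum_const, Finset.card_univ, Fintype.card_fin, nsmul_eq_mul]
    calc (m : ℝ≥0∞) * (ε / (m + 1)) ≤ (m + 1) * (ε / (m + 1)) := by gcongr; exact le_self_add
      _ ≤ ε := ENNReal.mul_div_le
  have hder : ∀ y ∈ Ω, ∑ i, fderiv ℝ (φ i) y = 0 := by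
    intro y hy
    rw [← fderiv_fun_sum fun i _ => (hφ1 i).differentiable one_ne_zero y]
    have : (fun z => ∑ i, φ i z) =ᶠ[𝓝 y] fun _ => 1 := by
      filter_upwards [hΩ.isOpen.mem_nhds hy] with z hz
      exact hsum z (subset_closure hz)
    rw [this.fderiv_eq]
    simp
  refine ⟨fun y => ∑ i, u i y, ContDiff.sum fun i _ => hu i, ?_, ?_, ?_⟩
  · refine HasCompactSupport.of_support_subset_isCompact
      (isCompact_iUnion fun i => (huc i).isCompact) fun y hy => ?_
    obtain ⟨i, -, hi⟩ := Finset.exists_ne_zero_of_sum_ne_zero hy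
    exact Set.mem_iUnion.2 ⟨i, subset_tsupport _ hi⟩
  · refine le_trans (le_of_eq (eLpNorm_congr_ae (g := ∑ i, fun y => u i y - φ i y * f y) ?_)) ?_
    · filter_upwards [ae_restrict_mem hΩ.isOpen.measurableSet] with y hy
      have : ∑ i, (φ i y : ℂ) = 1 := by
        exact_mod_cast hsum y (subset_closure hy)
      simp only [Finset.sum_apply, Finset.sum_sub_distrib]
      rw [← Finset.sum_mul, this, one_mul]
    · refine (eLpNorm_sum_le (fun i _ => ?_) (by norm_num)).trans
        ((Finset.sum_le_sum fun i _ => h1 i).trans hm)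
      exact (hu i).continuous.aestronglyMeasurable.sub
        (memLp_ofReal_mul (hφ1 i).continuous (hφc i) hf).1
  · refine le_trans (le_of_eq (eLpNorm_congr_ae
      (g := ∑ i, fun y => cgrad (u i) y - productGrad (φ i) f G y) ?_)) ?_
    · filter_upwards [ae_restrict_mem hΩ.isOpen.measurableSet] with y hy
      have h3 : ∑ i, (φ i y : ℂ) = 1 := by
        exact_mod_cast hsum y (subset_closure hy)
      have h4 : ∑ i, productGrad (φ i) f G y = G y := by
        ext k
        have h5 := congrArg (fun T => ((T (EuclideanSpace.single k 1) : ℝ) : ℂ)) (hder y hy)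
        simp only [sum_apply, zero_apply,
          Complex.ofReal_sum, Complex.ofReal_zero] at h5
        simp only [productGrad, WithLp.ofLp_sum, Finset.sum_apply, Finset.sum_add_distrib]
        rw [← Finset.sum_mul, ← Finset.sum_mul, h3, h5]
        simp
      simp only [Finset.sum_apply, Finset.sum_sub_distrib]
      rw [h4, cgrad_sum _ hu]
    · refine (eLpNorm_sum_le (fun i _ => ?_) (by norm_num)).trans
        ((Finset.sum_le_sum fun i _ => h2 i).trans hm)
      exact (continuous_cgrad (hu i)).aestronglyMeasurable.sub (memLp_productGrad (hφ1 i) (hφc i) hf hG.1).1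

end Density

/-! ### The Sobolev space as a closed subspace -/

section Sobolev

variable {d : ℕ} {Ω : Set (E d)}

theorem norm_fderiv_le_norm_cgrad (u : E d → ℂ) (x : E d) : ‖fderiv ℝ u x‖ ≤ ‖cgrad u x‖ := by
  refine ContinuousLinearMap.opNorm_le_bound _ (norm_nonneg _) fun v => ?_
  have e : v = ∑ i, v i • EuclideanSpace.single i (1 : ℝ) := by
    ext k
    simp [Finset.sum_apply, Pi.single_apply]
  have h1 : fderiv ℝ u x v = ∑ i, v i • cgrad u x i := by
    conv_lhs => rw [e, map_sum]
    simp [cgrad]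
  rw [h1, EuclideanSpace.norm_eq, EuclideanSpace.norm_eq, mul_comm]
  refine (norm_sum_le _ _).trans ?_
  simp only [norm_smul]
  exact Real.sum_mul_le_sqrt_mul_sqrt _ _ _

theorem hasCompactSupport_cgrad {u : E d → ℂ} (hu : HasCompactSupport u) :
    HasCompactSupport (cgrad u) := by
  refine HasCompactSupport.of_support_subset_isCompact (hu.fderiv ℝ).isCompact fun x hx => ?_
  refine subset_tsupport _ fun h => hx ?_
  ext i
  simp [cgrad, h]

theorem cgrad_add {u v : E d → ℂ} (hu : ContDiff ℝ 1 u) (hv : ContDiff ℝ 1 v) :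
    cgrad (u + v) = cgrad u + cgrad v := by
  funext x
  ext i
  simp [cgrad, fderiv_add (hu.differentiable one_ne_zero x) (hv.differentiable one_ne_zero x)]

theorem cgrad_const_smul {u : E d → ℂ} (hu : ContDiff ℝ 1 u) (c : ℂ) :
    cgrad (c • u) = c • cgrad u := by
  funext x
  ext i
  simp [cgrad, fderiv_const_smul (hu.differentiable one_ne_zero x)]

/-- Triples of a function on `Ω`, a vector field on `Ω` and a function on `∂Ω`. -/
abbrev SobolevTriple (Ω : Set (E d)) :=
  L2 Ω × Lp (EuclideanSpace ℂ (Fin d)) 2 (volume.restrict Ω) × Lp ℂ 2 (surface Ω)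

/-- The triples `(u, ∇u, u|∂Ω)` for compactly supported `C¹` functions `u`. -/
noncomputable def contDiffTriple (Ω : Set (E d)) : Submodule ℂ (SobolevTriple Ω) where
  carrier := {w | ∃ u : E d → ℂ, ContDiff ℝ 1 u ∧ HasCompactSupport u ∧
    w.1 =ᵐ[volume.restrict Ω] u ∧ w.2.1 =ᵐ[volume.restrict Ω] cgrad u ∧ w.2.2 =ᵐ[surface Ω] u}
  add_mem' := by
    rintro w w' ⟨u, hu, huc, h1, h2, h3⟩ ⟨v, hv, hvc, h1', h2', h3'⟩
    refine ⟨u + v, hu.add hv, huc.add hvc, (Lp.coeFn_add _ _).trans (h1.add h1'), ?_,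
      (Lp.coeFn_add _ _).trans (h3.add h3')⟩
    rw [cgrad_add hu hv]
    exact (Lp.coeFn_add _ _).trans (h2.add h2')
  zero_mem' := by
    refine ⟨0, contDiff_const, HasCompactSupport.zero, Lp.coeFn_zero _ _ _, ?_, Lp.coeFn_zero _ _ _⟩
    refine (Lp.coeFn_zero _ _ _).trans (Eventually.of_forall fun x => ?_)
    ext i
    simp [cgrad]
  smul_mem' := by
    rintro c w ⟨u, hu, huc, h1, h2, h3⟩
    refine ⟨c • u, contDiff_const.smul hu, huc.smul_left, (Lp.coeFn_smul _ _).trans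
      (h1.const_smul c), ?_, (Lp.coeFn_smul _ _).trans (h3.const_smul c)⟩
    rw [cgrad_const_smul hu]
    exact (Lp.coeFn_smul _ _).trans (h2.const_smul c)

/-- The triples `(f, ∇f, f|∂Ω)` for `f ∈ H¹(Ω)`. -/
noncomputable def sobolevTriple (Ω : Set (E d)) : Submodule ℂ (SobolevTriple Ω) :=
  (contDiffTriple Ω).topologicalClosure

/-- Closed conditions on triples need checking only for C¹ functions. This transfers the trace and
compactness inequalities to H¹(Ω). -/
theorem sobolevTriple_induction {p : SobolevTriple Ω → Prop} (hp : IsClosed {w | p w})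
    (h : ∀ w ∈ contDiffTriple Ω, p w) {w : SobolevTriple Ω} (hw : w ∈ sobolevTriple Ω) : p w :=
  closure_minimal (s := (contDiffTriple Ω : Set (SobolevTriple Ω))) h hp hw

theorem memLp_contDiff {F : Type*} [NormedAddCommGroup F] {μ : Measure (E d)}
    [IsFiniteMeasureOnCompacts μ] {u : E d → F} (hu : Continuous u) (huc : HasCompactSupport u) :
    MemLp u 2 μ := hu.memLp_of_hasCompactSupport huc

theorem norm_sq_le_of_enorm {a b c : ℝ} {C : ℝ≥0∞} {ε : ℝ} (hε : 0 ≤ ε) (hC : C ≠ ⊤)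
    (hb : 0 ≤ b) (hc : 0 ≤ c)
    (h : ENNReal.ofReal a ≤ ENNReal.ofReal ε * ENNReal.ofReal b + C * ENNReal.ofReal c) :
    a ≤ ε * b + C.toReal * c := by
  rw [← ENNReal.ofReal_toReal hC, ← ENNReal.ofReal_mul hε, ← ENNReal.ofReal_mul (by positivity),
    ← ENNReal.ofReal_add (by positivity) (by positivity)] at h
  exact (ENNReal.ofReal_le_ofReal_iff (by positivity)).1 h

theorem ofReal_norm_sq_eq_lintegral {α F : Type*} [MeasurableSpace α] {μ : Measure α}
    [NormedAddCommGroup F] (g : Lp F 2 μ) {u : α → F} (h : g =ᵐ[μ] u) :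
    ENNReal.ofReal (‖g‖ ^ 2) = ∫⁻ x, ‖u x‖ₑ ^ 2 ∂μ := by
  rw [ENNReal.ofReal_pow (norm_nonneg _), ofReal_norm, Lp.enorm_def, eLpNorm_congr_ae h,
    eLpNorm_two_sq]

theorem lintegral_fderiv_le {w : Lp (EuclideanSpace ℂ (Fin d)) 2 (volume.restrict Ω)} {u : E d → ℂ}
    (h : w =ᵐ[volume.restrict Ω] cgrad u) :
    ∫⁻ y in Ω, ‖fderiv ℝ u y‖ₑ ^ 2 ≤ ENNReal.ofReal (‖w‖ ^ 2) := by
  rw [ofReal_norm_sq_eq_lintegral w h]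
  refine lintegral_mono fun x => ?_
  gcongr
  exact enorm_le_iff_norm_le.2 (norm_fderiv_le_norm_cgrad u x)

theorem norm_sq_trace_le (hd : d ≠ 0) (hΩ : IsBoundedLipschitzDomain Ω) {ε : ℝ} (hε : 0 < ε) :
    ∃ C : ℝ, 0 ≤ C ∧ ∀ w ∈ sobolevTriple Ω, ‖w.2.2‖ ^ 2 ≤ ε * ‖w.2.1‖ ^ 2 + C * ‖w.1‖ ^ 2 := by
  obtain ⟨C, hC, h⟩ := lintegral_surface_le hd hΩ (ε := ENNReal.ofReal ε) (by simpa using hε)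
  refine ⟨C.toReal, ENNReal.toReal_nonneg, fun w hw => ?_⟩
  refine sobolevTriple_induction (p := fun w => ‖w.2.2‖ ^ 2 ≤ ε * ‖w.2.1‖ ^ 2
    + C.toReal * ‖w.1‖ ^ 2) (isClosed_le (by fun_prop) (by fun_prop)) ?_ hw
  rintro w ⟨u, hu, huc, h1, h2, h3⟩
  refine norm_sq_le_of_enorm hε.le hC (by positivity) (by positivity) ?_
  rw [ofReal_norm_sq_eq_lintegral w.2.2 h3, ofReal_norm_sq_eq_lintegral w.1 h1]
  refine (h u hu).trans ?_
  gcongr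
  exact lintegral_fderiv_le h2

theorem norm_sq_le_finite_rank (hΩ : IsBoundedLipschitzDomain Ω) {ε : ℝ} (hε : 0 < ε) :
    ∃ (N : ℕ) (g : Fin N → L2 Ω) (C : ℝ), 0 ≤ C ∧ ∀ w ∈ sobolevTriple Ω,
      ‖w.1‖ ^ 2 ≤ ε * ‖w.2.1‖ ^ 2 + C * ∑ k, ‖⟪g k, w.1⟫_ℂ‖ ^ 2 := by
  obtain ⟨N, g, C, hC, hg, h⟩ := lintegral_le_finite_rank hΩ (ε := ENNReal.ofReal ε)
    (by simpa using hε)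
  have : IsFiniteMeasure (volume.restrict Ω) := ⟨by simpa using hΩ.isBounded.measure_lt_top⟩
  have hgm : ∀ k, MemLp (fun x => (g k x : ℂ)) 2 (volume.restrict Ω) := by
    intro k
    obtain ⟨M, hM⟩ := hΩ.isBounded.isCompact_closure.exists_bound_of_continuousOn
      (hg k).continuousOn
    refine MemLp.of_bound (Complex.continuous_ofReal.comp (hg k)).aestronglyMeasurable M ?_
    filter_upwards [ae_restrict_mem hΩ.isOpen.measurableSet] with x hx
    rw [Complex.norm_real]
    exact hM x (subset_closure hx)
  refine ⟨N, fun k => (hgm k).toLp, C.toReal, ENNReal.toReal_nonneg, fun w hw => ?_⟩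
  refine sobolevTriple_induction (p := fun w => ‖w.1‖ ^ 2 ≤ ε * ‖w.2.1‖ ^ 2
    + C.toReal * ∑ k, ‖⟪(hgm k).toLp, w.1⟫_ℂ‖ ^ 2) (isClosed_le (by fun_prop) (by fun_prop)) ?_ hw
  rintro w ⟨u, hu, huc, h1, h2, h3⟩
  refine norm_sq_le_of_enorm hε.le hC (by positivity) (by positivity) ?_
  rw [ofReal_norm_sq_eq_lintegral w.1 h1]
  refine (h u hu).trans (add_le_add (mul_le_mul_right (lintegral_fderiv_le h2) _)
    (le_of_eq ?_))
  rw [ENNReal.ofReal_sum_of_nonneg (fun k _ => by positivity)]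
  congr 1
  refine Finset.sum_congr rfl fun k _ => ?_
  rw [ENNReal.ofReal_pow (norm_nonneg _), ofReal_norm, L2.inner_def]
  congr 2
  refine integral_congr_ae ?_
  filter_upwards [(hgm k).coeFn_toLp, h1] with x hx hx1
  rw [hx, hx1, RCLike.inner_apply, Complex.conj_ofReal, Complex.real_smul, mul_comm]

/-- Multiplication of `L²` functions by a fixed bounded function. -/
noncomputable def mulL2 {α : Type*} [MeasurableSpace α] {μ : Measure α} (c : Lp ℂ ⊤ μ) :
    Lp ℂ 2 μ →L[ℂ] Lp ℂ 2 μ :=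
  (ContinuousLinearMap.mul ℂ ℂ).holderL μ ⊤ 2 2 c

theorem coeFn_mulL2 {α : Type*} [MeasurableSpace α] {μ : Measure α} (c : Lp ℂ ⊤ μ)
    (f : Lp ℂ 2 μ) : mulL2 c f =ᵐ[μ] fun x => c x * f x :=
  (ContinuousLinearMap.mul ℂ ℂ).coeFn_holder c f

/-! ### Weak gradients and their stability under L² limits. -/

theorem HasWeakGrad.congr {f f' : E d → ℂ} {G G' : E d → EuclideanSpace ℂ (Fin d)}
    (h : HasWeakGrad Ω f G) (hf : f =ᵐ[volume.restrict Ω] f')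
    (hG : G =ᵐ[volume.restrict Ω] G') : HasWeakGrad Ω f' G' := by
  refine ⟨h.1.ae_eq hG, fun ψ h1 h2 h3 i => ?_⟩
  have := h.2 ψ h1 h2 h3 i
  rw [integral_congr_ae (g := fun x => (fderiv ℝ ψ x (EuclideanSpace.single i 1) : ℂ) * f x)
    (by filter_upwards [hf] with x hx; rw [hx]), this]
  congr 1
  refine integral_congr_ae ?_
  filter_upwards [hG] with x hx
  rw [hx]

/-- The fundamental lemma of the calculus of variations, applied to each component of the
difference. -/
theorem HasWeakGrad.ae_eq (hΩ : IsBoundedLipschitzDomain Ω) {f : E d → ℂ}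
    {G G' : E d → EuclideanSpace ℂ (Fin d)} (h : HasWeakGrad Ω f G) (h' : HasWeakGrad Ω f G') :
    G =ᵐ[volume.restrict Ω] G' := by
  have : IsFiniteMeasure (volume.restrict Ω) := ⟨by simpa using hΩ.isBounded.measure_lt_top⟩
  have hi : ∀ i, ∀ᵐ x ∂volume, x ∈ Ω → G x i - G' x i = 0 := by
    intro i
    have hint : IntegrableOn (fun x => G x i - G' x i) Ω :=
      ((memLp_apply h.1 i).sub (memLp_apply h'.1 i)).integrable (by norm_num)
    refine hΩ.isOpen.ae_eq_zero_of_integral_contDiff_smul_eq_zero hint.locallyIntegrableOn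
      fun ψ h1 h2 h3 => ?_
    have e := (h.2 ψ h1 h2 h3 i).symm.trans (h'.2 ψ h1 h2 h3 i)
    rw [← setIntegral_eq_integral_of_forall_compl_eq_zero (s := Ω)]
    · simp only [Complex.real_smul, mul_sub]
      rw [integral_sub, neg_inj.1 e, sub_self]
      · exact (memLp_ofReal_mul h1.continuous h2 (memLp_apply h.1 i)).integrable (by norm_num)
      · exact (memLp_ofReal_mul h1.continuous h2 (memLp_apply h'.1 i)).integrable (by norm_num)
    · intro x hx
      rw [image_eq_zero_of_notMem_tsupport fun hx' => hx (h3 hx'), zero_smul]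
  rw [Filter.EventuallyEq, ae_restrict_iff' hΩ.isOpen.measurableSet]
  filter_upwards [ae_all_iff.2 hi] with x hx hxΩ
  ext i
  exact sub_eq_zero.1 (hx i hxΩ)

theorem MemH1.hasWeakGrad {f : E d → ℂ} (h : MemH1 Ω f) : HasWeakGrad Ω f (weakGrad Ω f) := by
  rw [weakGrad, dif_pos h.2]
  exact h.2.choose_spec

theorem integral_fderiv_mul_eq_neg {ψ : E d → ℝ} (hψ : ContDiff ℝ 1 ψ) (hψc : HasCompactSupport ψ)
    (hs : tsupport ψ ⊆ Ω) {u : E d → ℂ} (hu : ContDiff ℝ 1 u) (v : E d) :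
    ∫ x in Ω, (fderiv ℝ ψ x v : ℂ) * u x = -∫ x in Ω, (ψ x : ℂ) * fderiv ℝ u x v := by
  have hz : ∀ x, x ∉ Ω → ψ x = 0 := fun x hx =>
    image_eq_zero_of_notMem_tsupport fun hx' => hx (hs hx')
  have hz' : ∀ x, x ∉ Ω → fderiv ℝ ψ x = 0 := fun x hx =>
    image_eq_zero_of_notMem_tsupport fun hx' => hx (hs (tsupport_fderiv_subset ℝ hx'))
  -- Both integrands vanish off Ω, so the integration by parts takes place on the whole space
  -- without a boundary term.
  rw [setIntegral_eq_integral_of_forall_compl_eq_zero fun x hx => by simp [hz' x hx],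
    setIntegral_eq_integral_of_forall_compl_eq_zero fun x hx => by simp [hz x hx]]
  have hfd : ∀ x, fderiv ℝ (fun x => (ψ x : ℂ)) x v = (fderiv ℝ ψ x v : ℂ) := by
    intro x
    have := (Complex.ofRealCLM.hasFDerivAt.comp x
      (hψ.differentiable one_ne_zero x).hasFDerivAt).fderiv
    change fderiv ℝ (Complex.ofRealCLM ∘ ψ) x v = _
    rw [this]
    rfl
  have hψ' : ContDiff ℝ 1 fun x => (ψ x : ℂ) := Complex.ofRealCLM.contDiff.comp hψ
  have hψc' : HasCompactSupport fun x => (ψ x : ℂ) := hψc.comp_left Complex.ofReal_zero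
  have hc1 : Continuous fun x => fderiv ℝ (fun x => (ψ x : ℂ)) x v :=
    (hψ'.continuous_fderiv one_ne_zero).clm_apply continuous_const
  have hc2 : Continuous fun x => fderiv ℝ u x v :=
    (hu.continuous_fderiv one_ne_zero).clm_apply continuous_const
  have h := integral_mul_fderiv_eq_neg_fderiv_mul_of_integrable (μ := (volume : Measure (E d)))
    (f := fun x => (ψ x : ℂ)) (g := u) (v := v)
    ((hc1.mul hu.continuous).integrable_of_hasCompactSupport (hψc'.fderiv_apply ℝ v).mul_right)
    ((hψ'.continuous.mul hc2).integrable_of_hasCompactSupport hψc'.mul_right)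
    ((hψ'.continuous.mul hu.continuous).integrable_of_hasCompactSupport hψc'.mul_right)
    (fun x _ => hψ'.differentiable one_ne_zero x) (fun x _ => hu.differentiable one_ne_zero x)
  simp only [hfd] at h
  rw [h, neg_neg]

/-- For a fixed test function both sides are inner products with fixed L² functions, so the identity
is closed under limits of triples and follows from the C¹ case. -/
theorem hasWeakGrad_of_mem {w : SobolevTriple Ω} (hw : w ∈ sobolevTriple Ω) :
    HasWeakGrad Ω w.1 w.2.1 := by
  refine ⟨Lp.memLp _, fun ψ h1 h2 h3 i => ?_⟩
  have hψ : ContDiff ℝ 1 ψ := h1.of_le (by exact_mod_cast le_top)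
  set e : E d := EuclideanSpace.single i 1
  have hDc : Continuous fun x => fderiv ℝ ψ x e :=
    (hψ.continuous_fderiv one_ne_zero).clm_apply continuous_const
  have hA : MemLp (fun x => (fderiv ℝ ψ x e : ℂ)) 2 (volume.restrict Ω) :=
    memLp_contDiff (Complex.continuous_ofReal.comp hDc)
      ((h2.fderiv_apply ℝ e).comp_left Complex.ofReal_zero)
  have hB : MemLp (fun x => EuclideanSpace.single i (ψ x : ℂ)) 2 (volume.restrict Ω) := by
    refine memLp_euclidean fun k => ?_
    by_cases hk : k = i
    · subst hk
      have := memLp_contDiff (μ := volume.restrict Ω)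
        (Complex.continuous_ofReal.comp hψ.continuous) (h2.comp_left Complex.ofReal_zero)
      simpa [Function.comp_def] using this
    · simp [hk]
  have hAi : ∀ f : L2 Ω, ⟪hA.toLp, f⟫_ℂ = ∫ x in Ω, (fderiv ℝ ψ x e : ℂ) * f x := by
    intro f
    rw [L2.inner_def]
    refine integral_congr_ae ?_
    filter_upwards [hA.coeFn_toLp] with x hx
    rw [hx, RCLike.inner_apply, Complex.conj_ofReal, mul_comm]
  have hBi : ∀ G : Lp (EuclideanSpace ℂ (Fin d)) 2 (volume.restrict Ω),
      ⟪hB.toLp, G⟫_ℂ = ∫ x in Ω, (ψ x : ℂ) * G x i := by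
    intro f
    rw [L2.inner_def]
    refine integral_congr_ae ?_
    filter_upwards [hB.coeFn_toLp] with x hx
    rw [hx, EuclideanSpace.inner_single_left, Complex.conj_ofReal]
  rw [← hAi, ← hBi]
  refine sobolevTriple_induction (p := fun w => ⟪hA.toLp, w.1⟫_ℂ = -⟪hB.toLp, w.2.1⟫_ℂ)
    (isClosed_eq (by fun_prop) (by fun_prop)) ?_ hw
  rintro w ⟨u, hu, huc, hu1, hu2, hu3⟩
  rw [hAi, hBi]
  have := integral_fderiv_mul_eq_neg hψ h2 h3 hu e
  rw [integral_congr_ae (g := fun x => (fderiv ℝ ψ x e : ℂ) * u x)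
    (by filter_upwards [hu1] with x hx; rw [hx]), this]
  congr 1
  refine integral_congr_ae ?_
  filter_upwards [hu2] with x hx
  rw [hx]
  rfl

theorem mem_sobolevTriple_of_tendsto [IsFiniteMeasure (surface Ω)] {F t : E d → ℂ}
    {G : E d → EuclideanSpace ℂ (Fin d)} (hF : MemLp F 2 (volume.restrict Ω))
    (hG : MemLp G 2 (volume.restrict Ω)) (ht : MemLp t 2 (surface Ω)) {u : ℕ → E d → ℂ}
    (hu : ∀ n, ContDiff ℝ 1 (u n) ∧ HasCompactSupport (u n))
    (h1 : Tendsto (fun n => eLpNorm (u n - F) 2 (volume.restrict Ω)) atTop (𝓝 0))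
    (h2 : Tendsto (fun n => eLpNorm (cgrad (u n) - G) 2 (volume.restrict Ω)) atTop (𝓝 0))
    (h3 : Tendsto (fun n => eLpNorm (u n - t) 2 (surface Ω)) atTop (𝓝 0)) :
    (hF.toLp, hG.toLp, ht.toLp) ∈ sobolevTriple Ω := by
  have m1 : ∀ n, MemLp (u n) 2 (volume.restrict Ω) := fun n =>
    memLp_contDiff (hu n).1.continuous (hu n).2
  have m2 : ∀ n, MemLp (cgrad (u n)) 2 (volume.restrict Ω) := fun n =>
    memLp_contDiff (continuous_cgrad (hu n).1) (hasCompactSupport_cgrad (hu n).2)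
  have m3 : ∀ n, MemLp (u n) 2 (surface Ω) := fun n =>
    memLp_contDiff (hu n).1.continuous (hu n).2
  have T : Tendsto (fun n => ((m1 n).toLp, (m2 n).toLp, (m3 n).toLp)) atTop
      (𝓝 (hF.toLp, hG.toLp, ht.toLp)) :=
    ((Lp.tendsto_Lp_iff_tendsto_eLpNorm'' _ m1 _ hF).2 h1).prodMk_nhds
      (((Lp.tendsto_Lp_iff_tendsto_eLpNorm'' _ m2 _ hG).2 h2).prodMk_nhds
        ((Lp.tendsto_Lp_iff_tendsto_eLpNorm'' _ m3 _ ht).2 h3))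
  refine mem_closure_of_tendsto (s := (contDiffTriple Ω : Set (SobolevTriple Ω))) T
    (Eventually.of_forall fun n => ?_)
  exact ⟨u n, (hu n).1, (hu n).2, (m1 n).coeFn_toLp, (m2 n).coeFn_toLp, (m3 n).coeFn_toLp⟩

/-! ### Existence and uniqueness of the trace. -/

theorem isClosed_sobolevTriple : IsClosed (sobolevTriple Ω : Set (SobolevTriple Ω)) :=
  (contDiffTriple Ω).isClosed_topologicalClosure

/-- By the trace inequality, forgetting the boundary component is bounded below on the closed space
of triples. It is therefore injective with closed range. -/
theorem exists_norm_le_mul (hd : d ≠ 0) (hΩ : IsBoundedLipschitzDomain Ω) :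
    ∃ K : NNReal, ∀ w ∈ sobolevTriple Ω, ‖w‖ ≤ K * ‖(w.1, w.2.1)‖ := by
  obtain ⟨C, hC, h⟩ := norm_sq_trace_le hd hΩ one_pos
  refine ⟨⟨C + 2, by positivity⟩, fun w hw => ?_⟩
  change ‖w‖ ≤ (C + 2) * ‖(w.1, w.2.1)‖
  set m := ‖(w.1, w.2.1)‖ with hm
  have hm0 : 0 ≤ m := norm_nonneg _
  have h1 : ‖w.1‖ ≤ m := le_max_left _ _
  have h2 : ‖w.2.1‖ ≤ m := le_max_right _ _
  have h3 : ‖w.2.2‖ ≤ (C + 2) * m := by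
    refine abs_le_of_sq_le_sq' ?_ (by positivity) |>.2
    have := h w hw
    have e1 : ‖w.1‖ ^ 2 ≤ m ^ 2 := by gcongr
    have e2 : ‖w.2.1‖ ^ 2 ≤ m ^ 2 := by gcongr
    nlinarith [mul_le_mul_of_nonneg_left e1 hC, mul_nonneg (mul_nonneg hC hC) (sq_nonneg m),
      mul_nonneg hC (sq_nonneg m), sq_nonneg m]
  have h4 : m ≤ (C + 2) * m := by nlinarith
  exact max_le (h1.trans h4) (max_le (h2.trans h4) h3)

theorem eq_of_fst_eq (hd : d ≠ 0) (hΩ : IsBoundedLipschitzDomain Ω) {w w' : SobolevTriple Ω}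
    (hw : w ∈ sobolevTriple Ω) (hw' : w' ∈ sobolevTriple Ω) (h : w.1 = w'.1) : w = w' := by
  have h1 : w.2.1 = w'.2.1 := by
    have a := hasWeakGrad_of_mem hw
    rw [h] at a
    exact Lp.ext (a.ae_eq hΩ (hasWeakGrad_of_mem hw'))
  obtain ⟨K, hK⟩ := exists_norm_le_mul hd hΩ
  have := hK (w - w') ((sobolevTriple Ω).sub_mem hw hw')
  have e : ((w - w').1, (w - w').2.1) = 0 := by simp [h, h1]
  rw [e, norm_zero, mul_zero] at this
  exact sub_eq_zero.1 (norm_le_zero_iff.1 this)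

/-- The pair (f, G) is a limit of pairs (u, ∇u) with u of class C¹, and the closed range of the
forgetful map contains this limit. The preimage supplies the trace. -/
theorem exists_mem_of_hasWeakGrad (hd : d ≠ 0) (hΩ : IsBoundedLipschitzDomain Ω) {f : E d → ℂ}
    {G : E d → EuclideanSpace ℂ (Fin d)} (hf : MemLp f 2 (volume.restrict Ω))
    (hG : HasWeakGrad Ω f G) : ∃ w ∈ sobolevTriple Ω, w.1 = hf.toLp ∧ w.2.1 = hG.1.toLp := by
  have := isFiniteMeasure_surface hd hΩ
  obtain ⟨K, hK⟩ := exists_norm_le_mul hd hΩ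
  let p : sobolevTriple Ω → L2 Ω × Lp (EuclideanSpace ℂ (Fin d)) 2 (volume.restrict Ω) :=
    fun w => (w.1.1, w.1.2.1)
  have hp : AntilipschitzWith K p := by
    refine AntilipschitzWith.of_le_mul_dist fun w w' => ?_
    rw [dist_eq_norm, dist_eq_norm]
    exact hK _ (w - w').2
  have : CompleteSpace (sobolevTriple Ω) := isClosed_sobolevTriple.completeSpace_coe
  have hlip : LipschitzWith 1 p := by
    refine LipschitzWith.of_dist_le_mul fun w w' => ?_
    rw [NNReal.coe_one, one_mul]
    exact max_le (le_max_left _ _) ((le_max_left _ _).trans (le_max_right _ _))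
  have hcl := hp.isClosed_range hlip.uniformContinuous
  choose u hu huc h1 h2 using fun n : ℕ => exists_contDiff_approx hΩ hf hG
    (ε := ((n : ℝ≥0∞) + 1)⁻¹) (by simp)
  have m1 : ∀ n, MemLp (u n) 2 (volume.restrict Ω) := fun n =>
    memLp_contDiff (hu n).continuous (huc n)
  have m2 : ∀ n, MemLp (cgrad (u n)) 2 (volume.restrict Ω) := fun n =>
    memLp_contDiff (continuous_cgrad (hu n)) (hasCompactSupport_cgrad (huc n))
  have m3 : ∀ n, MemLp (u n) 2 (surface Ω) := fun n =>
    memLp_contDiff (hu n).continuous (huc n)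
  have hε : Tendsto (fun n : ℕ => ((n : ℝ≥0∞) + 1)⁻¹) atTop (𝓝 0) := by
    have := (tendsto_add_atTop_iff_nat 1).2 ENNReal.tendsto_inv_nat_nhds_zero
    simpa using this
  have T : Tendsto (fun n => ((m1 n).toLp, (m2 n).toLp)) atTop (𝓝 (hf.toLp, hG.1.toLp)) :=
    ((Lp.tendsto_Lp_iff_tendsto_eLpNorm'' _ m1 _ hf).2
      (tendsto_of_tendsto_of_tendsto_of_le_of_le tendsto_const_nhds hε (fun _ => zero_le) h1)).prodMk_nhds
      ((Lp.tendsto_Lp_iff_tendsto_eLpNorm'' _ m2 _ hG.1).2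
      (tendsto_of_tendsto_of_tendsto_of_le_of_le tendsto_const_nhds hε (fun _ => zero_le) h2))
  obtain ⟨w, hw⟩ := hcl.mem_of_tendsto T (Eventually.of_forall fun n =>
    ⟨⟨((m1 n).toLp, (m2 n).toLp, (m3 n).toLp), (contDiffTriple Ω).le_topologicalClosure
      ⟨u n, hu n, huc n, (m1 n).coeFn_toLp, (m2 n).coeFn_toLp, (m3 n).coeFn_toLp⟩⟩, rfl⟩)
  exact ⟨w.1, w.2, congrArg Prod.fst hw, congrArg Prod.snd hw⟩

theorem MemH1.exists_mem (hd : d ≠ 0) (hΩ : IsBoundedLipschitzDomain Ω) {f : E d → ℂ}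
    (hf : MemH1 Ω f) : ∃ w ∈ sobolevTriple Ω, w.1 =ᵐ[volume.restrict Ω] f := by
  obtain ⟨w, hw, h, -⟩ := exists_mem_of_hasWeakGrad hd hΩ hf.1 hf.hasWeakGrad
  exact ⟨w, hw, h ▸ hf.1.coeFn_toLp⟩

theorem memH1_of_mem {w : SobolevTriple Ω} (hw : w ∈ sobolevTriple Ω) {f : E d → ℂ}
    (hf : w.1 =ᵐ[volume.restrict Ω] f) : MemH1 Ω f :=
  ⟨(Lp.memLp w.1).ae_eq hf, w.2.1, (hasWeakGrad_of_mem hw).congr hf EventuallyEq.rfl⟩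

theorem weakGrad_ae_eq_of_mem (hΩ : IsBoundedLipschitzDomain Ω) {w : SobolevTriple Ω}
    (hw : w ∈ sobolevTriple Ω) {f : E d → ℂ} (hf : w.1 =ᵐ[volume.restrict Ω] f) :
    weakGrad Ω f =ᵐ[volume.restrict Ω] w.2.1 :=
  (memH1_of_mem hw hf).hasWeakGrad.ae_eq hΩ ((hasWeakGrad_of_mem hw).congr hf EventuallyEq.rfl)

theorem hasTrace_of_mem (hΩ : IsBoundedLipschitzDomain Ω) {w : SobolevTriple Ω}
    (hw : w ∈ sobolevTriple Ω) {f : E d → ℂ} (hf : w.1 =ᵐ[volume.restrict Ω] f) :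
    HasTrace Ω f w.2.2 := by
  refine ⟨memH1_of_mem hw hf, Lp.memLp _, ?_⟩
  obtain ⟨y, hy, hyw⟩ := mem_closure_iff_seq_limit.1
    (show w ∈ closure (contDiffTriple Ω : Set (SobolevTriple Ω)) from hw)
  choose u hu huc h1 h2 h3 using hy
  have key : ∀ {F : Type} [NormedAddCommGroup F] {μ : Measure (E d)} {y : ℕ → Lp F 2 μ}
      {l : Lp F 2 μ} {v : ℕ → E d → F} {g : E d → F}, (∀ n, y n =ᵐ[μ] v n) → l =ᵐ[μ] g →
      Tendsto y atTop (𝓝 l) → Tendsto (fun n => eLpNorm (v n - g) 2 μ) atTop (𝓝 0) := by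
    intro F _ μ y l v g hv hg hyl
    rw [Lp.tendsto_Lp_iff_tendsto_eLpNorm'] at hyl
    refine hyl.congr fun n => eLpNorm_congr_ae ?_
    exact (hv n).sub hg
  refine ⟨u, fun n => ⟨hu n, huc n⟩, key h1 hf ?_, key h2
    (weakGrad_ae_eq_of_mem hΩ hw hf).symm ?_, key h3 EventuallyEq.rfl ?_⟩
  · exact (continuous_fst.tendsto _).comp hyw
  · exact ((continuous_fst.comp continuous_snd).tendsto _).comp hyw
  · exact ((continuous_snd.comp continuous_snd).tendsto _).comp hyw

/-- Whatever trace is chosen, the sequence defining it puts the resulting triple into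
`sobolevTriple`. Its first component is that of w, and the first component determines the triple. -/
theorem trace_ae_eq_of_mem (hd : d ≠ 0) (hΩ : IsBoundedLipschitzDomain Ω) {w : SobolevTriple Ω}
    (hw : w ∈ sobolevTriple Ω) {f : E d → ℂ} (hf : w.1 =ᵐ[volume.restrict Ω] f) :
    trace Ω f =ᵐ[surface Ω] w.2.2 := by
  have := isFiniteMeasure_surface hd hΩ
  have hex : ∃ g, HasTrace Ω f g := ⟨_, hasTrace_of_mem hΩ hw hf⟩
  have ht : HasTrace Ω f (trace Ω f) := by
    rw [trace, dif_pos hex]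
    exact hex.choose_spec
  obtain ⟨h1, h2, u, hu, hu1, hu2, hu3⟩ := ht
  have hm := mem_sobolevTriple_of_tendsto h1.1 h1.hasWeakGrad.1 h2 hu hu1 hu2 hu3
  have := eq_of_fst_eq hd hΩ hm hw (Lp.ext (h1.1.coeFn_toLp.trans hf.symm))
  rw [← this]
  exact h2.coeFn_toLp.symm

/-- The form of `-Δ_b - Λ` on triples. -/
noncomputable def tripleForm (β : Lp ℂ ⊤ (surface Ω)) (Λ : ℝ) (w w' : SobolevTriple Ω) : ℂ :=
  ⟪w.2.1, w'.2.1⟫_ℂ + ⟪w.2.2, mulL2 β w'.2.2⟫_ℂ - Λ * ⟪w.1, w'.1⟫_ℂ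

theorem robinForm_eq_tripleForm (hd : d ≠ 0) (hΩ : IsBoundedLipschitzDomain Ω) {b : E d → ℝ}
    {β : Lp ℂ ⊤ (surface Ω)} (hβ : β =ᵐ[surface Ω] fun x => (b x : ℂ)) (Λ : ℝ)
    {w w' : SobolevTriple Ω} (hw : w ∈ sobolevTriple Ω) (hw' : w' ∈ sobolevTriple Ω)
    {f f' : E d → ℂ} (hf : w.1 =ᵐ[volume.restrict Ω] f) (hf' : w'.1 =ᵐ[volume.restrict Ω] f') :
    robinForm Ω b Λ f f' = tripleForm β Λ w w' := by
  rw [robinForm, tripleForm, L2.inner_def, L2.inner_def, L2.inner_def]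
  congr 1
  · congr 1
    · refine integral_congr_ae ?_
      filter_upwards [weakGrad_ae_eq_of_mem hΩ hw hf, weakGrad_ae_eq_of_mem hΩ hw' hf']
        with x h1 h2
      rw [h1, h2]
    · refine integral_congr_ae ?_
      filter_upwards [trace_ae_eq_of_mem hd hΩ hw hf, trace_ae_eq_of_mem hd hΩ hw' hf', hβ,
        coeFn_mulL2 β w'.2.2] with x h1 h2 h3 h4
      rw [h1, h2, h4, h3, RCLike.inner_apply, RCLike.inner_apply]
      ring
  · refine congrArg _ (integral_congr_ae ?_)
    filter_upwards [hf, hf'] with x h1 h2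
    rw [h1, h2]

end Sobolev

/-! ### The negative eigenvalues of the localized operator -/

section Localized

open ComplexConjugate

variable {d : ℕ} {Ω : Set (E d)}

theorem inner_mulL2_right {α : Type*} [MeasurableSpace α] {μ : Measure α} {c : Lp ℂ ⊤ μ}
    {b : α → ℝ} (hc : c =ᵐ[μ] fun x => (b x : ℂ)) (f g : Lp ℂ 2 μ) :
    ⟪f, mulL2 c g⟫_ℂ = ⟪mulL2 c f, g⟫_ℂ := by
  rw [L2.inner_def, L2.inner_def]
  refine integral_congr_ae ?_
  filter_upwards [hc, coeFn_mulL2 c f, coeFn_mulL2 c g] with x h1 h2 h3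
  rw [h2, h3, h1, RCLike.inner_apply, RCLike.inner_apply, map_mul, Complex.conj_ofReal]
  ring

theorem conj_tripleForm {b : E d → ℝ} {β : Lp ℂ ⊤ (surface Ω)}
    (hβ : β =ᵐ[surface Ω] fun x => (b x : ℂ)) (Λ : ℝ) (w w' : SobolevTriple Ω) :
    conj (tripleForm β Λ w w') = tripleForm β Λ w' w := by
  rw [tripleForm, tripleForm, map_sub, map_add, map_mul, inner_conj_symm, inner_conj_symm,
    inner_conj_symm, Complex.conj_ofReal, inner_mulL2_right hβ]

theorem re_tripleForm_self (β : Lp ℂ ⊤ (surface Ω)) (Λ : ℝ) (w : SobolevTriple Ω) :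
    (tripleForm β Λ w w).re
      = ‖w.2.1‖ ^ 2 + (⟪w.2.2, mulL2 β w.2.2⟫_ℂ).re - Λ * ‖w.1‖ ^ 2 := by
  rw [tripleForm, Complex.sub_re, Complex.add_re, Complex.re_ofReal_mul]
  congr 2
  · exact inner_self_eq_norm_sq (𝕜 := ℂ) w.2.1
  · exact inner_self_eq_norm_sq (𝕜 := ℂ) w.1

/-- The boundary term, of either sign, is absorbed into half of the gradient term by the trace
inequality with small constant. -/
theorem le_re_tripleForm (hd : d ≠ 0) (hΩ : IsBoundedLipschitzDomain Ω)
    (β : Lp ℂ ⊤ (surface Ω)) (Λ : ℝ) : ∃ C : ℝ, 0 ≤ C ∧ ∀ w ∈ sobolevTriple Ω,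
      1 / 2 * ‖w.2.1‖ ^ 2 - C * ‖w.1‖ ^ 2 ≤ (tripleForm β Λ w w).re := by
  set B := ‖mulL2 β‖ with hB
  have hB0 : 0 ≤ B := norm_nonneg _
  -- With this ε the product Bε is at most 1/2; the summand 1 covers B = 0.
  obtain ⟨C, hC, h⟩ := norm_sq_trace_le hd hΩ (ε := 1 / (2 * (B + 1))) (by positivity)
  refine ⟨B * C + |Λ|, by positivity, fun w hw => ?_⟩
  rw [re_tripleForm_self]
  have h1 : -(B * ‖w.2.2‖ ^ 2) ≤ (⟪w.2.2, mulL2 β w.2.2⟫_ℂ).re := by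
    refine neg_le_of_abs_le ((Complex.abs_re_le_norm _).trans ((norm_inner_le_norm _ _).trans ?_))
    have := (mulL2 β).le_opNorm w.2.2
    calc ‖w.2.2‖ * ‖mulL2 β w.2.2‖ ≤ ‖w.2.2‖ * (B * ‖w.2.2‖) := by gcongr
      _ = B * ‖w.2.2‖ ^ 2 := by ring
  have h2 := mul_le_mul_of_nonneg_left (h w hw) hB0
  have h3 : B * (1 / (2 * (B + 1)) * ‖w.2.1‖ ^ 2) ≤ 1 / 2 * ‖w.2.1‖ ^ 2 := by
    rw [← mul_assoc]
    gcongr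
    rw [mul_one_div, div_le_div_iff₀ (by positivity) (by positivity)]
    linarith
  have h4 : Λ * ‖w.1‖ ^ 2 ≤ |Λ| * ‖w.1‖ ^ 2 := by
    gcongr
    exact le_abs_self _
  nlinarith

theorem continuous_re_tripleForm (β : Lp ℂ ⊤ (surface Ω)) (Λ : ℝ) :
    Continuous fun w : SobolevTriple Ω => (tripleForm β Λ w w).re := by
  unfold tripleForm
  fun_prop

/-- The pairs `(v, (φ v, ∇(φ v), (φ v)|∂Ω))` with `φ v ∈ H¹(Ω)`. -/
noncomputable def localizedSpace (Ω : Set (E d)) (m : Lp ℂ ⊤ (volume.restrict Ω)) :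
    Submodule ℂ (L2 Ω × SobolevTriple Ω) where
  carrier := {x | x.2 ∈ sobolevTriple Ω ∧ x.2.1 = mulL2 m x.1}
  add_mem' := by
    rintro x y ⟨h1, h2⟩ ⟨h3, h4⟩
    refine ⟨add_mem h1 h3, ?_⟩
    change x.2.1 + y.2.1 = mulL2 m (x.1 + y.1)
    rw [map_add, h2, h4]
  zero_mem' := ⟨zero_mem _, (map_zero (mulL2 m)).symm⟩
  smul_mem' := by
    rintro c x ⟨h1, h2⟩
    refine ⟨Submodule.smul_mem _ _ h1, ?_⟩
    change c • x.2.1 = mulL2 m (c • x.1)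
    rw [map_smul, h2]

theorem isClosed_localizedSpace (m : Lp ℂ ⊤ (volume.restrict Ω)) :
    IsClosed (localizedSpace Ω m : Set (L2 Ω × SobolevTriple Ω)) :=
  (isClosed_sobolevTriple.preimage continuous_snd).inter
    (isClosed_eq (continuous_fst.comp continuous_snd) ((mulL2 m).continuous.comp continuous_fst))

/-- The form of `φ (-Δ_b - Λ) φ` as a sesquilinear map. -/
noncomputable def localizedSesq (m : Lp ℂ ⊤ (volume.restrict Ω)) (β : Lp ℂ ⊤ (surface Ω)) (Λ : ℝ) :
    localizedSpace Ω m →ₗ⋆[ℂ] localizedSpace Ω m →ₗ[ℂ] ℂ :=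
  LinearMap.mk₂'ₛₗ (starRingEnd ℂ) (RingHom.id ℂ) (fun x y => tripleForm β Λ x.1.2 y.1.2)
    (fun x y z => by
      simp only [tripleForm, Submodule.coe_add, Prod.snd_add, Prod.fst_add, inner_add_left]
      ring)
    (fun c x y => by
      simp only [tripleForm, Submodule.coe_smul, Prod.smul_snd, Prod.smul_fst, inner_smul_left,
        smul_eq_mul]
      ring)
    (fun x y z => by
      simp only [tripleForm, Submodule.coe_add, Prod.snd_add, Prod.fst_add, inner_add_right,
        map_add]
      ring)
    (fun c x y => by
      simp only [tripleForm, Submodule.coe_smul, Prod.smul_snd, Prod.smul_fst, inner_smul_right,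
        map_smul, smul_eq_mul, RingHom.id_apply]
      ring)

theorem localizedSesq_apply (m : Lp ℂ ⊤ (volume.restrict Ω)) (β : Lp ℂ ⊤ (surface Ω)) (Λ : ℝ)
    (x y : localizedSpace Ω m) : localizedSesq m β Λ x y = tripleForm β Λ x.1.2 y.1.2 := rfl

/-- The graph norm contains ‖v‖, which the form does not control where φ vanishes. Adding a multiple
of ‖v‖² restores coercivity. -/
theorem le_re_localizedSesq (hd : d ≠ 0) (hΩ : IsBoundedLipschitzDomain Ω)
    (m : Lp ℂ ⊤ (volume.restrict Ω)) (β : Lp ℂ ⊤ (surface Ω)) (Λ : ℝ) :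
    ∃ M : ℝ, ∀ x : localizedSpace Ω m,
      1 / 4 * ‖x‖ ^ 2 ≤ (localizedSesq m β Λ x x).re + M * ‖x.1.1‖ ^ 2 := by
  obtain ⟨C, hC, h⟩ := le_re_tripleForm hd hΩ β Λ
  obtain ⟨C₁, hC₁, h₁⟩ := norm_sq_trace_le hd hΩ one_pos
  refine ⟨1 / 4 + (1 / 4 * (1 + C₁) + C) * ‖mulL2 m‖ ^ 2, fun x => ?_⟩
  rw [localizedSesq_apply]
  obtain ⟨⟨v, f, G, t⟩, hx, hxv⟩ := x
  have h2 := h _ hx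
  have h3 := h₁ _ hx
  simp only at h2 h3 hxv ⊢
  have h4 : ‖f‖ ^ 2 ≤ ‖mulL2 m‖ ^ 2 * ‖v‖ ^ 2 := by
    rw [hxv, ← mul_pow]
    gcongr
    exact (mulL2 m).le_opNorm v
  have h5 : ‖(v, f, G, t)‖ ^ 2 ≤ ‖v‖ ^ 2 + ‖f‖ ^ 2 + ‖G‖ ^ 2 + ‖t‖ ^ 2 := by
    have e : ‖(v, f, G, t)‖ = max ‖v‖ (max ‖f‖ (max ‖G‖ ‖t‖)) := rfl
    rw [e]
    rcases max_choice ‖v‖ (max ‖f‖ (max ‖G‖ ‖t‖)) with h | h <;> rw [h]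
    · nlinarith [sq_nonneg ‖f‖, sq_nonneg ‖G‖, sq_nonneg ‖t‖]
    rcases max_choice ‖f‖ (max ‖G‖ ‖t‖) with h | h <;> rw [h]
    · nlinarith [sq_nonneg ‖v‖, sq_nonneg ‖G‖, sq_nonneg ‖t‖]
    rcases max_choice ‖G‖ ‖t‖ with h | h <;> rw [h]
    · nlinarith [sq_nonneg ‖f‖, sq_nonneg ‖v‖, sq_nonneg ‖t‖]
    · nlinarith [sq_nonneg ‖f‖, sq_nonneg ‖G‖, sq_nonneg ‖v‖]
  have h6 : (1 / 4 * (1 + C₁) + C) * ‖f‖ ^ 2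
      ≤ (1 / 4 * (1 + C₁) + C) * (‖mulL2 m‖ ^ 2 * ‖v‖ ^ 2) := by gcongr
  change 1 / 4 * ‖(v, f, G, t)‖ ^ 2 ≤ _
  linarith

theorem norm_inner_sqrt_smul_adjoint_sq {H : Type*} [NormedAddCommGroup H]
    [InnerProductSpace ℂ H] [CompleteSpace H] (T : H →L[ℂ] H) {c : ℝ} (hc : 0 ≤ c) (g v : H) :
    ‖⟪(Real.sqrt c : ℂ) • T.adjoint g, v⟫_ℂ‖ ^ 2 = c * ‖⟪g, T v⟫_ℂ‖ ^ 2 := by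
  rw [inner_smul_left, Complex.conj_ofReal, ContinuousLinearMap.adjoint_inner_left,
    norm_mul, mul_pow, Complex.norm_real, Real.norm_eq_abs, sq_abs, Real.sq_sqrt hc]

/-- The term -C‖φv‖² is traded, by the compactness inequality, for part of the gradient and finitely
many functionals of φv. The adjoint of multiplication by φ turns these into functionals of v. No
multiple of ‖v‖² is lost, which keeps the negative spectrum finite. -/
theorem le_re_localizedSesq_finite_rank (hd : d ≠ 0) (hΩ : IsBoundedLipschitzDomain Ω)
    (m : Lp ℂ ⊤ (volume.restrict Ω)) (β : Lp ℂ ⊤ (surface Ω)) (Λ : ℝ) :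
    ∃ (N : ℕ) (g : Fin N → L2 Ω), ∀ x : localizedSpace Ω m,
      -∑ k, ‖⟪g k, x.1.1⟫_ℂ‖ ^ 2 ≤ (localizedSesq m β Λ x x).re := by
  obtain ⟨C, hC, h⟩ := le_re_tripleForm hd hΩ β Λ
  obtain ⟨N, g, C₁, hC₁, h₁⟩ := norm_sq_le_finite_rank hΩ (ε := 1 / (2 * (C + 1))) (by positivity)
  refine ⟨N, fun k => (Real.sqrt (C * C₁) : ℂ) • (mulL2 m).adjoint (g k), fun x => ?_⟩
  rw [localizedSesq_apply]
  obtain ⟨⟨v, f, G, t⟩, hx, hxv⟩ := x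
  have h2 := h _ hx
  have h3 := mul_le_mul_of_nonneg_left (h₁ _ hx) hC
  simp only at h2 h3 hxv ⊢
  have e : ∀ k, ‖⟪(Real.sqrt (C * C₁) : ℂ) • (mulL2 m).adjoint (g k), v⟫_ℂ‖ ^ 2
      = C * C₁ * ‖⟪g k, f⟫_ℂ‖ ^ 2 := by
    intro k
    rw [hxv]
    exact norm_inner_sqrt_smul_adjoint_sq (mulL2 m) (by positivity) (g k) v
  rw [Finset.sum_congr rfl fun k _ => e k, ← Finset.mul_sum]
  have h4 : C * (1 / (2 * (C + 1)) * ‖G‖ ^ 2) ≤ 1 / 2 * ‖G‖ ^ 2 := by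
    rw [← mul_assoc]
    gcongr
    rw [mul_one_div, div_le_div_iff₀ (by positivity) (by positivity)]
    linarith
  linarith

/-- The negative eigenvalues of `φ (-Δ_b - Λ) φ` with orthonormal eigenfunctions; outside their span
the form is nonnegative. -/
theorem exists_localized_eigenfunctions (hd : d ≠ 0) (hΩ : IsBoundedLipschitzDomain Ω)
    {b : E d → ℝ} (hb : MemLp (fun x => (b x : ℂ)) ⊤ (surface Ω)) (Λ : ℝ) {φ : E d → ℝ}
    (hφ : MemLp (fun x => (φ x : ℂ)) ⊤ (volume.restrict Ω)) :
    ∃ (n : ℕ) (v : Fin n → L2 Ω) (μ : Fin n → ℝ), Orthonormal ℂ v ∧ (∀ i, μ i < 0) ∧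
      (∀ i, FormOperator (localizedDomain Ω φ) (localizedForm Ω b Λ φ) (v i) ((μ i : ℂ) • v i)) ∧
      ∀ w ∈ localizedDomain Ω φ,
        ∑ i, μ i * ‖⟪v i, w⟫_ℂ‖ ^ 2 ≤ (localizedForm Ω b Λ φ w w).re := by
  set m := hφ.toLp with hm
  set β := hb.toLp with hβ
  have hβb : β =ᵐ[surface Ω] fun x => (b x : ℂ) := hb.coeFn_toLp
  have hmφ : ∀ v : L2 Ω, mulL2 m v =ᵐ[volume.restrict Ω] mulFun φ v := by
    intro v
    filter_upwards [coeFn_mulL2 m v, hφ.coeFn_toLp] with x h1 h2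
    rw [h1, hm, h2]
    rfl
  have hfst : ∀ x : localizedSpace Ω m, x.1.2.1 =ᵐ[volume.restrict Ω] mulFun φ x.1.1 := by
    intro x
    rw [x.2.2]
    exact hmφ _
  have hdom : ∀ x : localizedSpace Ω m, x.1.1 ∈ localizedDomain Ω φ := fun x =>
    memH1_of_mem x.2.1 (hfst x)
  -- Every element of the form domain lifts to the complete space of pairs, where the abstract
  -- theorem applies; the projection j recovers v.
  have hex : ∀ w ∈ localizedDomain Ω φ, ∃ x : localizedSpace Ω m, x.1.1 = w := by
    intro w hw
    obtain ⟨t, ht, htw⟩ := MemH1.exists_mem hd hΩ hw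
    exact ⟨⟨(w, t), ht, Lp.ext (htw.trans (hmφ w).symm)⟩, rfl⟩
  have hform : ∀ x y : localizedSpace Ω m,
      localizedForm Ω b Λ φ x.1.1 y.1.1 = localizedSesq m β Λ x y := fun x y =>
    robinForm_eq_tripleForm hd hΩ hβb Λ x.2.1 y.2.1 (hfst x) (hfst y)
  have : CompleteSpace (localizedSpace Ω m) := (isClosed_localizedSpace m).completeSpace_coe
  let j : localizedSpace Ω m →L[ℂ] L2 Ω :=
    (ContinuousLinearMap.fst ℂ (L2 Ω) (SobolevTriple Ω)) ∘L (localizedSpace Ω m).subtypeL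
  have hj : ∀ x, j x = x.1.1 := fun x => rfl
  obtain ⟨M, hM⟩ := le_re_localizedSesq hd hΩ m β Λ
  obtain ⟨N, g, hg⟩ := le_re_localizedSesq_finite_rank hd hΩ m β Λ
  obtain ⟨n, x, μ, hx, hμ, heig, hle⟩ := exists_negative_eigenvectors j (localizedSesq m β Λ)
    (fun x y => conj_tripleForm hβb Λ x.1.2 y.1.2)
    ((continuous_re_tripleForm β Λ).comp (continuous_snd.comp continuous_subtype_val))
    (by norm_num) hM g hg
  refine ⟨n, fun i => j (x i), μ, hx, hμ, fun i => ⟨hdom _, fun w hw => ?_⟩, fun w hw => ?_⟩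
  · obtain ⟨y, rfl⟩ := hex w hw
    exact (hform y (x i)).trans ((heig i y).trans (inner_smul_right _ _ _).symm)
  · obtain ⟨y, rfl⟩ := hex w hw
    exact (hle y).trans_eq (congrArg Complex.re (hform y y).symm)

end Localized

/-! ### Localized plane waves as test functions -/

section TestFunctions

variable {d : ℕ} {Ω : Set (E d)}

theorem hasFDerivAt_planeWave (ξ x : E d) : HasFDerivAt (planeWave ξ)
    ((2 * Real.pi * Complex.I * planeWave ξ x) • (Complex.ofRealCLM ∘L innerSL ℝ ξ)) x := by
  have h1 : HasFDerivAt (fun x : E d => (⟪x, ξ⟫_ℝ : ℂ)) (Complex.ofRealCLM ∘L innerSL ℝ ξ) x := by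
    have h2 : HasFDerivAt (fun x : E d => ⟪ξ, x⟫_ℝ) (innerSL ℝ ξ) x := (innerSL ℝ ξ).hasFDerivAt
    simp only [real_inner_comm]
    exact Complex.ofRealCLM.hasFDerivAt.comp x h2
  have h3 := ((h1.const_mul (2 * Real.pi : ℂ)).mul_const Complex.I).cexp
  refine h3.congr_fderiv ?_
  ext v
  simp only [smul_apply, smul_eq_mul, planeWave]
  ring

theorem cgrad_ofReal_mul_planeWave {φ : E d → ℝ} (hφ : ContDiff ℝ 1 φ) (ξ x : E d) (i : Fin d) :
    cgrad (fun y => (φ y : ℂ) * planeWave ξ y) x i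
      = (fderiv ℝ φ x (EuclideanSpace.single i 1) + (2 * Real.pi * ξ i * φ x : ℝ) * Complex.I)
        * planeWave ξ x := by
  have h1 : HasFDerivAt (fun y => (φ y : ℂ)) (Complex.ofRealCLM ∘L fderiv ℝ φ x) x :=
    Complex.ofRealCLM.hasFDerivAt.comp x (hφ.differentiable one_ne_zero x).hasFDerivAt
  have h2 := (h1.mul (hasFDerivAt_planeWave ξ x)).fderiv
  refine (congrArg (fun T => T (EuclideanSpace.single i 1)) h2).trans ?_
  simp [EuclideanSpace.inner_single_right]
  ring

/-- Since φ is real, ∇φ and 2πξφ enter as real and imaginary parts up to a unimodular factor, so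
there is no cross term. -/
theorem norm_sq_cgrad_ofReal_mul_planeWave {φ : E d → ℝ} (hφ : ContDiff ℝ 1 φ) (ξ x : E d) :
    ‖cgrad (fun y => (φ y : ℂ) * planeWave ξ y) x‖ ^ 2
      = 4 * Real.pi ^ 2 * ‖ξ‖ ^ 2 * |φ x| ^ 2 + ‖gradient φ x‖ ^ 2 := by
  rw [EuclideanSpace.norm_sq_eq, EuclideanSpace.norm_sq_eq, EuclideanSpace.norm_sq_eq,
    Finset.mul_sum, Finset.sum_mul, ← Finset.sum_add_distrib]
  refine Finset.sum_congr rfl fun i _ => ?_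
  have h : gradient φ x i = fderiv ℝ φ x (EuclideanSpace.single i 1) := by
    rw [← inner_gradient_left, EuclideanSpace.inner_single_right]
    simp
  rw [cgrad_ofReal_mul_planeWave hφ, norm_mul, norm_planeWave, mul_one, h, Complex.sq_norm,
    Complex.normSq_add_mul_I, Real.norm_eq_abs, Real.norm_eq_abs, sq_abs, sq_abs, sq_abs]
  ring

/-- The test vector is the bare plane wave, because the localized form itself supplies the factor φ.
The product with φ is C¹ with compact support, so its triple is explicit. -/
theorem planeWave_mem_localizedDomain (hΩ : IsBoundedLipschitzDomain Ω) (hd : d ≠ 0) {φ : E d → ℝ}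
    (hφ : ContDiff ℝ 1 φ) (hφc : HasCompactSupport φ) {b : E d → ℝ}
    (hb : MemLp (fun x => (b x : ℂ)) ⊤ (surface Ω)) (Λ : ℝ) (ξ : E d) :
    (memLp_planeWave hΩ.isBounded.measure_lt_top.ne ξ).toLp ∈ localizedDomain Ω φ ∧
    (localizedForm Ω b Λ φ (memLp_planeWave hΩ.isBounded.measure_lt_top.ne ξ).toLp
      (memLp_planeWave hΩ.isBounded.measure_lt_top.ne ξ).toLp).re
      = 4 * Real.pi ^ 2 * ‖ξ‖ ^ 2 * (∫ x in Ω, |φ x| ^ 2)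
        + ((∫ x, b x * |φ x| ^ 2 ∂(surface Ω)) + (∫ x in Ω, ‖gradient φ x‖ ^ 2)
          - Λ * ∫ x in Ω, |φ x| ^ 2) := by
  have := isFiniteMeasure_surface hd hΩ
  set e := (memLp_planeWave hΩ.isBounded.measure_lt_top.ne ξ).toLp with he
  set u : E d → ℂ := fun y => (φ y : ℂ) * planeWave ξ y with hu
  have hu1 : ContDiff ℝ 1 u := (Complex.ofRealCLM.contDiff.comp hφ).mul
    ((contDiff_planeWave ξ).of_le (by exact_mod_cast le_top))
  have huc : HasCompactSupport u := (hφc.comp_left Complex.ofReal_zero).mul_right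
  have m1 : MemLp u 2 (volume.restrict Ω) := memLp_contDiff hu1.continuous huc
  have m2 : MemLp (cgrad u) 2 (volume.restrict Ω) :=
    memLp_contDiff (continuous_cgrad hu1) (hasCompactSupport_cgrad huc)
  have m3 : MemLp u 2 (surface Ω) := memLp_contDiff hu1.continuous huc
  set w : SobolevTriple Ω := (m1.toLp, m2.toLp, m3.toLp) with hw
  have hwm : w ∈ sobolevTriple Ω := (contDiffTriple Ω).le_topologicalClosure
    ⟨u, hu1, huc, m1.coeFn_toLp, m2.coeFn_toLp, m3.coeFn_toLp⟩
  have hwe : w.1 =ᵐ[volume.restrict Ω] mulFun φ e := by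
    refine m1.coeFn_toLp.trans ?_
    filter_upwards [(memLp_planeWave hΩ.isBounded.measure_lt_top.ne ξ).coeFn_toLp] with x hx
    rw [mulFun, he, hx]
  refine ⟨memH1_of_mem hwm hwe, ?_⟩
  have hnu : ∀ x, ‖u x‖ = |φ x| := fun x => by
    rw [hu, norm_mul, norm_planeWave, mul_one, Complex.norm_real, Real.norm_eq_abs]
  have i1 : Integrable (fun x => |φ x| ^ 2) (volume.restrict Ω) := by
    simpa only [hnu] using (memLp_two_iff_integrable_sq_norm m1.1).1 m1
  have i2 := (memLp_two_iff_integrable_sq_norm m2.1).1 m2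
  simp only [hu, norm_sq_cgrad_ofReal_mul_planeWave hφ] at i2
  have i3 : Integrable (fun x => ‖gradient φ x‖ ^ 2) (volume.restrict Ω) := by
    refine (i2.sub (i1.const_mul (4 * Real.pi ^ 2 * ‖ξ‖ ^ 2))).congr
      (Eventually.of_forall fun x => ?_)
    simp
  have e1 : ‖w.1‖ ^ 2 = ∫ x in Ω, |φ x| ^ 2 := by
    rw [norm_sq_eq_integral]
    refine integral_congr_ae ?_
    filter_upwards [m1.coeFn_toLp] with x hx
    rw [hw, hx, hnu]
  have e2 : ‖w.2.1‖ ^ 2 = 4 * Real.pi ^ 2 * ‖ξ‖ ^ 2 * (∫ x in Ω, |φ x| ^ 2)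
      + ∫ x in Ω, ‖gradient φ x‖ ^ 2 := by
    rw [norm_sq_eq_integral, ← integral_const_mul, ← integral_add (i1.const_mul _) i3]
    refine integral_congr_ae ?_
    filter_upwards [m2.coeFn_toLp] with x hx
    rw [hw, hx, hu, norm_sq_cgrad_ofReal_mul_planeWave hφ]
  have e3 : ⟪w.2.2, mulL2 hb.toLp w.2.2⟫_ℂ = ((∫ x, b x * |φ x| ^ 2 ∂(surface Ω) : ℝ) : ℂ) := by
    rw [L2.inner_def]
    refine (integral_congr_ae ?_).trans integral_ofReal
    filter_upwards [m3.coeFn_toLp, hb.coeFn_toLp, coeFn_mulL2 hb.toLp w.2.2] with x h1 h2 h3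
    rw [h3, h2, hw, h1, RCLike.inner_apply, mul_assoc, Complex.mul_conj,
      Complex.normSq_eq_norm_sq, hnu]
    exact (Complex.ofReal_mul _ _).symm
  have e4 : localizedForm Ω b Λ φ e e = tripleForm hb.toLp Λ w w :=
    robinForm_eq_tripleForm hd hΩ hb.coeFn_toLp Λ hwm hwm hwe hwe
  rw [e4, re_tripleForm_self, e3, e2, e1, Complex.ofReal_re]
  ring

end TestFunctions

/-! ### The lower bounds -/

section Main

variable {d : ℕ} {Ω : Set (E d)}

/-- The pointwise bound is integrated over the ball |ξ| < R. Each coefficient integrates to at most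
1, and μ i < 0 turns this into a bound of ∑ μ i from above. -/
theorem sum_le_of_forall_planeWave_le (hd : d ≠ 0) (hΩ : IsBoundedLipschitzDomain Ω) {n : ℕ}
    {v : Fin n → L2 Ω} {μ : Fin n → ℝ} (hv : Orthonormal ℂ v) (hμ : ∀ i, μ i < 0) {A K : ℝ}
    (h : ∀ ξ, ∑ i, μ i * ‖⟪v i, (memLp_planeWave hΩ.isBounded.measure_lt_top.ne ξ).toLp⟫_ℂ‖ ^ 2
      ≤ 4 * Real.pi ^ 2 * ‖ξ‖ ^ 2 * A + K) {R : ℝ} (hR : 0 < R) :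
    ∑ i, μ i ≤ 4 * Real.pi ^ 2 * A * (d / (d + 2) * omega d * R ^ (d + 2))
      + R ^ d * omega d * K := by
  have hΩm := hΩ.isOpen.measurableSet
  have hfin : volume Ω ≠ ⊤ := hΩ.isBounded.measure_lt_top.ne
  have hint : ∀ i, Integrable fun ξ => μ i * ‖⟪v i, (memLp_planeWave hfin ξ).toLp⟫_ℂ‖ ^ 2 :=
    fun i => (integrable_norm_sq_inner_planeWave hfin hΩm (v i)).const_mul _
  have i1 : IntegrableOn (fun ξ : E d => ‖ξ‖ ^ 2) (Metric.ball 0 R) :=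
    Continuous.integrableOn_of_isBounded Metric.isBounded_ball (by fun_prop)
  have i2 : IntegrableOn (fun _ : E d => K) (Metric.ball 0 R) :=
    integrableOn_const (by finiteness)
  calc ∑ i, μ i
      ≤ ∑ i, μ i * ∫ ξ in Metric.ball (0 : E d) R, ‖⟪v i, (memLp_planeWave hfin ξ).toLp⟫_ℂ‖ ^ 2 := by
        refine Finset.sum_le_sum fun i _ => ?_
        have := integral_norm_sq_inner_planeWave_le hfin hΩm (v i) (Metric.ball 0 R)
        rw [hv.1 i, one_pow] at this
        nlinarith [hμ i]
    _ = ∫ ξ in Metric.ball (0 : E d) R, ∑ i, μ i * ‖⟪v i, (memLp_planeWave hfin ξ).toLp⟫_ℂ‖ ^ 2 := by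
        rw [integral_finsetSum _ fun i _ => (hint i).integrableOn]
        simp only [integral_const_mul]
    _ ≤ ∫ ξ in Metric.ball (0 : E d) R, (4 * Real.pi ^ 2 * A * ‖ξ‖ ^ 2 + K) := by
        refine integral_mono (integrable_finsetSum _ fun i _ => (hint i).integrableOn)
          ((i1.const_mul _).add i2) fun ξ => ?_
        refine (h ξ).trans_eq ?_
        ring
    _ = _ := by
        rw [integral_add (i1.const_mul _) i2, integral_const_mul, integral_norm_sq_ball hd hR,
          setIntegral_const, volume_real_ball hR, smul_eq_mul]

theorem memLp_top_boundary {b : E d → ℝ} (hb_meas : AEMeasurable b (surface Ω))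
    (hb_bdd : ∃ C : ℝ, ∀ x ∈ frontier Ω, |b x| ≤ C) :
    MemLp (fun x => (b x : ℂ)) ⊤ (surface Ω) := by
  obtain ⟨C, hC⟩ := hb_bdd
  refine memLp_top_of_bound
    (Complex.measurable_ofReal.comp_aemeasurable hb_meas).aestronglyMeasurable C ?_
  filter_upwards [ae_restrict_mem isClosed_frontier.measurableSet] with x hx
  rw [Complex.norm_real]
  exact hC x hx

theorem ofReal_le_localizedNegTrace (hd : d ≠ 0) (hΩ : IsBoundedLipschitzDomain Ω) {b : E d → ℝ}
    (hb : MemLp (fun x => (b x : ℂ)) ⊤ (surface Ω)) {Λ : ℝ} (hΛ : 0 < Λ) {φ : E d → ℝ}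
    (hφ : ContDiff ℝ 1 φ) (hφc : HasCompactSupport φ) :
    ENNReal.ofReal
      (L1 d * Λ ^ (1 + (d : ℝ) / 2) * (∫ x in Ω, |φ x| ^ 2)
        - omega d / (2 * Real.pi) ^ d * Λ ^ ((d : ℝ) / 2) *
          ((∫ x, b x * |φ x| ^ 2 ∂(surface Ω)) + ∫ x in Ω, ‖gradient φ x‖ ^ 2))
      ≤ localizedNegTrace Ω b Λ φ := by
  have hφm : MemLp (fun x => (φ x : ℂ)) ⊤ (volume.restrict Ω) :=
    (Complex.continuous_ofReal.comp hφ.continuous).memLp_top_of_hasCompactSupport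
      (hφc.comp_left Complex.ofReal_zero) _
  obtain ⟨n, v, μ, hv, hμ, heig, hle⟩ := exists_localized_eigenfunctions hd hΩ hb Λ hφm
  refine le_trans ?_ (sum_ofReal_neg_le_negTrace _ _ hv heig)
  rw [← ENNReal.ofReal_sum_of_nonneg fun i _ => by linarith [hμ i]]
  refine ENNReal.ofReal_le_ofReal ?_
  rw [Finset.sum_neg_distrib]
  -- On the ball of this radius the symbol 4π²|ξ|² - Λ is negative, and it vanishes on the boundary
  -- sphere.
  have hR : 0 < Real.sqrt Λ / (2 * Real.pi) := by positivity
  have h := sum_le_of_forall_planeWave_le hd hΩ hv hμ (fun ξ => by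
    have h1 := planeWave_mem_localizedDomain hΩ hd hφ hφc hb Λ ξ
    exact (hle _ h1.1).trans_eq h1.2) hR
  set A := ∫ x in Ω, |φ x| ^ 2
  set S := (∫ x, b x * |φ x| ^ 2 ∂(surface Ω)) + ∫ x in Ω, ‖gradient φ x‖ ^ 2
  set R := Real.sqrt Λ / (2 * Real.pi) with hRdef
  have hR2 : 4 * Real.pi ^ 2 * R ^ 2 = Λ := by
    rw [hRdef, div_pow, Real.sq_sqrt hΛ.le]
    field_simp
    ring
  have hRd : R ^ d = Λ ^ ((d : ℝ) / 2) * ((2 * Real.pi) ^ d)⁻¹ := by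
    rw [hRdef, div_pow, Real.sqrt_eq_rpow, ← Real.rpow_natCast, ← Real.rpow_mul hΛ.le,
      div_eq_mul_inv]
    congr 2
    ring
  have hΛ1 : Λ ^ (1 + (d : ℝ) / 2) = Λ * Λ ^ ((d : ℝ) / 2) := by
    rw [Real.rpow_add hΛ, Real.rpow_one]
  -- The kinetic part contributes d/(d+2) and the shift by Λ contributes -1. Their sum -2/(d+2) is
  -- the factor in `L1`.
  have e : 4 * Real.pi ^ 2 * A * (d / (d + 2) * omega d * R ^ (d + 2))
      + R ^ d * omega d * (S - Λ * A)
      = -(L1 d * Λ ^ (1 + (d : ℝ) / 2) * A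
        - omega d / (2 * Real.pi) ^ d * Λ ^ ((d : ℝ) / 2) * S) := by
    have e1 : 4 * Real.pi ^ 2 * A * (d / (d + 2) * omega d * R ^ (d + 2))
        = (4 * Real.pi ^ 2 * R ^ 2) * A * (d / (d + 2) * omega d) * R ^ d := by ring
    rw [e1, hR2, hRd, hΛ1, L1]
    field_simp
    ring
  rw [e] at h
  linarith

/-! ### Removing the cutoff. -/

theorem weakGrad_congr {f f' : E d → ℂ} (h : f =ᵐ[volume.restrict Ω] f') :
    weakGrad Ω f = weakGrad Ω f' := by
  have : HasWeakGrad Ω f = HasWeakGrad Ω f' := funext fun G => propext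
    ⟨fun hG => hG.congr h EventuallyEq.rfl, fun hG => hG.congr h.symm EventuallyEq.rfl⟩
  rw [weakGrad, weakGrad, this]

theorem memH1_congr {f f' : E d → ℂ} (h : f =ᵐ[volume.restrict Ω] f') :
    MemH1 Ω f ↔ MemH1 Ω f' :=
  ⟨fun hf => ⟨hf.1.ae_eq h, hf.2.imp fun _ hG => hG.congr h EventuallyEq.rfl⟩,
    fun hf => ⟨hf.1.ae_eq h.symm, hf.2.imp fun _ hG => hG.congr h.symm EventuallyEq.rfl⟩⟩

theorem trace_congr {f f' : E d → ℂ} (h : f =ᵐ[volume.restrict Ω] f') :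
    trace Ω f = trace Ω f' := by
  have : HasTrace Ω f = HasTrace Ω f' := by
    funext g
    have e : ∀ u : ℕ → E d → ℂ, (fun n => eLpNorm (u n - f) 2 (volume.restrict Ω))
        = fun n => eLpNorm (u n - f') 2 (volume.restrict Ω) := fun u =>
      funext fun n => eLpNorm_congr_ae (EventuallyEq.rfl.sub h)
    simp only [HasTrace, memH1_congr h, weakGrad_congr h, e]
  rw [trace, trace, this]

theorem robinForm_congr {b : E d → ℝ} {Λ : ℝ} {f f' g g' : E d → ℂ}
    (hf : f =ᵐ[volume.restrict Ω] f') (hg : g =ᵐ[volume.restrict Ω] g') :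
    robinForm Ω b Λ f g = robinForm Ω b Λ f' g' := by
  rw [robinForm, robinForm, weakGrad_congr hf, weakGrad_congr hg, trace_congr hf, trace_congr hg]
  refine congrArg _ (congrArg _ (integral_congr_ae ?_))
  filter_upwards [hf, hg] with x h1 h2
  rw [h1, h2]

theorem localizedNegTrace_eq_robinNegTrace (hΩ : MeasurableSet Ω) {b : E d → ℝ} {Λ : ℝ}
    {φ : E d → ℝ} (hφ : ∀ x ∈ Ω, φ x = 1) :
    localizedNegTrace Ω b Λ φ = robinNegTrace Ω b Λ := by
  have h : ∀ v : L2 Ω, mulFun φ v =ᵐ[volume.restrict Ω] v := by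
    intro v
    filter_upwards [ae_restrict_mem hΩ] with x hx
    rw [mulFun, hφ x hx, Complex.ofReal_one, one_mul]
  have e1 : localizedDomain Ω φ = {v : L2 Ω | MemH1 Ω v} := by
    ext v
    exact memH1_congr (h v)
  have e2 : localizedForm Ω b Λ φ = fun w v : L2 Ω => robinForm Ω b Λ w v := by
    funext w v
    exact robinForm_congr (h w) (h v)
  rw [localizedNegTrace, robinNegTrace, e1, e2]

/-- A cutoff equal to 1 on the closure of Ω has zero gradient in Ω, changes neither the volume nor
the boundary integral, and leaves the operator the same. -/
theorem ofReal_le_robinNegTrace (hd : d ≠ 0) (hΩ : IsBoundedLipschitzDomain Ω) {b : E d → ℝ}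
    (hb : MemLp (fun x => (b x : ℂ)) ⊤ (surface Ω)) {Λ : ℝ} (hΛ : 0 < Λ) :
    ENNReal.ofReal
      (L1 d * volume.real Ω * Λ ^ (1 + (d : ℝ) / 2)
        - omega d / (2 * Real.pi) ^ d * (∫ x, b x ∂(surface Ω)) * Λ ^ ((d : ℝ) / 2))
      ≤ robinNegTrace Ω b Λ := by
  obtain ⟨r, hr, hsub⟩ : ∃ r > (0 : ℝ), closure Ω ⊆ Metric.closedBall 0 r := by
    obtain ⟨r, hr⟩ := hΩ.isBounded.closure.subset_closedBall 0
    exact ⟨max r 1, by positivity, hr.trans (Metric.closedBall_subset_closedBall (le_max_left _ _))⟩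
  let φ : ContDiffBump (0 : E d) := ⟨r, r + 1, hr, by linarith⟩
  have h1 : ∀ x ∈ closure Ω, φ x = 1 := fun x hx => φ.one_of_mem_closedBall (hsub hx)
  have hg : ∀ x ∈ Ω, gradient φ x = 0 := by
    intro x hx
    have : (φ : E d → ℝ) =ᶠ[𝓝 x] fun _ => 1 := by
      filter_upwards [hΩ.isOpen.mem_nhds hx] with y hy
      exact h1 y (subset_closure hy)
    rw [this.gradient_eq, gradient_fun_const]
  have e1 : ∫ x in Ω, |φ x| ^ 2 = volume.real Ω := by
    rw [setIntegral_congr_fun hΩ.isOpen.measurableSet (g := fun _ => (1 : ℝ)) fun x hx => by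
      simp [h1 x (subset_closure hx)]]
    simp
  have e2 : ∫ x in Ω, ‖gradient φ x‖ ^ 2 = 0 := by
    rw [setIntegral_congr_fun hΩ.isOpen.measurableSet (g := fun _ => (0 : ℝ)) fun x hx => by
      simp [hg x hx]]
    simp
  have e3 : ∫ x, b x * |φ x| ^ 2 ∂(surface Ω) = ∫ x, b x ∂(surface Ω) := by
    refine setIntegral_congr_fun isClosed_frontier.measurableSet fun x hx => ?_
    simp [h1 x (frontier_subset_closure hx)]
  have h := ofReal_le_localizedNegTrace hd hΩ hb hΛ (φ := φ) φ.contDiff φ.hasCompactSupport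
  rw [e1, e2, e3, localizedNegTrace_eq_robinNegTrace hΩ.isOpen.measurableSet
    fun x hx => h1 x (subset_closure hx)] at h
  refine le_trans (le_of_eq (congrArg ENNReal.ofReal ?_)) h
  ring

end Main
end Robin

/-! ### The localized and the global lower bound. -/

theorem mainTheorem5 {d : ℕ} (hd : 2 ≤ d) (Ω : Set (Robin.E d))
    (hΩ : Robin.IsBoundedLipschitzDomain Ω) (b : Robin.E d → ℝ)
    (hb_meas : AEMeasurable b (Robin.surface Ω))
    (hb_bdd : ∃ C : ℝ, ∀ x ∈ frontier Ω, |b x| ≤ C) (Λ : ℝ) (hΛ : 0 < Λ) :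
    (∀ φ : Robin.E d → ℝ, ContDiff ℝ 1 φ → HasCompactSupport φ →
      ENNReal.ofReal
        (Robin.L1 d * Λ ^ (1 + (d : ℝ) / 2) * (∫ x in Ω, |φ x| ^ 2)
          - Robin.omega d / (2 * Real.pi) ^ d * Λ ^ ((d : ℝ) / 2) *
            ((∫ x, b x * |φ x| ^ 2 ∂(Robin.surface Ω)) + ∫ x in Ω, ‖gradient φ x‖ ^ 2))
        ≤ Robin.localizedNegTrace Ω b Λ φ) ∧
    ENNReal.ofReal
        (Robin.L1 d * volume.real Ω * Λ ^ (1 + (d : ℝ) / 2)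
          - Robin.omega d / (2 * Real.pi) ^ d * (∫ x, b x ∂(Robin.surface Ω))
            * Λ ^ ((d : ℝ) / 2))
        ≤ Robin.robinNegTrace Ω b Λ := by
  have hd0 : d ≠ 0 := by omega
  have hb := Robin.memLp_top_boundary hb_meas hb_bdd
  exact ⟨fun φ hφ hφc => Robin.ofReal_le_localizedNegTrace hd0 hΩ hb hΛ hφ hφc,
    Robin.ofReal_le_robinNegTrace hd0 hΩ hb hΛ⟩
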